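/- Let $g\ge 2$ and let $G$ be a Fuchsian Schottky group of genus $g$, that is, a discrete subgroup of $PSL(2,\mathbb R)$ which is a Schottky group on some $g$ generators. Here a group $G$ of Möbius transformations of the Riemann sphere is a Schottky group on generators $A_1,\dots,A_g$ if there are Jordan curves $C_1,C_1',\dots,C_g,C_g'$ in the sphere which, together with suitable sides of them (their insides), are mutually disjoint, and such that $A_i$ maps $C_i$ onto $C_i'$ and the outside of $C_i$ onto the inside of $C_i'$ for every $i$; it is classical on $A_1,\dots,A_g$ if all these curves can be taken to be geometric circles. A generating set of $G$ always means a generating set of $g$ elements. Let $S=U/G$ be the quotient surface, where $U$ is the upper half plane. (a) If $S$ is not (homeomorphic to) a one-holed torus, then there is a generating set of $G$ on which $G$ is not classical. (b) $G$ is classical on all of its generating sets if and only if $g=2$ and $G$ is generated by a pair of hyperbolic elements with intersecting axes. -/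

import Mathlib

open Matrix Set OnePoint
open scoped MatrixGroups UpperHalfPlane

noncomputable section

namespace FuchsianSchottky

/-- `PSL(2, ℝ)`, the quotient of `SL(2, ℝ)` by its centre `{1, -1}`. It carries the quotient
topology. -/
abbrev PSL2R : Type := PSL(2, ℝ)

/-- If `SL(2, ℝ)` acts on `X` and the centre acts trivially, this is the resulting homomorphism
from `PSL(2, ℝ)` to the permutations of `X`. -/
def liftPerm (X : Type*) [MulAction SL(2, ℝ) X]
    (h : ∀ a ∈ Subgroup.center SL(2, ℝ), ∀ x : X, a • x = x) : PSL2R →* Equiv.Perm X :=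
  QuotientGroup.lift (Subgroup.center SL(2, ℝ)) (MulAction.toPermHom SL(2, ℝ) X)
    (fun a ha => Equiv.ext (h a ha))

theorem center_smul_upperHalfPlane (a : SL(2, ℝ)) (ha : a ∈ Subgroup.center SL(2, ℝ)) (z : ℍ) :
    a • z = z := by
  obtain ⟨r, hr, hra⟩ := Matrix.SpecialLinearGroup.mem_center_iff.mp ha
  have h2 : r ^ 2 = 1 := by simpa using hr
  have hr0 : r ≠ 0 := by rintro rfl; norm_num at h2
  have h00 : a 0 0 = r := by rw [← hra]; simp
  have h11 : a 1 1 = r := by rw [← hra]; simp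
  have h01 : a 0 1 = 0 := by rw [← hra]; simp
  have h10 : a 1 0 = 0 := by rw [← hra]; simp
  apply UpperHalfPlane.ext
  rw [UpperHalfPlane.coe_specialLinearGroup_apply]
  simp [h00, h11, h01, h10, hr0]

/-- The action of `PSL(2, ℝ)` on the upper half plane by `z ↦ (a z + b) / (c z + d)`. -/
instance actionUpperHalfPlane : MulAction PSL2R ℍ :=
  MulAction.compHom ℍ (liftPerm ℍ center_smul_upperHalfPlane)

section ProjectiveLine

variable (K : Type*) [Field K] [DecidableEq K] [Algebra ℝ K]

/-- `SL(2, ℝ)` acts on the projective line `K ∪ {∞}` through `GL(2, K)`. -/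
abbrev slAction : MulAction SL(2, ℝ) (OnePoint K) :=
  MulAction.compHom (OnePoint K)
    ((Matrix.SpecialLinearGroup.toGL (n := Fin 2) (R := K)).comp
      (Matrix.SpecialLinearGroup.map (n := Fin 2) (algebraMap ℝ K)))

theorem center_smul_onePoint (a : SL(2, ℝ)) (ha : a ∈ Subgroup.center SL(2, ℝ))
    (x : OnePoint K) : (slAction K).smul a x = x := by
  obtain ⟨r, hr, hra⟩ := Matrix.SpecialLinearGroup.mem_center_iff.mp ha
  have h2 : r ^ 2 = 1 := by simpa using hr
  have hr0 : r ≠ 0 := by rintro rfl; norm_num at h2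
  have h00 : a 0 0 = r := by rw [← hra]; simp
  have h11 : a 1 1 = r := by rw [← hra]; simp
  have h01 : a 0 1 = 0 := by rw [← hra]; simp
  have h10 : a 1 0 = 0 := by rw [← hra]; simp
  have hK : algebraMap ℝ K r ≠ 0 := by simpa using hr0
  change (Matrix.SpecialLinearGroup.toGL (Matrix.SpecialLinearGroup.map (algebraMap ℝ K) a)) • x
    = x
  cases x with
  | infty => rw [OnePoint.smul_infty_eq_self_iff]; simp [h10]
  | coe k =>
    rw [OnePoint.smul_some_eq_ite]
    simp [h00, h11, h01, h10, hK]

/-- The action of `PSL(2, ℝ)` on `K ∪ {∞}` by Möbius transformations `z ↦ (a z + b) / (c z + d)`.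
For `K = ℂ` this is the action on the Riemann sphere, for `K = ℝ` the one on its boundary circle
`ℝ ∪ {∞}` of the upper half plane. -/
instance actionOnePoint : MulAction PSL2R (OnePoint K) :=
  MulAction.compHom (OnePoint K)
    (@liftPerm (OnePoint K) (slAction K) (center_smul_onePoint K))

end ProjectiveLine

/-- The Riemann sphere `ℂ ∪ {∞}`. -/
abbrev Sphere : Type := OnePoint ℂ

/-- A Jordan curve in the Riemann sphere: the image of an injective continuous map from the
circle. -/
def IsJordanCurve (C : Set Sphere) : Prop :=
  ∃ γ : Circle → Sphere, Continuous γ ∧ Function.Injective γ ∧ range γ = C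

/-- A geometric circle in the Riemann sphere: a Euclidean circle of positive radius in `ℂ`, or a
straight line in `ℂ` together with `∞`. -/
def IsGeometricCircle (C : Set Sphere) : Prop :=
  (∃ (c : ℂ) (r : ℝ), 0 < r ∧ C = (fun z : ℂ => (z : Sphere)) '' {z : ℂ | dist z c = r}) ∨
  (∃ (a : ℂ) (t : ℝ), a ≠ 0 ∧
    C = insert ∞ ((fun z : ℂ => (z : Sphere)) '' {z : ℂ | (starRingEnd ℂ a * z).re = t}))

/-- `D` is one of the connected components of the complement of `C`. -/
def IsSide (C D : Set Sphere) : Prop :=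
  ∃ x ∈ Cᶜ, D = connectedComponentIn Cᶜ x

/-- The Möbius transformations `A₁, …, A_g` pair curves of type `P`: there are curves
`Cᵢ, Cᵢ'` of type `P`, the inside of `Cᵢ` being its complementary component `Dᵢ` and that of `Cᵢ'`
its complementary component `Dᵢ'`, such that the `2g` curves together with their insides are
mutually disjoint (so that there is a region exterior to all the curves), and such that `Aᵢ` maps
`Cᵢ` onto `Cᵢ'` and the outside of `Cᵢ` onto the inside of `Cᵢ'`. -/
def PairsCurves (P : Set Sphere → Prop) {g : ℕ} (A : Fin g → PSL2R) : Prop :=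
  ∃ C D C' D' : Fin g → Set Sphere,
    (∀ i, P (C i) ∧ P (C' i) ∧ IsSide (C i) (D i) ∧ IsSide (C' i) (D' i)) ∧
    (∀ i j, i ≠ j → Disjoint (C i ∪ D i) (C j ∪ D j)) ∧
    (∀ i j, i ≠ j → Disjoint (C' i ∪ D' i) (C' j ∪ D' j)) ∧
    (∀ i j, Disjoint (C i ∪ D i) (C' j ∪ D' j)) ∧
    (∀ i, (fun x : Sphere => A i • x) '' C i = C' i) ∧
    (∀ i, (fun x : Sphere => A i • x) '' (C i ∪ D i)ᶜ = D' i)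

/-- `A₁, …, A_g` generate the group `G`. -/
def Generates {g : ℕ} (A : Fin g → PSL2R) (G : Subgroup PSL2R) : Prop :=
  Subgroup.closure (range A) = G

/-- `G` is a Schottky group (of genus `g`) on the generators `A₁, …, A_g`. -/
def IsSchottkyOn (G : Subgroup PSL2R) {g : ℕ} (A : Fin g → PSL2R) : Prop :=
  Generates A G ∧ PairsCurves IsJordanCurve A

/-- `G` is a classical Schottky group on the generators `A₁, …, A_g`: all the curves can be
taken to be geometric circles. -/
def IsClassicalOn (G : Subgroup PSL2R) {g : ℕ} (A : Fin g → PSL2R) : Prop :=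
  Generates A G ∧ PairsCurves IsGeometricCircle A

/-- `G` is a Fuchsian Schottky group of genus `g`: a discrete subgroup of `PSL(2, ℝ)` which is a
Schottky group on some `g` generators. -/
def IsFuchsianSchottky (g : ℕ) (G : Subgroup PSL2R) : Prop :=
  DiscreteTopology G ∧ ∃ A : Fin g → PSL2R, IsSchottkyOn G A

/-- The quotient surface `ℍ / G`, with the quotient topology. -/
abbrev QuotientSurface (G : Subgroup PSL2R) : Type :=
  Quotient (MulAction.orbitRel G ℍ)

/-- The torus `ℝ/ℤ × ℝ/ℤ` with a closed disc removed (the closed ball of radius `1/4` about `0`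
for the maximum norm, that is, the image of the square `[-1/4, 1/4] × [-1/4, 1/4]`). -/
abbrev OneHoledTorus : Type :=
  {p : UnitAddCircle × UnitAddCircle // 1 / 4 < ‖p‖}

/-- A topological space is a one-holed torus if it is homeomorphic to a torus with a closed disc
removed. -/
def IsOneHoledTorus (S : Type*) [TopologicalSpace S] : Prop :=
  Nonempty (S ≃ₜ OneHoledTorus)

/-- An element of `PSL(2, ℝ)` is hyperbolic if it is represented by a matrix with two distinct real
eigenvalues. -/
def IsHyperbolic (A : PSL2R) : Prop :=
  ∃ a : SL(2, ℝ), (QuotientGroup.mk a : PSL2R) = A ∧ (a : Matrix (Fin 2) (Fin 2) ℝ).IsHyperbolic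

/-- The axis of a hyperbolic element of `PSL(2, ℝ)`: the geodesic of the upper half plane whose
endpoints are the two fixed points in `ℝ ∪ {∞}`. It is the half circle with diameter `[p, q]` if
the fixed points are `p, q ∈ ℝ`, and the vertical half line over `p` if they are `p ∈ ℝ` and `∞`. -/
def axis (A : PSL2R) : Set ℍ :=
  {z | (∃ p q : ℝ, p ≠ q ∧ A • (p : OnePoint ℝ) = p ∧ A • (q : OnePoint ℝ) = q ∧
          dist (z : ℂ) (((p + q) / 2 : ℝ) : ℂ) = |p - q| / 2) ∨
       (∃ p : ℝ, A • (p : OnePoint ℝ) = p ∧ A • (∞ : OnePoint ℝ) = ∞ ∧ z.re = p)}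

end FuchsianSchottky

end

noncomputable section

namespace FuchsianSchottky

-- The argument is governed by `commDet a b = det (a b - b a) = 2 - tr [a, b]`. If it is positive,
-- the traceless matrix `a b - b a` is elliptic and its fixed point lies on both axes. Conversely,
-- matrices whose axes meet can be conjugated to symmetric ones, and then `commDet` is a square.
--
-- The Jordan curves enter through ping-pong (`PairsCurves.exists_pingPong`): the group is free on
-- the given generators, distinct generators do not commute, and every nontrivial element is
-- hyperbolic (`PingPong.four_lt_trace_sq`). In particular the commutator of noncommuting elements
-- has `(2 - commDet) ^ 2 > 4`, so crossing axes force `commDet > 4`, that is, `tr [a, b] < -2`.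
--
-- Always classical implies crossing. If the paired curves are circles, then a circle of one
-- generator `c` separates the axis of another generator from the `c`-conjugate of any generator
-- other than `c` (`commDet_conj_nonpos`). Suppose that `a`, `b` belong to a generating set and do
-- not cross. Replacing `a` by `a b⁻¹` and by `a b` keeps a generating set; the separation there
-- gives an upper bound for `tr a tr b tr (a b⁻¹)` and one for `tr a tr b tr (a b)`. Their sum
-- contradicts `tr² > 4`. So any two generators in any generating set cross. With a third generator
-- `c`, one may replace `b` by `c b c⁻¹`, whose axis is separated from that of `a`; hence `g = 2`
-- (`crossing_of_always_classical`).
--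
-- Crossing implies always classical. A pair with `commDet > 4` pairs four circles
-- (`pairsCurves_of_commDet`): with the crossing point at the centre of the Klein disc, a suitable
-- rotation makes the sides of a rectangle with its corners outside the disc the required geodesics.
-- Any other pair of generators also has `commDet > 4`, since `commDet` does not change under a
-- change of basis of the free group (`commDet_lift`). This is shown without Nielsen's theorem: a
-- basis change acts on trace coordinates by polynomial maps that preserve the ideal of the Fricke
-- polynomial up to a unit, and the quaternion group shows that this unit is `1`.
--
-- For part (a), the same rectangle, cut by the disc, is a fundamental cell whose opposite sides are
-- glued by isometries. An explicit map identifies this glued cell with a torus minus a closed disc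
-- (`exists_isTorusModel`, `isOneHoledTorus_of_commDet`). So a group that is classical on all
-- generating sets has a one-holed torus as its quotient.

-- The action on the sphere in homogeneous coordinates

theorem exists_rep (A : PSL2R) : ∃ a : SL(2, ℝ), (QuotientGroup.mk a : PSL2R) = A :=
  QuotientGroup.mk_surjective A

theorem mk_smul_sphere (a : SL(2, ℝ)) (x : Sphere) :
    (QuotientGroup.mk a : PSL2R) • x
      = Matrix.SpecialLinearGroup.toGL (Matrix.SpecialLinearGroup.map (algebraMap ℝ ℂ) a) • x := rfl

theorem mk_smul_upperHalfPlane (a : SL(2, ℝ)) (z : ℍ) :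
    (QuotientGroup.mk a : PSL2R) • z = a • z := rfl

theorem mk_smul_realLine (a : SL(2, ℝ)) (x : OnePoint ℝ) :
    (QuotientGroup.mk a : PSL2R) • x
      = Matrix.SpecialLinearGroup.toGL (Matrix.SpecialLinearGroup.map (algebraMap ℝ ℝ) a) • x := rfl

/-- The point of the sphere with homogeneous coordinates `(p, q)`. -/
def ofHom (p q : ℂ) : Sphere := if q = 0 then ∞ else ((p / q : ℂ) : Sphere)

theorem ofHom_coe (z : ℂ) : ofHom z 1 = (z : Sphere) := by simp [ofHom]

theorem ofHom_infty : ofHom 1 0 = ∞ := by simp [ofHom]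

theorem exists_ofHom (x : Sphere) : ∃ p q : ℂ, (p ≠ 0 ∨ q ≠ 0) ∧ ofHom p q = x := by
  cases x using OnePoint.rec with
  | infty => exact ⟨1, 0, by simp, ofHom_infty⟩
  | coe z => exact ⟨z, 1, by simp, ofHom_coe z⟩

theorem det_eq (a : SL(2, ℝ)) : a 0 0 * a 1 1 - a 0 1 * a 1 0 = 1 := by
  have := a.det_coe
  rwa [Matrix.det_fin_two] at this

theorem mk_smul_ofHom (a : SL(2, ℝ)) {p q : ℂ} (h : p ≠ 0 ∨ q ≠ 0) :
    (QuotientGroup.mk a : PSL2R) • ofHom p q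
      = ofHom (a 0 0 * p + a 0 1 * q) (a 1 0 * p + a 1 1 * q) := by
  rw [mk_smul_sphere]
  unfold ofHom
  by_cases hq : q = 0
  · subst hq
    have hp : p ≠ 0 := by simpa using h
    simp only [if_true, smul_infty_eq_ite]
    by_cases hc : a 1 0 = 0
    · simp [hc]
    · simp [hc, hp]
      field_simp
  · rw [if_neg hq, smul_some_eq_ite]
    have e : (a 1 0 : ℂ) * (p / q) + a 1 1 = (a 1 0 * p + a 1 1 * q) / q := by field_simp
    have e' : (a 0 0 : ℂ) * (p / q) + a 0 1 = (a 0 0 * p + a 0 1 * q) / q := by field_simp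
    have m : ∀ i j, (Matrix.SpecialLinearGroup.toGL
        (Matrix.SpecialLinearGroup.map (algebraMap ℝ ℂ) a)) i j = (a i j : ℂ) := fun i j => rfl
    rw [m, m, m, m, e, e']
    by_cases h0 : (a 1 0 * p + a 1 1 * q : ℂ) = 0
    · simp [h0]
    · rw [if_neg h0, if_neg (div_ne_zero h0 hq)]
      congr 1
      field_simp

theorem hom_ne_zero (a : SL(2, ℝ)) {p q : ℂ} (h : p ≠ 0 ∨ q ≠ 0) :
    (a 0 0 * p + a 0 1 * q ≠ 0) ∨ (a 1 0 * p + a 1 1 * q ≠ 0) := by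
  by_contra! h0
  have hd : (a 0 0 * a 1 1 - a 0 1 * a 1 0 : ℂ) = 1 := by exact_mod_cast det_eq a
  have hp : p = 0 := by linear_combination (a 1 1 : ℂ) * h0.1 - a 0 1 * h0.2 - p * hd
  have hq : q = 0 := by linear_combination (a 0 0 : ℂ) * h0.2 - a 1 0 * h0.1 - q * hd
  simp [hp, hq] at h

theorem real_hom_ne_zero (a : SL(2, ℝ)) {x y : ℝ} (h : x ≠ 0 ∨ y ≠ 0) :
    (a 0 0 * x + a 0 1 * y ≠ 0) ∨ (a 1 0 * x + a 1 1 * y ≠ 0) := by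
  have := hom_ne_zero a (p := x) (q := y) (by simpa using h)
  exact_mod_cast this

-- Circles and their sides as sign sets of Hermitian forms

/-- The Hermitian form `α |p|² + 2 Re (β p q̄) + γ |q|²`. -/
def herm (α : ℝ) (β : ℂ) (γ : ℝ) (p q : ℂ) : ℝ :=
  α * Complex.normSq p + 2 * (β * p * starRingEnd ℂ q).re + γ * Complex.normSq q

/-- The sign of a Hermitian form as a function on the sphere: its value at `(1, 0)` or `(z, 1)`. -/
def hermVal (α : ℝ) (β : ℂ) (γ : ℝ) : Sphere → ℝ
  | ∞ => α
  | (z : ℂ) => herm α β γ z 1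

theorem hermVal_infty (α : ℝ) (β : ℂ) (γ : ℝ) : hermVal α β γ ∞ = α := rfl

theorem hermVal_coe (α : ℝ) (β : ℂ) (γ : ℝ) (z : ℂ) :
    hermVal α β γ (z : Sphere) = α * Complex.normSq z + 2 * (β * z).re + γ := by
  change herm α β γ z 1 = _
  simp [herm]

theorem herm_smul (α : ℝ) (β : ℂ) (γ : ℝ) (t p q : ℂ) :
    herm α β γ (t * p) (t * q) = Complex.normSq t * herm α β γ p q := by
  simp only [herm, Complex.normSq_apply, Complex.mul_re, Complex.mul_im, Complex.conj_re,
    Complex.conj_im]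
  ring

/-- Rescaling homogeneous coordinates by `t` multiplies the form by `|t|² > 0`, so its sign is well
defined on the sphere and may be read off from any representative. -/
theorem hermVal_ofHom (α : ℝ) (β : ℂ) (γ : ℝ) {p q : ℂ} (h : p ≠ 0 ∨ q ≠ 0) :
    ∃ t : ℝ, 0 < t ∧ herm α β γ p q = t * hermVal α β γ (ofHom p q) := by
  by_cases hq : q = 0
  · subst hq
    refine ⟨Complex.normSq p, Complex.normSq_pos.mpr (by simpa using h), ?_⟩
    simp [ofHom, hermVal_infty, herm, mul_comm]
  · refine ⟨Complex.normSq q, Complex.normSq_pos.mpr hq, ?_⟩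
    rw [ofHom, if_neg hq]
    change _ = _ * herm α β γ (p / q) 1
    rw [← herm_smul]
    congr 1
    · field_simp
    · simp

theorem hermVal_neg_iff (α : ℝ) (β : ℂ) (γ : ℝ) {p q : ℂ} (h : p ≠ 0 ∨ q ≠ 0) :
    hermVal α β γ (ofHom p q) < 0 ↔ herm α β γ p q < 0 := by
  obtain ⟨t, ht, e⟩ := hermVal_ofHom α β γ h
  rw [e, mul_neg_iff]
  constructor
  · intro h; exact Or.inl ⟨ht, h⟩
  · rintro (h | h)
    · exact h.2
    · linarith [h.1]

theorem hermVal_zero_iff (α : ℝ) (β : ℂ) (γ : ℝ) {p q : ℂ} (h : p ≠ 0 ∨ q ≠ 0) :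
    hermVal α β γ (ofHom p q) = 0 ↔ herm α β γ p q = 0 := by
  obtain ⟨t, ht, e⟩ := hermVal_ofHom α β γ h
  rw [e, mul_eq_zero]
  simp [ht.ne']

theorem hermVal_neg (α : ℝ) (β : ℂ) (γ : ℝ) (x : Sphere) :
    hermVal (-α) (-β) (-γ) x = - hermVal α β γ x := by
  cases x using OnePoint.rec with
  | infty => simp [hermVal_infty]
  | coe z => simp [hermVal_coe]; ring

theorem exists_center (α : ℝ) (β : ℂ) (γ : ℝ) (hα : α ≠ 0)
    (h : 0 < Complex.normSq β - α * γ) :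
    ∃ (c : ℂ) (r : ℝ), 0 < r ∧
      ∀ z : ℂ, hermVal α β γ (z : Sphere) = α * (dist z c ^ 2 - r ^ 2) := by
  refine ⟨-(starRingEnd ℂ β) / α, √(Complex.normSq β - α * γ) / |α|, by positivity, fun z => ?_⟩
  rw [hermVal_coe, div_pow, Real.sq_sqrt h.le, sq_abs, dist_eq_norm, ← Complex.normSq_eq_norm_sq]
  have e : z - -(starRingEnd ℂ β) / α = (1 / α : ℝ) * (α * z + starRingEnd ℂ β) := by
    have : (α : ℂ) ≠ 0 := by exact_mod_cast hα
    push_cast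
    field_simp
    ring
  rw [e, Complex.normSq_mul, Complex.normSq_ofReal]
  simp only [Complex.normSq_apply, Complex.mul_re, Complex.mul_im, Complex.add_re, Complex.add_im,
    Complex.conj_re, Complex.conj_im, Complex.ofReal_re, Complex.ofReal_im]
  field_simp
  ring

theorem isPreconnected_exterior (c : ℂ) {r : ℝ} (hr : 0 < r) :
    IsPreconnected {z : ℂ | r < dist z c} := by
  have e : {z : ℂ | r < dist z c}
      = (fun p : ℝ × ℝ => c + p.1 * Complex.exp (p.2 * Complex.I)) '' (Ioi r ×ˢ univ) := by
    ext z
    simp only [mem_ofPred_eq, mem_image, mem_prod, mem_Ioi, mem_univ, and_true, Prod.exists]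
    constructor
    · intro h
      refine ⟨‖z - c‖, Complex.arg (z - c), by rwa [← dist_eq_norm], ?_⟩
      rw [Complex.norm_mul_exp_arg_mul_I]
      ring
    · rintro ⟨s, t, hs, rfl⟩
      simpa [dist_eq_norm, Complex.norm_exp_ofReal_mul_I, abs_of_pos (hr.trans hs)] using hs
  rw [e]
  apply IsPreconnected.image
  · exact ((convex_Ioi r).prod convex_univ).isPreconnected
  · fun_prop

theorem isPreconnected_exterior_infty (c : ℂ) {r : ℝ} (hr : 0 < r) :
    IsPreconnected (insert ∞ ((fun z : ℂ => (z : Sphere)) '' {z : ℂ | r < dist z c})) := by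
  have h1 : IsPreconnected ((fun z : ℂ => (z : Sphere)) '' {z : ℂ | r < dist z c}) :=
    (isPreconnected_exterior c hr).image _ OnePoint.continuous_coe.continuousOn
  refine h1.subset_closure (subset_insert _ _) (insert_subset ?_ subset_closure)
  rw [mem_closure_iff_nhds]
  intro t ht
  have hb : IsCompact (Metric.closedBall c r) := isCompact_closedBall c r
  have h2 := OnePoint.tendsto_coe_infty (X := ℂ) ht
  rw [Filter.mem_map, Filter.coclosedCompact_eq_cocompact] at h2
  have h3 : (Metric.closedBall c r)ᶜ ∈ Filter.cocompact ℂ := hb.compl_mem_cocompact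
  obtain ⟨z, hz, hz'⟩ := (Filter.nonempty_of_mem (Filter.inter_mem h2 h3))
  exact ⟨z, hz, z, by simpa using hz', rfl⟩

/-- The sign of `α` decides the shape: the exterior of a closed disc together with `∞`, an open half
plane, or an open disc. -/
theorem isOpen_preconnected_hermVal_neg (α : ℝ) (β : ℂ) (γ : ℝ)
    (h : 0 < Complex.normSq β - α * γ) :
    IsOpen {x | hermVal α β γ x < 0} ∧ IsPreconnected {x | hermVal α β γ x < 0} ∧
      {x | hermVal α β γ x < 0}.Nonempty := by
  rcases lt_trichotomy α 0 with hα | rfl | hα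
  · obtain ⟨c, r, hr, e⟩ := exists_center α β γ hα.ne h
    have es : {x | hermVal α β γ x < 0}
        = insert ∞ ((fun z : ℂ => (z : Sphere)) '' {z : ℂ | r < dist z c}) := by
      ext x
      induction x using OnePoint.rec with
      | infty => simp [hermVal_infty, hα]
      | coe z =>
        simp only [mem_ofPred_eq, e, mem_insert_iff, OnePoint.coe_ne_infty, false_or, mem_image,
          OnePoint.coe_eq_coe, exists_eq_right]
        rw [mul_neg_iff]
        simp only [hα, hα.le.not_gt, false_and, true_and, false_or, sub_pos]
        exact sq_lt_sq₀ hr.le dist_nonneg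
    refine ⟨?_, ?_, ⟨∞, hα⟩⟩
    · have e2 : {x | hermVal α β γ x < 0}
          = ((fun z : ℂ => (z : Sphere)) '' Metric.closedBall c r)ᶜ := by
        rw [es]
        ext x
        induction x using OnePoint.rec with
        | infty => simp
        | coe z => simp
      rw [e2]
      exact OnePoint.isOpen_compl_image_coe.mpr
        ⟨Metric.isClosed_closedBall, isCompact_closedBall c r⟩
    · rw [es]
      exact isPreconnected_exterior_infty c hr
  · have hβ : 0 < Complex.normSq β := by simpa using h
    have es : {x | hermVal 0 β γ x < 0}
        = (fun z : ℂ => (z : Sphere)) '' {z : ℂ | 2 * (β * z).re + γ < 0} := by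
      ext x
      induction x using OnePoint.rec with
      | infty => simp [hermVal_infty]
      | coe z => simp [hermVal_coe]
    rw [es]
    refine ⟨?_, ?_, ?_⟩
    · apply OnePoint.isOpenEmbedding_coe.isOpenMap
      exact isOpen_lt (by fun_prop) continuous_const
    · apply IsPreconnected.image _ _ OnePoint.continuous_coe.continuousOn
      apply Convex.isPreconnected
      have : {z : ℂ | 2 * (β * z).re + γ < 0} = {z : ℂ | (β * z).re < -γ / 2} := by
        ext z; simp only [mem_ofPred_eq]; constructor <;> intro h <;> linarith
      rw [this]
      apply convex_halfSpace_lt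
      constructor
      · intro x y; simp [mul_add]
      · intro c x; simp; ring
    · refine Nonempty.image _ ⟨(((-γ / 2 - 1) / Complex.normSq β : ℝ) : ℂ) * starRingEnd ℂ β, ?_⟩
      have : β * ((((-γ / 2 - 1) / Complex.normSq β : ℝ) : ℂ) * starRingEnd ℂ β)
          = (((-γ / 2 - 1) : ℝ) : ℂ) := by
        rw [mul_left_comm, Complex.mul_conj, ← Complex.ofReal_mul, div_mul_cancel₀ _ hβ.ne']
      rw [mem_ofPred_eq, this, Complex.ofReal_re]
      linarith
  · obtain ⟨c, r, hr, e⟩ := exists_center α β γ hα.ne' h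
    have es : {x | hermVal α β γ x < 0} = (fun z : ℂ => (z : Sphere)) '' Metric.ball c r := by
      ext x
      induction x using OnePoint.rec with
      | infty => simp [hermVal_infty, hα.le]
      | coe z =>
        simp only [mem_ofPred_eq, e, mem_image, OnePoint.coe_eq_coe, exists_eq_right,
          Metric.mem_ball]
        rw [mul_neg_iff]
        simp only [hα, hα.le.not_gt, false_and, true_and, or_false, sub_neg]
        exact sq_lt_sq₀ dist_nonneg hr.le
    rw [es]
    refine ⟨OnePoint.isOpenEmbedding_coe.isOpenMap _ Metric.isOpen_ball, ?_,
      (Metric.nonempty_ball.mpr hr).image _⟩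
    exact (convex_ball c r).isPreconnected.image _ OnePoint.continuous_coe.continuousOn

theorem isGeometricCircle_hermVal_zero (α : ℝ) (β : ℂ) (γ : ℝ)
    (h : 0 < Complex.normSq β - α * γ) : IsGeometricCircle {x | hermVal α β γ x = 0} := by
  by_cases hα : α = 0
  · subst hα
    right
    refine ⟨starRingEnd ℂ β, -γ / 2, ?_, ?_⟩
    · rintro h0
      have : β = 0 := by simpa using h0
      simp [this] at h
    · ext x
      induction x using OnePoint.rec with
      | infty => simp [hermVal_infty]
      | coe z =>
        simp only [mem_ofPred_eq, hermVal_coe, mem_insert_iff, OnePoint.coe_ne_infty, false_or,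
          mem_image, OnePoint.coe_eq_coe, exists_eq_right, Complex.conj_conj]
        constructor <;> intro h <;> linarith
  · obtain ⟨c, r, hr, e⟩ := exists_center α β γ hα h
    refine Or.inl ⟨c, r, hr, ?_⟩
    ext x
    induction x using OnePoint.rec with
    | infty => simp [hermVal_infty, hα]
    | coe z =>
      simp only [mem_ofPred_eq, e, mem_image, OnePoint.coe_eq_coe, exists_eq_right, mul_eq_zero, hα,
        false_or, sub_eq_zero]
      exact sq_eq_sq₀ dist_nonneg hr.le

theorem IsGeometricCircle.exists_herm {C : Set Sphere} (h : IsGeometricCircle C) :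
    ∃ (α : ℝ) (β : ℂ) (γ : ℝ), 0 < Complex.normSq β - α * γ ∧ C = {x | hermVal α β γ x = 0} := by
  rcases h with ⟨c, r, hr, rfl⟩ | ⟨a, t, ha, rfl⟩
  · refine ⟨1, -starRingEnd ℂ c, Complex.normSq c - r ^ 2, ?_, ?_⟩
    · rw [Complex.normSq_neg, Complex.normSq_conj]
      have := pow_pos hr 2
      linarith
    · ext x
      induction x using OnePoint.rec with
      | infty => simp [hermVal_infty]
      | coe z =>
        simp only [mem_ofPred_eq, hermVal_coe, mem_image, OnePoint.coe_eq_coe, exists_eq_right]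
        rw [← sq_eq_sq₀ dist_nonneg hr.le, dist_eq_norm, ← Complex.normSq_eq_norm_sq,
          ← sub_eq_zero]
        simp only [Complex.normSq_apply, Complex.sub_re, Complex.sub_im, Complex.mul_re,
          Complex.neg_re, Complex.neg_im, Complex.conj_re, Complex.conj_im]
        constructor <;> intro h <;> linarith
  · refine ⟨0, starRingEnd ℂ a, -2 * t, ?_, ?_⟩
    · simpa using ha
    · ext x
      induction x using OnePoint.rec with
      | infty => simp [hermVal_infty]
      | coe z =>
        simp only [mem_ofPred_eq, hermVal_coe, mem_insert_iff, OnePoint.coe_ne_infty, false_or,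
          mem_image, OnePoint.coe_eq_coe, exists_eq_right]
        constructor <;> intro h <;> linarith

/-- The negative and the positive set are open, disjoint and cover the complement of the circle, and
the negative set is connected; so it is a whole component. -/
theorem connectedComponentIn_eq_of_hermVal_neg (α : ℝ) (β : ℂ) (γ : ℝ)
    (h : 0 < Complex.normSq β - α * γ) {x : Sphere} (hx : hermVal α β γ x < 0) :
    connectedComponentIn {x | hermVal α β γ x = 0}ᶜ x = {x | hermVal α β γ x < 0} := by
  obtain ⟨o, p, -⟩ := isOpen_preconnected_hermVal_neg α β γ h
  have h' : 0 < Complex.normSq (-β) - (-α) * (-γ) := by simpa using h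
  obtain ⟨o', -, -⟩ := isOpen_preconnected_hermVal_neg (-α) (-β) (-γ) h'
  apply Subset.antisymm
  · refine isPreconnected_connectedComponentIn.subset_left_of_subset_union o o' ?_ ?_
      ⟨x, mem_connectedComponentIn (by simpa using hx.ne), hx⟩
    · rw [Set.disjoint_left]
      intro y hy hy'
      simp only [mem_ofPred_eq, hermVal_neg] at hy hy'
      linarith
    · refine (connectedComponentIn_subset _ _).trans fun y hy => ?_
      simp only [mem_compl_iff, mem_ofPred_eq, mem_union, hermVal_neg, Left.neg_neg_iff] at hy ⊢
      exact lt_or_gt_of_ne hy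
  · exact p.subset_connectedComponentIn hx fun y hy => ne_of_lt hy

theorem isSide_hermVal_neg (α : ℝ) (β : ℂ) (γ : ℝ) (h : 0 < Complex.normSq β - α * γ) :
    IsSide {x | hermVal α β γ x = 0} {x | hermVal α β γ x < 0} := by
  obtain ⟨x, hx⟩ := (isOpen_preconnected_hermVal_neg α β γ h).2.2
  exact ⟨x, by simpa using ne_of_lt hx,
    (connectedComponentIn_eq_of_hermVal_neg α β γ h hx).symm⟩

theorem IsSide.exists_herm {C D : Set Sphere} (hC : IsGeometricCircle C) (hD : IsSide C D) :
    ∃ (α : ℝ) (β : ℂ) (γ : ℝ), D = {x | hermVal α β γ x < 0} := by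
  obtain ⟨α, β, γ, h, rfl⟩ := hC.exists_herm
  obtain ⟨x, hx, rfl⟩ := hD
  rcases lt_or_gt_of_ne (by simpa using hx : hermVal α β γ x ≠ 0) with hn | hp
  · exact ⟨α, β, γ, connectedComponentIn_eq_of_hermVal_neg α β γ h hn⟩
  · refine ⟨-α, -β, -γ, ?_⟩
    rw [← connectedComponentIn_eq_of_hermVal_neg (-α) (-β) (-γ) (by simpa using h) (x := x)
      (by simpa [hermVal_neg] using hp)]
    simp [hermVal_neg]

/-- Fixed points of hyperbolic elements are real, so only the trace of a disc on the real circle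
matters, and there the Hermitian form becomes a binary quadratic form. -/
theorem IsSide.exists_real_form {C D : Set Sphere} (hC : IsGeometricCircle C) (hD : IsSide C D) :
    ∃ α β γ : ℝ, ∀ x y : ℝ, (x ≠ 0 ∨ y ≠ 0) →
      (ofHom x y ∈ D ↔ α * x ^ 2 + 2 * β * x * y + γ * y ^ 2 < 0) := by
  obtain ⟨α, β, γ, rfl⟩ := hD.exists_herm hC
  refine ⟨α, β.re, γ, fun x y h => ?_⟩
  rw [mem_ofPred_eq, hermVal_neg_iff _ _ _ (by simpa using h)]
  apply iff_of_eq
  congr 1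
  simp only [herm, Complex.normSq_ofReal, Complex.conj_ofReal, Complex.mul_re, Complex.mul_im,
    Complex.ofReal_re, Complex.ofReal_im]
  ring

theorem IsGeometricCircle.isClosed {C : Set Sphere} (h : IsGeometricCircle C) : IsClosed C := by
  obtain ⟨α, β, γ, hd, rfl⟩ := h.exists_herm
  obtain ⟨o, -, -⟩ := isOpen_preconnected_hermVal_neg α β γ hd
  obtain ⟨o', -, -⟩ := isOpen_preconnected_hermVal_neg (-α) (-β) (-γ) (by simpa using hd)
  rw [← isOpen_compl_iff]
  convert o.union o' using 1
  ext y
  simp only [mem_compl_iff, mem_ofPred_eq, mem_union, hermVal_neg, Left.neg_neg_iff]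
  exact ne_iff_lt_or_gt

theorem IsJordanCurve.isClosed {C : Set Sphere} (h : IsJordanCurve C) : IsClosed C := by
  obtain ⟨γ, hγ, -, rfl⟩ := h
  exact (isCompact_range hγ).isClosed

-- Ping-pong

/-- The generator or inverse generator attached to a letter. -/
def letter {ι : Type*} (A : ι → PSL2R) (l : ι × Bool) : PSL2R :=
  bif l.2 then A l.1 else (A l.1)⁻¹

/-- Ping-pong data on the sphere: closed sets `K l` indexed by the letters, containing sets `D l`,
such that each letter `l` maps the complement of `K l⁻¹` into `D l`. -/
structure PingPong {ι : Type*} (A : ι → PSL2R) (K D : ι × Bool → Set Sphere) : Prop where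
  isClosed : ∀ l, IsClosed (K l)
  nonempty : ∀ l, (K l).Nonempty
  subset : ∀ l, D l ⊆ K l
  disjoint : ∀ l m, l ≠ m → Disjoint (K l) (K m)
  maps : ∀ l x, x ∉ K (l.1, !l.2) → letter A l • x ∈ D l

/-- A limit point of a component of `Cᶜ` that is not on `C` can be added to the component without
disconnecting it, so it already belongs to it. -/
theorem IsSide.isClosed_union {C D : Set Sphere} (hC : IsClosed C) (h : IsSide C D) :
    IsClosed (C ∪ D) := by
  obtain ⟨x, hx, rfl⟩ := h
  have hcl : closure (connectedComponentIn Cᶜ x) ⊆ C ∪ connectedComponentIn Cᶜ x := by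
    intro y hy
    by_cases hyC : y ∈ C
    · exact Or.inl hyC
    · right
      have p : IsPreconnected (insert y (connectedComponentIn Cᶜ x)) :=
        isPreconnected_connectedComponentIn.subset_closure (subset_insert _ _)
          (insert_subset hy subset_closure)
      exact p.subset_connectedComponentIn (mem_insert_of_mem _ (mem_connectedComponentIn hx))
        (insert_subset hyC (connectedComponentIn_subset _ _)) (mem_insert _ _)
  have : C ∪ connectedComponentIn Cᶜ x = C ∪ closure (connectedComponentIn Cᶜ x) :=
    Subset.antisymm (union_subset_union_right _ subset_closure)
      (union_subset subset_union_left hcl)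
  rw [this]
  exact hC.union isClosed_closure

theorem smul_compl_inv {A : PSL2R} {C D C' D' : Set Sphere}
    (hC : (fun x : Sphere => A • x) '' C = C')
    (hD : (fun x : Sphere => A • x) '' (C ∪ D)ᶜ = D') {x : Sphere} (hx : x ∉ C' ∪ D') :
    A⁻¹ • x ∈ D := by
  by_contra h
  apply hx
  by_cases h1 : A⁻¹ • x ∈ C
  · left; rw [← hC]; exact ⟨_, h1, smul_inv_smul _ _⟩
  · right; rw [← hD]; exact ⟨_, by simp [h, h1], smul_inv_smul _ _⟩

/-- The curves of a pairing as ping-pong data. -/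
theorem PairsCurves.exists_pingPong {P : Set Sphere → Prop} (hP : ∀ C, P C → IsClosed C) {g : ℕ}
    {A : Fin g → PSL2R} (h : PairsCurves P A) :
    ∃ C K D : Fin g × Bool → Set Sphere,
      (∀ l, P (C l) ∧ IsSide (C l) (D l)) ∧ PingPong A K D := by
  obtain ⟨C, D, C', D', hC, d1, d2, d3, m1, m2⟩ := h
  refine ⟨fun l => bif l.2 then C' l.1 else C l.1,
    fun l => bif l.2 then C' l.1 ∪ D' l.1 else C l.1 ∪ D l.1,
    fun l => bif l.2 then D' l.1 else D l.1, ?_, ?_, ?_, ?_, ?_, ?_⟩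
  · rintro ⟨i, _ | _⟩
    · exact ⟨(hC i).1, (hC i).2.2.1⟩
    · exact ⟨(hC i).2.1, (hC i).2.2.2⟩
  · rintro ⟨i, _ | _⟩
    · exact (hC i).2.2.1.isClosed_union (hP _ (hC i).1)
    · exact (hC i).2.2.2.isClosed_union (hP _ (hC i).2.1)
  · rintro ⟨i, _ | _⟩
    · obtain ⟨x, hx, e⟩ := (hC i).2.2.1
      exact ⟨x, Or.inr (e ▸ mem_connectedComponentIn hx)⟩
    · obtain ⟨x, hx, e⟩ := (hC i).2.2.2
      exact ⟨x, Or.inr (e ▸ mem_connectedComponentIn hx)⟩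
  · rintro ⟨i, _ | _⟩
    · exact subset_union_right
    · exact subset_union_right
  · rintro ⟨i, _ | _⟩ ⟨j, _ | _⟩ hij
    · exact d1 i j (by simpa using hij)
    · exact d3 i j
    · exact (d3 j i).symm
    · exact d2 i j (by simpa using hij)
  · rintro ⟨i, _ | _⟩ x hx
    · exact smul_compl_inv (m1 i) (m2 i) (by simpa using hx)
    · change A i • x ∈ D' i
      rw [← m2 i]
      exact ⟨x, hx, rfl⟩

namespace PingPong

variable {g : ℕ} {A : Fin g → PSL2R} {K D : Fin g × Bool → Set Sphere}

/-- The connected sphere is not a finite disjoint union of at least two nonempty closed sets. The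
uncovered part is open, hence contains a point other than `∞`. -/
theorem exists_exterior (h : PingPong A K D) (hg : 0 < g) : ∃ z : ℂ, ∀ l, (z : Sphere) ∉ K l := by
  have hcl : IsClosed (⋃ l, K l) := isClosed_iUnion_of_finite h.isClosed
  have hne : (⋃ l, K l)ᶜ.Nonempty := by
    rw [nonempty_compl]
    intro hu
    let l₀ : Fin g × Bool := (⟨0, hg⟩, true)
    let l₁ : Fin g × Bool := (⟨0, hg⟩, false)
    have hc : (K l₀)ᶜ = ⋃ l : {l // l ≠ l₀}, K l.1 := by
      ext x
      simp only [mem_compl_iff, mem_iUnion]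
      constructor
      · intro hx
        obtain ⟨l, hl⟩ := mem_iUnion.mp (hu ▸ mem_univ x)
        exact ⟨⟨l, by rintro rfl; exact hx hl⟩, hl⟩
      · rintro ⟨⟨l, hl⟩, hx⟩ hx'
        exact (h.disjoint l l₀ hl).le_bot ⟨hx, hx'⟩
    have hclopen : IsClopen (K l₀) := by
      refine ⟨h.isClosed _, ?_⟩
      rw [← isClosed_compl_iff, hc]
      exact isClosed_iUnion_of_finite fun l => h.isClosed l.1
    rcases isClopen_iff.mp hclopen with e | e
    · exact (h.nonempty l₀).ne_empty e
    · obtain ⟨x, hx⟩ := h.nonempty l₁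
      exact (h.disjoint l₁ l₀ (by simp [l₀, l₁])).le_bot ⟨hx, e ▸ mem_univ x⟩
  obtain ⟨x, hx⟩ := hne
  have hd : DenseRange ((↑) : ℂ → Sphere) := OnePoint.denseRange_coe
  obtain ⟨z, hz⟩ := hd.exists_mem_open hcl.isOpen_compl ⟨x, hx⟩
  exact ⟨z, fun l hl => hz (mem_iUnion.mpr ⟨l, hl⟩)⟩

theorem word_smul_mem (h : PingPong A K D) {x : Sphere} (hx : ∀ l, x ∉ K l)
    (L : List (Fin g × Bool)) : ∀ l, FreeGroup.IsReduced (l :: L) →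
      ((l :: L).map (letter A)).prod • x ∈ K l := by
  induction L with
  | nil =>
    intro l _
    simpa using h.subset _ (h.maps l x (hx _))
  | cons m L ih =>
    intro l hr
    rw [FreeGroup.isReduced_cons_cons] at hr
    rw [List.map_cons, List.prod_cons, mul_smul]
    refine h.subset _ (h.maps l _ fun hm => ?_)
    have hne : (l.1, !l.2) ≠ m := by
      rintro rfl
      simpa using hr.1
    exact (h.disjoint _ _ hne).le_bot ⟨hm, ih m hr.2⟩

theorem lift_mk_eq (L : List (Fin g × Bool)) :
    FreeGroup.lift A (FreeGroup.mk L) = (L.map (letter A)).prod := FreeGroup.lift_mk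

theorem lift_smul_mem (h : PingPong A K D) {x : Sphere} (hx : ∀ l, x ∉ K l)
    {L : List (Fin g × Bool)} (hL : FreeGroup.IsReduced L) {l : Fin g × Bool}
    (hl : l ∈ L.head?) : FreeGroup.lift A (FreeGroup.mk L) • x ∈ K l := by
  rw [lift_mk_eq]
  cases L with
  | nil => simp at hl
  | cons m L =>
    obtain rfl : m = l := by simpa using hl
    exact h.word_smul_mem hx L m hL

/-- A nonempty reduced word moves an exterior point into the set of its first letter, so it does not
act trivially. -/
theorem injective_lift (h : PingPong A K D) : Function.Injective (FreeGroup.lift A) := by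
  rw [injective_iff_map_eq_one]
  intro f hf
  by_contra hne
  have hL : f.toWord ≠ [] := by simpa using hne
  obtain ⟨l, L, e⟩ := List.exists_cons_of_ne_nil hL
  obtain ⟨z, hz⟩ := h.exists_exterior (Fin.pos l.1)
  have := h.lift_smul_mem hz (L := f.toWord) FreeGroup.isReduced_toWord (l := l) (by simp [e])
  rw [FreeGroup.mk_toWord, hf, one_smul] at this
  exact hz l this

theorem not_commute (h : PingPong A K D) {i j : Fin g} (hij : i ≠ j) : A i * A j ≠ A j * A i := by
  intro e
  have : FreeGroup.of i * FreeGroup.of j = FreeGroup.of j * FreeGroup.of i :=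
    h.injective_lift (by simpa using e)
  have := congrArg FreeGroup.toWord this
  simp [FreeGroup.of, FreeGroup.toWord_mk, FreeGroup.reduce, hij, hij.symm] at this

/-- A fixed point of a generator lies in one of the two discs paired by it. -/
theorem fixed_mem (h : PingPong A K D) {i : Fin g} {x : Sphere} (hx : A i • x = x) :
    x ∈ K (i, true) ∨ x ∈ K (i, false) := by
  by_cases hf : x ∈ K (i, false)
  · exact Or.inr hf
  · left
    have := h.subset _ (h.maps (i, true) x hf)
    rwa [letter, cond_true, hx] at this

theorem fixed_notMem (h : PingPong A K D) {i j : Fin g} (hij : i ≠ j) {x : Sphere}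
    (hx : A i • x = x) (b : Bool) : x ∉ K (j, b) := by
  intro hxj
  rcases h.fixed_mem hx with h' | h'
  · exact (h.disjoint (i, true) (j, b) (by simp [hij])).le_bot ⟨h', hxj⟩
  · exact (h.disjoint (i, false) (j, b) (by simp [hij])).le_bot ⟨h', hxj⟩

/-- Every nontrivial element is conjugate to one whose positive and negative powers move an
exterior point into two disjoint closed sets. -/
theorem exists_conj_pow_mem (h : PingPong A K D) {w : PSL2R}
    (hw : w ∈ Subgroup.closure (range A)) (hw1 : w ≠ 1) :
    ∃ (u : PSL2R) (z : ℂ) (l m : Fin g × Bool), l ≠ m ∧ (z : Sphere) ∉ K l ∧ ∀ n : ℕ, 0 < n →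
      (u⁻¹ * w * u) ^ n • (z : Sphere) ∈ K l ∧ ((u⁻¹ * w * u)⁻¹) ^ n • (z : Sphere) ∈ K m := by
  rw [← FreeGroup.range_lift_eq_closure] at hw
  obtain ⟨f, rfl⟩ := hw
  set L := FreeGroup.reduceCyclically f.toWord with hLdef
  set U := FreeGroup.reduceCyclically.conjugator f.toWord with hUdef
  have hf : f = FreeGroup.mk U * FreeGroup.mk L * (FreeGroup.mk U)⁻¹ := by
    have := FreeGroup.reduceCyclically.conj_conjugator_reduceCyclically f.toWord
    rw [FreeGroup.inv_mk, FreeGroup.mul_mk, FreeGroup.mul_mk, this, FreeGroup.mk_toWord]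
  have hL : FreeGroup.IsCyclicallyReduced L :=
    FreeGroup.reduceCyclically.isCyclicallyReduced FreeGroup.isReduced_toWord
  have hLne : L ≠ [] := by
    intro h0
    apply hw1
    rw [hf, h0, ← FreeGroup.one_eq_mk, mul_one, mul_inv_cancel, map_one]
  obtain ⟨l, hl⟩ := Option.ne_none_iff_exists'.mp (mt List.head?_eq_none_iff.mp hLne)
  obtain ⟨k, hk⟩ := Option.ne_none_iff_exists'.mp (mt List.getLast?_eq_none_iff.mp hLne)
  obtain ⟨z, hz⟩ := h.exists_exterior (Fin.pos l.1)
  -- Powers of the cyclically reduced core stay reduced: positive ones begin with its first letter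
  -- `l`, negative ones with the inverse of its last letter `k`. Cyclic reducedness says precisely
  -- that these two letters differ.
  refine ⟨FreeGroup.lift A (FreeGroup.mk U), z, l, (k.1, !k.2), ?_, hz l, fun n hn => ?_⟩
  · rintro rfl
    have := hL.2 k hk _ hl rfl
    simp at this
  have e : (FreeGroup.lift A (FreeGroup.mk U))⁻¹ * FreeGroup.lift A f
      * FreeGroup.lift A (FreeGroup.mk U) = FreeGroup.lift A (FreeGroup.mk L) := by
    rw [hf]; simp only [map_mul, map_inv]; group
  have hr := (hL.flatten_replicate n).isReduced
  rw [e, ← map_pow, ← map_inv, ← map_pow, FreeGroup.inv_mk]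
  have hpow : ∀ L' : List (Fin g × Bool),
      FreeGroup.mk L' ^ n = FreeGroup.mk (List.replicate n L').flatten := fun L' =>
    FreeGroup.pow_mk n
  constructor
  · rw [hpow]
    exact h.lift_smul_mem hz hr (by rw [List.head?_flatten_replicate hn.ne' L]; exact hl)
  · rw [← FreeGroup.inv_mk, inv_pow, hpow, FreeGroup.inv_mk]
    refine h.lift_smul_mem hz ?_ ?_
    · rw [FreeGroup.isReduced_iff_reduce_eq, FreeGroup.reduce_invRev, hr.reduce_eq]
    · rw [FreeGroup.invRev, List.head?_reverse, List.getLast?_map,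
        List.getLast?_flatten_replicate hn.ne', hk]
      rfl

end PingPong

-- Nontrivial elements are hyperbolic

theorem ofHom_smul {t : ℂ} (ht : t ≠ 0) (p q : ℂ) : ofHom (t * p) (t * q) = ofHom p q := by
  unfold ofHom
  by_cases hq : q = 0
  · simp [hq]
  · simp [hq, ht, mul_div_mul_left]

/-- The only delicate limit is `∞`: a closed set missing `∞` is bounded in `ℂ`, so `‖p‖ ≤ R ‖q‖`
along the sequence, and `q → 0` would force `p → 0` as well. -/
theorem ofHom_mem_of_tendsto {K : Set Sphere} (hK : IsClosed K) {p q : ℕ → ℂ} {p₀ q₀ : ℂ}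
    (hp : Filter.Tendsto p Filter.atTop (nhds p₀)) (hq : Filter.Tendsto q Filter.atTop (nhds q₀))
    (h0 : p₀ ≠ 0 ∨ q₀ ≠ 0) (hmem : ∀ n, ofHom (p n) (q n) ∈ K) : ofHom p₀ q₀ ∈ K := by
  by_cases hq0 : q₀ = 0
  · subst hq0
    by_contra hn
    have hinf : (∞ : Sphere) ∉ K := by simpa [ofHom] using hn
    obtain ⟨-, hc⟩ := (OnePoint.isClosed_iff_of_notMem hinf).mp hK
    obtain ⟨R, hR⟩ := hc.isBounded.exists_norm_le
    have hle : ∀ n, ‖p n‖ ≤ R * ‖q n‖ := by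
      intro n
      have hqn : q n ≠ 0 := by
        intro h; apply hinf; simpa [ofHom, h] using hmem n
      have := hR (p n / q n) (by simpa [ofHom, hqn] using hmem n)
      rw [norm_div, div_le_iff₀ (norm_pos_iff.mpr hqn)] at this
      exact this
    have := le_of_tendsto_of_tendsto' hp.norm (hq.norm.const_mul R) hle
    rw [norm_zero, mul_zero, norm_le_zero_iff] at this
    simp [this] at h0
  · have hev : ∀ᶠ n in Filter.atTop, q n ≠ 0 := hq.eventually_ne hq0
    have ht : Filter.Tendsto (fun n => ((p n / q n : ℂ) : Sphere)) Filter.atTop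
        (nhds ((p₀ / q₀ : ℂ) : Sphere)) :=
      (OnePoint.continuous_coe.tendsto _).comp (hp.div hq hq0)
    rw [ofHom, if_neg hq0]
    refine hK.mem_of_tendsto ht ?_
    filter_upwards [hev] with n hn
    simpa [ofHom, hn] using hmem n

theorem trace_eq (a : SL(2, ℝ)) : (a : Matrix (Fin 2) (Fin 2) ℝ).trace = a 0 0 + a 1 1 :=
  Matrix.trace_fin_two _

theorem isHyperbolic_mk_iff (a : SL(2, ℝ)) :
    (a : Matrix (Fin 2) (Fin 2) ℝ).IsHyperbolic ↔ 4 < (a 0 0 + a 1 1) ^ 2 := by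
  rw [Matrix.IsHyperbolic, Matrix.discr_fin_two, trace_eq, a.det_coe]
  constructor <;> intro h <;> linarith

theorem sq_entries (w : SL(2, ℝ)) {t : ℝ} (ht : w 0 0 + w 1 1 = t) :
    (w : Matrix (Fin 2) (Fin 2) ℝ) * w = t • (w : Matrix (Fin 2) (Fin 2) ℝ) - 1 := by
  have hd := det_eq w
  ext i j
  fin_cases i <;> fin_cases j <;>
    simp only [Matrix.mul_apply, Fin.sum_univ_two, Matrix.sub_apply, Matrix.smul_apply,
      Matrix.one_apply, smul_eq_mul, Fin.zero_eta, Fin.mk_one, Fin.isValue, if_true, ← ht,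
      zero_ne_one, one_ne_zero, if_false] <;> first | ring1 | linear_combination -hd

/-- By Cayley–Hamilton the powers satisfy the recurrence of `cos nθ` and `sin nθ`; geometrically `w`
is conjugate to the rotation by `θ`. -/
theorem pow_of_trace_eq_cos (w : SL(2, ℝ)) {θ : ℝ} (hs : Real.sin θ ≠ 0)
    (ht : w 0 0 + w 1 1 = 2 * Real.cos θ) (n : ℕ) :
    ((w ^ n : SL(2, ℝ)) : Matrix (Fin 2) (Fin 2) ℝ) = Real.cos (n * θ) • 1
      + (Real.sin (n * θ) / Real.sin θ) •
        ((w : Matrix (Fin 2) (Fin 2) ℝ) - Real.cos θ • 1) := by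
  induction n with
  | zero => simp
  | succ n ih =>
    have h2 := sq_entries w ht
    rw [pow_succ, Matrix.SpecialLinearGroup.coe_mul, ih, add_mul, smul_mul_assoc, one_mul,
      smul_mul_assoc, sub_mul, h2, smul_mul_assoc, one_mul]
    have hsc := Real.sin_sq_add_cos_sq θ
    push_cast
    rw [add_mul (n : ℝ) 1 θ, one_mul, Real.cos_add, Real.sin_add]
    ext i j
    simp only [Matrix.add_apply, Matrix.sub_apply, Matrix.smul_apply, smul_eq_mul]
    field_simp
    linear_combination (Real.sin (n * θ) * (1 : Matrix (Fin 2) (Fin 2) ℝ) i j) * hsc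

theorem pow_of_trace_eq_two_mul (w : SL(2, ℝ)) {e : ℝ} (he : e ^ 2 = 1)
    (ht : w 0 0 + w 1 1 = 2 * e) (n : ℕ) :
    ((w ^ n : SL(2, ℝ)) : Matrix (Fin 2) (Fin 2) ℝ) = e ^ n • (1 + (n : ℝ) •
        (e • (w : Matrix (Fin 2) (Fin 2) ℝ) - 1)) := by
  induction n with
  | zero => simp
  | succ n ih =>
    have h2 := sq_entries w ht
    rw [pow_succ, Matrix.SpecialLinearGroup.coe_mul, ih, smul_mul_assoc, add_mul, one_mul,
      smul_mul_assoc, sub_mul, smul_mul_assoc, h2, one_mul]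
    push_cast
    ext i j
    simp only [Matrix.add_apply, Matrix.sub_apply, Matrix.smul_apply, smul_eq_mul]
    generalize (w : Matrix (Fin 2) (Fin 2) ℝ) i j = x
    generalize (1 : Matrix (Fin 2) (Fin 2) ℝ) i j = y
    rw [pow_succ]
    linear_combination (e ^ n * (n * x - x)) * he

/-- Dirichlet approximation of `θ / 2π` brings suitable positive multiples of `θ` arbitrarily close
to `2πℤ`, whether or not the quotient is rational. -/
theorem exists_pow_tendsto_one (θ : ℝ) : ∃ k : ℕ → ℕ, (∀ n, 0 < k n) ∧
    Filter.Tendsto (fun n => Real.cos (k n * θ)) Filter.atTop (nhds 1) ∧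
    Filter.Tendsto (fun n => Real.sin (k n * θ)) Filter.atTop (nhds 0) := by
  have h := fun n : ℕ => Real.exists_nat_abs_mul_sub_round_le (θ / (2 * Real.pi)) n.succ_pos
  choose k hk _ hk3 using h
  set δ : ℕ → ℝ := fun n => k n * (θ / (2 * Real.pi)) - round (k n * (θ / (2 * Real.pi))) with hδ
  have hδ0 : Filter.Tendsto δ Filter.atTop (nhds 0) := by
    apply squeeze_zero_norm hk3
    have : Filter.Tendsto (fun n : ℕ => 1 / ((n : ℝ) + 1)) Filter.atTop (nhds 0) :=
      tendsto_one_div_add_atTop_nhds_zero_nat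
    exact this.comp (Filter.tendsto_add_atTop_nat 1)
  have e : ∀ n, (k n : ℝ) * θ
      = 2 * Real.pi * δ n + round (k n * (θ / (2 * Real.pi))) * (2 * Real.pi) := by
    intro n
    simp only [hδ]
    have := Real.pi_ne_zero
    field_simp
    ring
  refine ⟨k, hk, ?_, ?_⟩
  · simp_rw [e, Real.cos_add_int_mul_two_pi]
    have := (Real.continuous_cos.tendsto 0).comp ((hδ0.const_mul (2 * Real.pi)).trans (by simp))
    simpa [Function.comp_def] using this
  · simp_rw [e, Real.sin_add_int_mul_two_pi]
    have := (Real.continuous_sin.tendsto 0).comp ((hδ0.const_mul (2 * Real.pi)).trans (by simp))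
    simpa [Function.comp_def] using this

theorem mk_smul_coe (a : SL(2, ℝ)) (z : ℂ) : (QuotientGroup.mk a : PSL2R) • (z : Sphere)
    = ofHom (a 0 0 * z + a 0 1) (a 1 0 * z + a 1 1) := by
  rw [← ofHom_coe, mk_smul_ofHom a (by simp)]
  simp

/-- Positive powers of an elliptic matrix accumulate at the identity, so the point is a limit of its
own images. -/
theorem mem_of_elliptic {K : Set Sphere} (hK : IsClosed K) (w : SL(2, ℝ))
    (ht : (w 0 0 + w 1 1) ^ 2 < 4) (z : ℂ)
    (h : ∀ n : ℕ, 0 < n → (QuotientGroup.mk w : PSL2R) ^ n • (z : Sphere) ∈ K) :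
    (z : Sphere) ∈ K := by
  obtain ⟨θ, hs, hθ⟩ : ∃ θ : ℝ, Real.sin θ ≠ 0 ∧ w 0 0 + w 1 1 = 2 * Real.cos θ := by
    have h1 : -1 < (w 0 0 + w 1 1) / 2 := by nlinarith
    have h2 : (w 0 0 + w 1 1) / 2 < 1 := by nlinarith
    refine ⟨Real.arccos ((w 0 0 + w 1 1) / 2), ?_, ?_⟩
    · rw [Real.sin_arccos]
      exact (Real.sqrt_pos.mpr (by nlinarith)).ne'
    · rw [Real.cos_arccos h1.le h2.le]; ring
  obtain ⟨k, hk, hc, hs'⟩ := exists_pow_tendsto_one θ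
  have hent : ∀ i j, Filter.Tendsto (fun n => ((w ^ k n : SL(2, ℝ)) i j)) Filter.atTop
      (nhds ((1 : Matrix (Fin 2) (Fin 2) ℝ) i j)) := by
    intro i j
    have : ∀ n, (w ^ k n : SL(2, ℝ)) i j
        = Real.cos (k n * θ) * (1 : Matrix (Fin 2) (Fin 2) ℝ) i j
          + Real.sin (k n * θ) / Real.sin θ * ((w : Matrix (Fin 2) (Fin 2) ℝ)
              - Real.cos θ • 1) i j := by
      intro n
      have := congrFun (congrFun (pow_of_trace_eq_cos w hs hθ (k n)) i) j
      simpa only [Matrix.add_apply, Matrix.smul_apply, smul_eq_mul] using this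
    simp_rw [this]
    have := (hc.mul_const ((1 : Matrix (Fin 2) (Fin 2) ℝ) i j)).add
      ((hs'.div_const (Real.sin θ)).mul_const (((w : Matrix (Fin 2) (Fin 2) ℝ)
              - Real.cos θ • 1) i j))
    simpa using this
  have hentC : ∀ i j, Filter.Tendsto (fun n => (((w ^ k n : SL(2, ℝ)) i j : ℝ) : ℂ)) Filter.atTop
      (nhds (((1 : Matrix (Fin 2) (Fin 2) ℝ) i j : ℝ) : ℂ)) := fun i j =>
    (Complex.continuous_ofReal.tendsto _).comp (hent i j)
  have := ofHom_mem_of_tendsto hK (p := fun n => ((w ^ k n : SL(2, ℝ)) 0 0 : ℂ) * z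
      + ((w ^ k n : SL(2, ℝ)) 0 1 : ℂ)) (q := fun n => ((w ^ k n : SL(2, ℝ)) 1 0 : ℂ) * z
      + ((w ^ k n : SL(2, ℝ)) 1 1 : ℂ)) (((hentC 0 0).mul_const z).add (hentC 0 1))
      (((hentC 1 0).mul_const z).add (hentC 1 1)) (by simp) (fun n => by
        rw [← mk_smul_coe]
        exact h (k n) (hk n))
  simpa [ofHom_coe] using this

/-- Up to a scalar, `wⁿ` is `1/n + (e w - 1)`, so the orbit of `z` converges to the direction of `(e
w - 1) (z, 1)`, provided that this vector is nonzero. -/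
theorem ofHom_mem_of_parabolic {K : Set Sphere} (hK : IsClosed K) (w : SL(2, ℝ)) {e : ℝ}
    (he : e ^ 2 = 1) (ht : w 0 0 + w 1 1 = 2 * e) (z : ℂ)
    (h : ∀ n : ℕ, 0 < n → (QuotientGroup.mk w : PSL2R) ^ n • (z : Sphere) ∈ K)
    (h0 : ((e * w 0 0 - 1) * z + e * w 0 1 : ℂ) ≠ 0 ∨ (e * w 1 0 * z + (e * w 1 1 - 1) : ℂ) ≠ 0) :
    ofHom ((e * w 0 0 - 1) * z + e * w 0 1) (e * w 1 0 * z + (e * w 1 1 - 1)) ∈ K := by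
  have hinv : Filter.Tendsto (fun n : ℕ => (((1 / ((n : ℝ) + 1) : ℝ)) : ℂ)) Filter.atTop
      (nhds 0) := by
    have := (Complex.continuous_ofReal.tendsto 0).comp
      (tendsto_one_div_add_atTop_nhds_zero_nat (𝕜 := ℝ))
    simpa [Function.comp_def] using this
  refine ofHom_mem_of_tendsto hK
    (p := fun n => (((1 / ((n : ℝ) + 1) : ℝ)) : ℂ) * z + ((e * w 0 0 - 1) * z + e * w 0 1))
    (q := fun n => (((1 / ((n : ℝ) + 1) : ℝ)) : ℂ) + (e * w 1 0 * z + (e * w 1 1 - 1))) ?_ ?_ h0 ?_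
  · simpa using (hinv.mul_const z).add_const ((e * w 0 0 - 1) * z + e * w 0 1 : ℂ)
  · simpa using hinv.add_const (e * w 1 0 * z + (e * w 1 1 - 1) : ℂ)
  · intro n
    have hm := h (n + 1) n.succ_pos
    rw [← QuotientGroup.mk_pow, mk_smul_coe] at hm
    have hp := pow_of_trace_eq_two_mul w he ht (n + 1)
    have hen : ∀ i j, (w ^ (n + 1) : SL(2, ℝ)) i j
        = e ^ (n + 1) * ((1 : Matrix (Fin 2) (Fin 2) ℝ) i j + ((n + 1 : ℕ) : ℝ)
          * (e * w i j - (1 : Matrix (Fin 2) (Fin 2) ℝ) i j)) := fun i j => by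
      have := congrFun (congrFun hp i) j
      simpa only [Matrix.add_apply, Matrix.sub_apply, Matrix.smul_apply, smul_eq_mul] using this
    have he0 : e ≠ 0 := by rintro rfl; norm_num at he
    have hn0 : ((n : ℂ) + 1) ≠ 0 := by exact_mod_cast n.succ_ne_zero
    have hsc : ((e : ℂ) ^ (n + 1) * (n + 1)) ≠ 0 :=
      mul_ne_zero (pow_ne_zero _ (by exact_mod_cast he0)) hn0
    rw [← ofHom_smul hsc]
    convert hm using 2
    · rw [hen, hen]; simp; field_simp; ring
    · rw [hen, hen]; simp; field_simp; ring

/-- A nontrivial element of `PSL(2, ℝ)` whose positive and negative powers move some point into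
two disjoint closed sets is hyperbolic. -/
theorem four_lt_trace_sq_of_pow_mem {K K' : Set Sphere} (hK : IsClosed K) (hK' : IsClosed K')
    (hd : Disjoint K K') (w : SL(2, ℝ)) (z : ℂ) (hz : (z : Sphere) ∉ K)
    (h : ∀ n : ℕ, 0 < n → (QuotientGroup.mk w : PSL2R) ^ n • (z : Sphere) ∈ K)
    (h' : ∀ n : ℕ, 0 < n → (QuotientGroup.mk w : PSL2R)⁻¹ ^ n • (z : Sphere) ∈ K') :
    4 < (w 0 0 + w 1 1) ^ 2 := by
  by_contra! hle
  rcases hle.lt_or_eq with hlt | heq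
  · exact hz (mem_of_elliptic hK w hlt z h)
  set e : ℝ := (w 0 0 + w 1 1) / 2 with hedef
  have he : e ^ 2 = 1 := by rw [hedef]; linarith
  have ht : w 0 0 + w 1 1 = 2 * e := by rw [hedef]; ring
  have hent : (w⁻¹ 0 0 = w 1 1) ∧ (w⁻¹ 0 1 = - w 0 1) ∧ (w⁻¹ 1 0 = - w 1 0) ∧ (w⁻¹ 1 1 = w 0 0) := by
    simp [Matrix.SpecialLinearGroup.SL2_inv_expl]
  obtain ⟨i1, i2, i3, i4⟩ := hent
  have e1 : (e * w⁻¹ 0 0 - 1 : ℂ) = - (e * w 0 0 - 1) := by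
    rw [i1]
    have : e * w 1 1 - 1 = -(e * w 0 0 - 1) := by linear_combination e * ht + 2 * he
    exact_mod_cast this
  have e2 : (e * w⁻¹ 1 1 - 1 : ℂ) = - (e * w 1 1 - 1) := by
    rw [i4]
    have : e * w 0 0 - 1 = -(e * w 1 1 - 1) := by linear_combination e * ht + 2 * he
    exact_mod_cast this
  -- Since `e w⁻¹ - 1 = -(e w - 1)`, forward and backward orbits have the same limit, which cannot
  -- lie in both disjoint closed sets. If the limiting vector vanishes, `z` is fixed by `w`, and its
  -- first image puts it into `K`.
  by_cases h0 : ((e * w 0 0 - 1) * z + e * w 0 1 : ℂ) ≠ 0 ∨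
      (e * w 1 0 * z + (e * w 1 1 - 1) : ℂ) ≠ 0
  · have m1 := ofHom_mem_of_parabolic hK w he ht z h h0
    have m2 := ofHom_mem_of_parabolic hK' w⁻¹ he (by rw [i1, i4, ← ht]; ring) z (by simpa using h')
      (by
        rw [e1, e2, i2, i3]
        push_cast
        rcases h0 with h0 | h0
        · left; contrapose! h0; linear_combination -h0
        · right; contrapose! h0; linear_combination -h0)
    rw [e1, e2, i2, i3] at m2
    refine hd.le_bot ⟨m1, ?_⟩
    rw [← ofHom_smul (t := -1) (by norm_num)]
    convert m2 using 2 <;> push_cast <;> ring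
  · push Not at h0
    apply hz
    have hm := h 1 one_pos
    rw [pow_one, mk_smul_coe] at hm
    have he0 : (e : ℂ) ≠ 0 := by
      have : e ≠ 0 := by rintro h; rw [h] at he; norm_num at he
      exact_mod_cast this
    rw [← ofHom_smul he0] at hm
    rw [← ofHom_coe]
    convert hm using 2
    · linear_combination -h0.1
    · linear_combination -h0.2

theorem PingPong.four_lt_trace_sq {g : ℕ} {A : Fin g → PSL2R} {K D : Fin g × Bool → Set Sphere}
    (h : PingPong A K D) (w : SL(2, ℝ))
    (hw : (QuotientGroup.mk w : PSL2R) ∈ Subgroup.closure (range A))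
    (hw1 : (QuotientGroup.mk w : PSL2R) ≠ 1) : 4 < (w 0 0 + w 1 1) ^ 2 := by
  obtain ⟨u, z, l, m, hlm, hz, hpow⟩ := h.exists_conj_pow_mem hw hw1
  obtain ⟨v, rfl⟩ := exists_rep u
  have e : ((QuotientGroup.mk v : PSL2R)⁻¹ * QuotientGroup.mk w * QuotientGroup.mk v)
      = QuotientGroup.mk (v⁻¹ * w * v) := rfl
  rw [e] at hpow
  have := four_lt_trace_sq_of_pow_mem (h.isClosed l) (h.isClosed m) (h.disjoint l m hlm)
    (v⁻¹ * w * v) z hz (fun n hn => (hpow n hn).1) (fun n hn => (hpow n hn).2)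
  rw [← trace_eq, Matrix.SpecialLinearGroup.coe_mul, Matrix.trace_mul_comm,
    ← Matrix.SpecialLinearGroup.coe_mul] at this
  rw [← trace_eq]
  simpa [mul_assoc] using this

-- Trace identities and crossing axes

theorem mul_entry (a b : SL(2, ℝ)) (i j : Fin 2) :
    (a * b) i j = a i 0 * b 0 j + a i 1 * b 1 j := by
  rw [Matrix.SpecialLinearGroup.coe_mul, Matrix.mul_apply, Fin.sum_univ_two]

theorem inv_entries (w : SL(2, ℝ)) :
    w⁻¹ 0 0 = w 1 1 ∧ w⁻¹ 0 1 = - w 0 1 ∧ w⁻¹ 1 0 = - w 1 0 ∧ w⁻¹ 1 1 = w 0 0 := by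
  simp [Matrix.SpecialLinearGroup.SL2_inv_expl]

/-- The trace of an element of `SL(2, ℝ)`. -/
def tr (a : SL(2, ℝ)) : ℝ := a 0 0 + a 1 1

theorem tr_mul_comm (a b : SL(2, ℝ)) : tr (a * b) = tr (b * a) := by
  simp only [tr, mul_entry]; ring

theorem tr_conj (h a : SL(2, ℝ)) : tr (h * a * h⁻¹) = tr a := by
  rw [tr_mul_comm, inv_mul_cancel_left]

theorem tr_inv (a : SL(2, ℝ)) : tr a⁻¹ = tr a := by
  obtain ⟨i1, -, -, i4⟩ := inv_entries a
  rw [tr, tr, i1, i4, add_comm]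

theorem tr_mul_inv (a b : SL(2, ℝ)) : tr (a * b⁻¹) = tr a * tr b - tr (a * b) := by
  obtain ⟨i1, i2, i3, i4⟩ := inv_entries b
  simp only [tr, mul_entry, i1, i2, i3, i4]; ring

/-- The determinant of `a b - b a`, in terms of traces. -/
def commDet (a b : SL(2, ℝ)) : ℝ :=
  4 + tr a * tr b * tr (a * b) - tr a ^ 2 - tr b ^ 2 - tr (a * b) ^ 2

theorem tr_one : tr 1 = 2 := by
  simp only [tr, Matrix.SpecialLinearGroup.coe_one, Matrix.one_apply_eq]; norm_num

theorem tr_mul_self (a : SL(2, ℝ)) : tr (a * a) = tr a ^ 2 - 2 := by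
  have := tr_mul_inv a a
  rw [mul_inv_cancel, tr_one] at this
  linarith

theorem tr_commutator (a b : SL(2, ℝ)) : tr (a * b * a⁻¹ * b⁻¹) = 2 - commDet a b := by
  have h1 : tr (a * b * a⁻¹ * b⁻¹) = tr (a * b * a⁻¹) * tr b - tr (a * b * a⁻¹ * b) :=
    tr_mul_inv _ _
  have h2 := tr_mul_inv (a * b) (a⁻¹ * b)
  rw [show a * b * (a⁻¹ * b)⁻¹ = a * a by group, tr_mul_comm a⁻¹ b, tr_mul_inv, tr_mul_self,
    ← mul_assoc, tr_mul_comm b a] at h2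
  rw [h1, tr_conj, commDet]
  linear_combination -h2

/-- The matrix `a b - b a` has trace zero, so its determinant is determined by three of its entries.
-/
theorem commDet_eq (a b : SL(2, ℝ)) : commDet a b
    = -((a * b) 0 0 - (b * a) 0 0) ^ 2
      - ((a * b) 0 1 - (b * a) 0 1) * ((a * b) 1 0 - (b * a) 1 0) := by
  have da := det_eq a
  have db := det_eq b
  simp only [commDet, tr, mul_entry]
  linear_combination ((b 0 0 + b 1 1) ^ 2 - 4) * da + ((a 0 0 + a 1 1) ^ 2
    - 4 * (a 0 0 * a 1 1 - a 0 1 * a 1 0)) * db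

theorem commDet_inv_right (a b : SL(2, ℝ)) : commDet a b⁻¹ = commDet a b := by
  simp only [commDet, tr_mul_inv, tr_inv]; ring

theorem commDet_conj (h a b : SL(2, ℝ)) : commDet (h * a * h⁻¹) (h * b * h⁻¹) = commDet a b := by
  have : h * a * h⁻¹ * (h * b * h⁻¹) = h * (a * b) * h⁻¹ := by group
  simp only [commDet, this, tr_conj]

/-- The commutation determinant of `a b⁻¹` and its conjugate `b⁻¹ a`. -/
theorem commDet_mul_inv (a b : SL(2, ℝ)) : commDet (a * b⁻¹) (b⁻¹ * a)
    = -commDet a b * (tr a * tr b * tr (a * b⁻¹) - tr a ^ 2 - tr b ^ 2) := by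
  have h1 := tr_mul_inv (a * b⁻¹) (a⁻¹ * b)
  have h2 : tr (a * b⁻¹ * (b⁻¹ * a)) = tr a * tr b * tr (a * b⁻¹) - tr a ^ 2 - tr b ^ 2 + 2 := by
    have e1 : tr (a * b⁻¹ * (b⁻¹ * a)) = tr (a * a * b⁻¹ * b⁻¹) := by
      rw [← mul_assoc, tr_mul_comm]; simp only [mul_assoc]
    have e2 := tr_mul_inv (a * a * b⁻¹) b
    have e3 := tr_mul_inv a (b * a⁻¹)
    rw [show a * (b * a⁻¹)⁻¹ = a * a * b⁻¹ by group, ← mul_assoc, tr_conj,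
      tr_mul_inv b a] at e3
    rw [inv_mul_cancel_right, tr_mul_self, e3] at e2
    rw [e1, e2, tr_mul_inv, tr_mul_comm b a]
    ring
  rw [commDet, h2, tr_mul_comm b⁻¹ a, tr_mul_inv, commDet]
  ring

/-- The commutator `a b - b a` of symmetric matrices is antisymmetric, so its determinant is the
square of its one free entry. -/
theorem commDet_ne_zero_of_symm {a b : SL(2, ℝ)} (ha : a 0 1 = a 1 0) (hb : b 0 1 = b 1 0) :
    0 ≤ commDet a b ∧ (commDet a b = 0 → a * b = b * a) := by
  have e : commDet a b = ((a * b) 0 1 - (b * a) 0 1) ^ 2 := by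
    rw [commDet_eq]
    simp only [mul_entry, ha, hb]
    ring
  refine ⟨e ▸ sq_nonneg _, fun h => ?_⟩
  rw [e, sq_eq_zero_iff] at h
  have h' := h
  simp only [mul_entry, ha, hb] at h'
  ext i j
  fin_cases i <;> fin_cases j <;> simp only [Fin.zero_eta, Fin.mk_one, Fin.isValue, mul_entry,
    ha, hb] <;> linarith

/-- An element of `SL(2, ℝ)` mapping `x + i y` to `i`. -/
def toI (x y : ℝ) (hy : 0 < y) : SL(2, ℝ) :=
  ⟨!![1 / √y, -x / √y; 0, √y], by
    have := (Real.sqrt_pos.mpr hy).ne'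
    rw [Matrix.det_fin_two_of]; field_simp; simp⟩

/-- For hyperbolic `a` the equation says that `x + i y` is on its axis, and an axis through `i`
corresponds to a symmetric matrix. -/
theorem toI_conj_symm {x y : ℝ} (hy : 0 < y) (a : SL(2, ℝ))
    (h : a 1 0 * (x ^ 2 + y ^ 2) - (a 0 0 - a 1 1) * x - a 0 1 = 0) :
    (toI x y hy * a * (toI x y hy)⁻¹) 0 1 = (toI x y hy * a * (toI x y hy)⁻¹) 1 0 := by
  obtain ⟨i1, i2, i3, i4⟩ := inv_entries (toI x y hy)
  have hs := (Real.sqrt_pos.mpr hy).ne'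
  have hs2 : √y ^ 2 = y := Real.sq_sqrt hy.le
  have t1 : toI x y hy 0 0 = 1 / √y := rfl
  have t2 : toI x y hy 0 1 = -x / √y := rfl
  have t3 : toI x y hy 1 0 = 0 := rfl
  have t4 : toI x y hy 1 1 = √y := rfl
  simp only [mul_entry, i1, i2, i3, i4, t1, t2, t3, t4]
  field_simp
  rw [← hs2] at h
  linear_combination -h

/-- If `a b - b a` has positive determinant, it fixes a point of the upper half plane, which lies
on the axes of `a` and `b`. -/
theorem exists_point_of_commDet_pos {a b : SL(2, ℝ)} (h : 0 < commDet a b) :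
    ∃ x y : ℝ, 0 < y ∧ a 1 0 * (x ^ 2 + y ^ 2) - (a 0 0 - a 1 1) * x - a 0 1 = 0 ∧
      b 1 0 * (x ^ 2 + y ^ 2) - (b 0 0 - b 1 1) * x - b 0 1 = 0 := by
  set p := (a * b) 0 0 - (b * a) 0 0 with hp
  set q := (a * b) 0 1 - (b * a) 0 1 with hq
  set r := (a * b) 1 0 - (b * a) 1 0 with hr
  have hd := commDet_eq a b
  rw [← hp, ← hq, ← hr] at hd
  have hr0 : r ≠ 0 := by
    rintro h0
    rw [h0] at hd
    nlinarith [sq_nonneg p]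
  have hy2 : (√(commDet a b) / |r|) ^ 2 = commDet a b / r ^ 2 := by
    rw [div_pow, Real.sq_sqrt h.le, sq_abs]
  -- The fixed points of the traceless matrix with rows `(p, q)` and `(r, -p)` are `(p ± i √(-p² - q
  -- r)) / r`; the absolute value selects the one in the upper half plane.
  refine ⟨p / r, √(commDet a b) / |r|, by positivity, ?_, ?_⟩
  · rw [hy2, hd]
    -- This is `tr (a (a b - b a)) = 0`.
    have : a 1 0 * q + (a 0 0 - a 1 1) * p + a 0 1 * r = 0 := by
      simp only [hp, hq, hr, mul_entry]; ring
    field_simp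
    linear_combination (-r) * this
  · rw [hy2, hd]
    have : b 1 0 * q + (b 0 0 - b 1 1) * p + b 0 1 * r = 0 := by
      simp only [hp, hq, hr, mul_entry]; ring
    field_simp
    linear_combination (-r) * this

theorem exists_conj_symm {a b : SL(2, ℝ)} (h : 0 < commDet a b) :
    ∃ u : SL(2, ℝ), (u * a * u⁻¹) 0 1 = (u * a * u⁻¹) 1 0 ∧
      (u * b * u⁻¹) 0 1 = (u * b * u⁻¹) 1 0 := by
  obtain ⟨x, y, hy, ha, hb⟩ := exists_point_of_commDet_pos h
  exact ⟨toI x y hy, toI_conj_symm hy a ha, toI_conj_symm hy b hb⟩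

theorem exists_eigenvector_of_symm {a : SL(2, ℝ)} (ha : a 0 1 = a 1 0) :
    ∃ c s : ℝ, c ^ 2 + s ^ 2 = 1 ∧ c * (a 1 0 * c + a 1 1 * s) = s * (a 0 0 * c + a 0 1 * s) := by
  by_cases h0 : a 1 0 = 0
  · exact ⟨1, 0, by norm_num, by rw [h0]; ring⟩
  · set d := √((a 0 0 - a 1 1) ^ 2 + 4 * a 1 0 ^ 2) with hd
    have hd2 : d ^ 2 = (a 0 0 - a 1 1) ^ 2 + 4 * a 1 0 ^ 2 := Real.sq_sqrt (by positivity)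
    set m := √((2 * a 1 0) ^ 2 + (d - (a 0 0 - a 1 1)) ^ 2) with hm
    have hpos : 0 < (2 * a 1 0) ^ 2 + (d - (a 0 0 - a 1 1)) ^ 2 := by positivity
    have hm0 : m ≠ 0 := (Real.sqrt_pos.mpr hpos).ne'
    have hm2 : m ^ 2 = (2 * a 1 0) ^ 2 + (d - (a 0 0 - a 1 1)) ^ 2 := Real.sq_sqrt hpos.le
    refine ⟨2 * a 1 0 / m, (d - (a 0 0 - a 1 1)) / m, ?_, ?_⟩
    · field_simp
      rw [hm2]
      ring
    · rw [ha]
      field_simp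
      linear_combination -hd2

theorem smul_ofHom_of_eigenvector (a : SL(2, ℝ)) {c s : ℝ} (h0 : c ≠ 0 ∨ s ≠ 0)
    (h : c * (a 1 0 * c + a 1 1 * s) = s * (a 0 0 * c + a 0 1 * s)) :
    (QuotientGroup.mk a : PSL2R) • ofHom c s = ofHom c s := by
  rw [mk_smul_ofHom a (by simpa using h0)]
  have hne := real_hom_ne_zero a h0
  have h' : (c : ℂ) * (a 1 0 * c + a 1 1 * s) = s * (a 0 0 * c + a 0 1 * s) := by exact_mod_cast h
  have hne' := hom_ne_zero a (p := c) (q := s) (by simpa using h0)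
  unfold ofHom
  by_cases hs : (s : ℂ) = 0
  · have hc : (c : ℂ) ≠ 0 := by
      have : s = 0 := by exact_mod_cast hs
      simpa [this] using h0
    have : (a 1 0 * c + a 1 1 * s : ℂ) = 0 := by
      rw [hs, zero_mul] at h'
      rw [hs]
      exact (mul_eq_zero.mp h').resolve_left hc
    rw [if_pos this, if_pos hs]
  · have : (a 1 0 * c + a 1 1 * s : ℂ) ≠ 0 := by
      intro h1
      rw [h1, mul_zero] at h'
      rcases mul_eq_zero.mp h'.symm with h2 | h2
      · exact hs h2
      · rcases hne' with h3 | h3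
        · exact h3 h2
        · exact h3 h1
    rw [if_neg this, if_neg hs]
    congr 1
    rw [div_eq_div_iff this hs]
    linear_combination -h'

/-- A symmetric matrix has an orthonormal eigenbasis, and the sum of a quadratic form over an
orthonormal basis is its trace. So the sum over the two fixed directions of `a` depends on `u` and
the form but not on `a`. -/
theorem exists_fixed_pair (u a : SL(2, ℝ)) (ha : (u * a * u⁻¹) 0 1 = (u * a * u⁻¹) 1 0)
    (α β γ : ℝ) :
    ∃ x y x' y' : ℝ, (x ≠ 0 ∨ y ≠ 0) ∧ (x' ≠ 0 ∨ y' ≠ 0) ∧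
      (QuotientGroup.mk a : PSL2R) • ofHom x y = ofHom x y ∧
      (QuotientGroup.mk a : PSL2R) • ofHom x' y' = ofHom x' y' ∧
      (α * x ^ 2 + 2 * β * x * y + γ * y ^ 2) + (α * x' ^ 2 + 2 * β * x' * y' + γ * y' ^ 2)
        = α * (u 1 1 ^ 2 + u 0 1 ^ 2) - 2 * β * (u 1 1 * u 1 0 + u 0 1 * u 0 0)
          + γ * (u 1 0 ^ 2 + u 0 0 ^ 2) := by
  obtain ⟨c, s, h1, h2⟩ := exists_eigenvector_of_symm ha
  obtain ⟨i1, i2, i3, i4⟩ := inv_entries u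
  have key : ∀ c s : ℝ, c ^ 2 + s ^ 2 = 1 →
      c * ((u * a * u⁻¹) 1 0 * c + (u * a * u⁻¹) 1 1 * s)
        = s * ((u * a * u⁻¹) 0 0 * c + (u * a * u⁻¹) 0 1 * s) →
      ((u 1 1 * c - u 0 1 * s ≠ 0) ∨ (-u 1 0 * c + u 0 0 * s ≠ 0)) ∧
      (QuotientGroup.mk a : PSL2R) • ofHom ((u 1 1 * c - u 0 1 * s : ℝ) : ℂ)
        ((-u 1 0 * c + u 0 0 * s : ℝ) : ℂ)
        = ofHom ((u 1 1 * c - u 0 1 * s : ℝ) : ℂ) ((-u 1 0 * c + u 0 0 * s : ℝ) : ℂ) := by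
    intro c s h1 h2
    have h0 : c ≠ 0 ∨ s ≠ 0 := by
      by_contra! h
      rw [h.1, h.2] at h1
      norm_num at h1
    have hv : ofHom ((u 1 1 * c - u 0 1 * s : ℝ) : ℂ) ((-u 1 0 * c + u 0 0 * s : ℝ) : ℂ)
        = (QuotientGroup.mk u⁻¹ : PSL2R) • ofHom c s := by
      rw [mk_smul_ofHom _ (by simpa using h0), i1, i2, i3, i4]
      push_cast
      congr 1
      ring
    constructor
    · have := real_hom_ne_zero u⁻¹ h0
      rw [i1, i2, i3, i4] at this
      rcases this with h | h
      · left; intro h'; apply h; linarith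
      · exact Or.inr h
    · have h3 := smul_ofHom_of_eigenvector _ h0 h2
      rw [hv]
      conv_rhs => rw [← h3]
      rw [← mul_smul, ← mul_smul, ← QuotientGroup.mk_mul, ← QuotientGroup.mk_mul]
      congr 2
      group
  obtain ⟨n1, f1⟩ := key c s h1 h2
  -- By symmetry, the orthogonal vector is an eigenvector too.
  obtain ⟨n2, f2⟩ := key (-s) c (by linarith) (by linear_combination -h2 - (c ^ 2 + s ^ 2) * ha)
  refine ⟨_, _, _, _, n1, n2, f1, f2, ?_⟩
  linear_combination (α * (u 1 1 ^ 2 + u 0 1 ^ 2) - 2 * β * (u 1 1 * u 1 0 + u 0 1 * u 0 0)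
          + γ * (u 1 0 ^ 2 + u 0 0 ^ 2)) * h1

/-- If a real quadratic form separates the fixed points of `a` from those of `b`, the axes of `a`
and `b` do not cross. -/
theorem commDet_nonpos_of_separated {a b : SL(2, ℝ)} {α β γ : ℝ}
    (ha : ∀ x y : ℝ, (x ≠ 0 ∨ y ≠ 0) → (QuotientGroup.mk a : PSL2R) • ofHom x y = ofHom x y →
      0 ≤ α * x ^ 2 + 2 * β * x * y + γ * y ^ 2)
    (hb : ∀ x y : ℝ, (x ≠ 0 ∨ y ≠ 0) → (QuotientGroup.mk b : PSL2R) • ofHom x y = ofHom x y →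
      α * x ^ 2 + 2 * β * x * y + γ * y ^ 2 < 0) : commDet a b ≤ 0 := by
  by_contra! h
  obtain ⟨u, sa, sb⟩ := exists_conj_symm h
  obtain ⟨x, y, x', y', h1, h2, f1, f2, e⟩ := exists_fixed_pair u a sa α β γ
  obtain ⟨z, w, z', w', h3, h4, f3, f4, e'⟩ := exists_fixed_pair u b sb α β γ
  -- Both sums equal the same trace, but one is nonnegative and the other negative.
  linarith [ha _ _ h1 f1, ha _ _ h2 f2, hb _ _ h3 f3, hb _ _ h4 f4]

theorem mk_smul_real_coe_iff (a : SL(2, ℝ)) (p : ℝ) :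
    (QuotientGroup.mk a : PSL2R) • (p : OnePoint ℝ) = p ↔
      a 1 0 * p ^ 2 - (a 0 0 - a 1 1) * p - a 0 1 = 0 := by
  rw [mk_smul_realLine, smul_some_eq_ite]
  have m : ∀ i j, (Matrix.SpecialLinearGroup.toGL
      (Matrix.SpecialLinearGroup.map (algebraMap ℝ ℝ) a)) i j = a i j := fun i j => rfl
  rw [m, m, m, m]
  have hd := det_eq a
  by_cases h0 : a 1 0 * p + a 1 1 = 0
  · rw [if_pos h0]
    refine ⟨fun h => absurd h (OnePoint.infty_ne_coe p), fun h => ?_⟩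
    exfalso
    have h1 : a 0 0 * p + a 0 1 = 0 := by linear_combination -h + p * h0
    have h2 : a 0 0 * (a 1 0 * p + a 1 1) - a 1 0 * (a 0 0 * p + a 0 1) = 1 := by
      linear_combination hd
    rw [h0, h1] at h2
    norm_num at h2
  · rw [if_neg h0, OnePoint.coe_eq_coe, div_eq_iff h0]
    constructor <;> intro h <;> linear_combination -h

theorem mk_smul_real_infty_iff (a : SL(2, ℝ)) :
    (QuotientGroup.mk a : PSL2R) • (∞ : OnePoint ℝ) = ∞ ↔ a 1 0 = 0 := by
  rw [mk_smul_realLine, smul_infty_eq_self_iff]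
  rfl

theorem dist_center_sq (z : ℍ) (m : ℝ) :
    dist (z : ℂ) (m : ℂ) ^ 2 = (z.re - m) ^ 2 + z.im ^ 2 := by
  rw [dist_eq_norm, ← Complex.normSq_eq_norm_sq, Complex.normSq_apply]
  simp only [Complex.sub_re, Complex.sub_im, Complex.ofReal_re, Complex.ofReal_im,
    UpperHalfPlane.coe_re, UpperHalfPlane.coe_im]
  ring

/-- The quadratic equation of the fixed points, with `p ^ 2` replaced by `|z|²` and `p` by `Re z`,
is the equation of the geodesic joining them. -/
theorem eq_of_mem_axis {a : SL(2, ℝ)} {z : ℍ} (h : z ∈ axis (QuotientGroup.mk a)) :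
    a 1 0 * (z.re ^ 2 + z.im ^ 2) - (a 0 0 - a 1 1) * z.re - a 0 1 = 0 := by
  rcases h with ⟨p, q, hpq, hp, hq, hd⟩ | ⟨p, hp, hi, hz⟩
  · rw [mk_smul_real_coe_iff] at hp hq
    have h1 := dist_center_sq z ((p + q) / 2)
    rw [hd, div_pow, sq_abs] at h1
    have h2 : z.re ^ 2 + z.im ^ 2 = (p + q) * z.re - p * q := by linarith
    have hpq' : p - q ≠ 0 := sub_ne_zero.mpr hpq
    have h3 : a 1 0 * (p + q) = a 0 0 - a 1 1 := by
      apply mul_left_cancel₀ hpq'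
      linear_combination hp - hq
    rw [h2]
    linear_combination z.re * h3 + hp - p * h3
  · rw [mk_smul_real_coe_iff] at hp
    rw [mk_smul_real_infty_iff] at hi
    rw [hi] at hp ⊢
    rw [hz]
    linarith

theorem mem_axis_of_eq {a : SL(2, ℝ)} (ha : 4 < tr a ^ 2) {z : ℍ}
    (h : a 1 0 * (z.re ^ 2 + z.im ^ 2) - (a 0 0 - a 1 1) * z.re - a 0 1 = 0) :
    z ∈ axis (QuotientGroup.mk a) := by
  have hdet := det_eq a
  rw [tr] at ha
  by_cases hc : a 1 0 = 0
  · right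
    refine ⟨z.re, ?_, (mk_smul_real_infty_iff a).mpr hc, rfl⟩
    rw [mk_smul_real_coe_iff]
    rw [hc] at h ⊢
    linarith
  · left
    set d := √((a 0 0 + a 1 1) ^ 2 - 4) with hd
    have hpos : 0 < (a 0 0 + a 1 1) ^ 2 - 4 := by linarith
    have hd0 : 0 < d := Real.sqrt_pos.mpr hpos
    have hd2 : d ^ 2 = (a 0 0 + a 1 1) ^ 2 - 4 := Real.sq_sqrt hpos.le
    refine ⟨(a 0 0 - a 1 1 + d) / (2 * a 1 0), (a 0 0 - a 1 1 - d) / (2 * a 1 0), ?_, ?_, ?_, ?_⟩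
    · intro h
      rw [div_left_inj' (by simpa using hc)] at h
      linarith
    · rw [mk_smul_real_coe_iff]
      field_simp
      linear_combination hd2 + 4 * hdet
    · rw [mk_smul_real_coe_iff]
      field_simp
      linear_combination hd2 + 4 * hdet
    · rw [← sq_eq_sq₀ dist_nonneg (by positivity), dist_center_sq, div_pow, sq_abs]
      field_simp
      linear_combination (16 * a 1 0) * h - 4 * hd2 - 16 * hdet

theorem axis_inter_nonempty {a b : SL(2, ℝ)} (ha : 4 < tr a ^ 2) (hb : 4 < tr b ^ 2)
    (h : 0 < commDet a b) :
    (axis (QuotientGroup.mk a) ∩ axis (QuotientGroup.mk b)).Nonempty := by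
  obtain ⟨x, y, hy, h1, h2⟩ := exists_point_of_commDet_pos h
  exact ⟨⟨⟨x, y⟩, hy⟩, mem_axis_of_eq ha h1, mem_axis_of_eq hb h2⟩

theorem closure_range_eq {ι G : Type*} [Group G] {A A' : ι → G} (i : ι)
    (h : ∀ k, k ≠ i → A' k = A k)
    (h1 : A' i ∈ Subgroup.closure (range A)) (h2 : A i ∈ Subgroup.closure (range A')) :
    Subgroup.closure (range A') = Subgroup.closure (range A) := by
  apply le_antisymm <;> rw [Subgroup.closure_le] <;> rintro _ ⟨k, rfl⟩ <;> by_cases hk : k = i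
  · exact hk ▸ h1
  · rw [h k hk]; exact Subgroup.subset_closure ⟨k, rfl⟩
  · exact hk ▸ h2
  · rw [← h k hk]; exact Subgroup.subset_closure ⟨k, rfl⟩

-- Classical on all generating sets forces crossing axes and genus two

section AlwaysClassical

variable {g : ℕ} {G : Subgroup PSL2R}

theorem mk_eq_mk_comm {a b : SL(2, ℝ)} : (QuotientGroup.mk a : PSL2R) * QuotientGroup.mk b
    = QuotientGroup.mk b * QuotientGroup.mk a ↔
      (QuotientGroup.mk (a * b * a⁻¹ * b⁻¹) : PSL2R) = 1 := by
  rw [QuotientGroup.mk_mul, QuotientGroup.mk_mul, QuotientGroup.mk_mul, QuotientGroup.mk_inv,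
    QuotientGroup.mk_inv, mul_inv_eq_one, mul_inv_eq_iff_eq_mul]

/-- The commutator is a nontrivial element of `G`, hence hyperbolic, and its trace is `2 - commDet a
b`. This excludes the whole interval `[0, 4]` for `commDet`. -/
theorem commDet_ne_zero {a b : SL(2, ℝ)}
    (hG : ∀ w : SL(2, ℝ), (QuotientGroup.mk w : PSL2R) ∈ G → (QuotientGroup.mk w : PSL2R) ≠ 1 →
      4 < tr w ^ 2)
    (ha : (QuotientGroup.mk a : PSL2R) ∈ G) (hb : (QuotientGroup.mk b : PSL2R) ∈ G)
    (hab : (QuotientGroup.mk a : PSL2R) * QuotientGroup.mk b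
      ≠ QuotientGroup.mk b * QuotientGroup.mk a) : 4 < (2 - commDet a b) ^ 2 := by
  rw [← tr_commutator]
  refine hG _ ?_ (fun h => hab (mk_eq_mk_comm.mpr h))
  exact G.mul_mem (G.mul_mem (G.mul_mem ha hb) (G.inv_mem ha)) (G.inv_mem hb)

/-- On a classical generating set, conjugating by a generator `A j` separates axes. -/
theorem commDet_conj_nonpos {A : Fin g → PSL2R} (hA : PairsCurves IsGeometricCircle A)
    {j : Fin g} {a b c : SL(2, ℝ)} (hc : (QuotientGroup.mk c : PSL2R) = A j)
    (ha : ∃ i, i ≠ j ∧ (QuotientGroup.mk a : PSL2R) = A i)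
    (hb : ∃ i, i ≠ j ∧ (QuotientGroup.mk b : PSL2R) = A i) :
    commDet a (c * b * c⁻¹) ≤ 0 ∧ commDet a (c⁻¹ * b * c) ≤ 0 := by
  obtain ⟨C, K, D, hCD, hp⟩ := hA.exists_pingPong fun _ h => h.isClosed
  obtain ⟨i, hij, hi⟩ := ha
  obtain ⟨i', hij', hi'⟩ := hb
  -- The fixed points of `a` avoid both discs of `A j`. Those of `b` do as well, so `d` carries them
  -- into the disc of the letter `(j, l)`, where the fixed points of `d b d⁻¹` therefore lie; the
  -- quadratic form of that disc separates the two axes.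
  have key : ∀ (l : Bool) (d : SL(2, ℝ)), (QuotientGroup.mk d : PSL2R) = letter A (j, l) →
      commDet a (d * b * d⁻¹) ≤ 0 := by
    intro l d hd
    obtain ⟨α, β, γ, hq⟩ := (hCD (j, l)).2.exists_real_form (hCD (j, l)).1
    refine commDet_nonpos_of_separated (α := α) (β := β) (γ := γ) ?_ ?_
    · intro x y h0 hf
      by_contra! hlt
      rw [← hq x y h0] at hlt
      rw [hi] at hf
      exact hp.fixed_notMem hij hf l (hp.subset _ hlt)
    · intro x y h0 hf
      rw [← hq x y h0]
      have hf' : (QuotientGroup.mk b : PSL2R) • ((QuotientGroup.mk d : PSL2R)⁻¹ • ofHom x y)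
          = (QuotientGroup.mk d : PSL2R)⁻¹ • ofHom x y := by
        conv_rhs => rw [← hf]
        rw [QuotientGroup.mk_mul, QuotientGroup.mk_mul, QuotientGroup.mk_inv, ← mul_smul,
          ← mul_smul]
        congr 1
        group
      rw [hi'] at hf'
      have := hp.maps (j, l) _ (hp.fixed_notMem hij' hf' (!l))
      rwa [← hd, smul_inv_smul] at this
  refine ⟨key true c hc, ?_⟩
  have := key false c⁻¹ (by simp [letter, ← hc])
  rwa [inv_inv] at this

/-- Non-crossing generators could be replaced by `a b⁻¹, b` and by `a b, b`. Both are generating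
sets, and separation of `a b⁻¹` from its conjugate `b⁻¹ a` (and likewise with `b⁻¹` for `b`) bounds
the traces of `a b⁻¹` and `a b` in a way incompatible with hyperbolicity of `a` and `b`. -/
theorem commDet_pos_of_always_classical
    (hH : ∀ w : SL(2, ℝ), (QuotientGroup.mk w : PSL2R) ∈ G → (QuotientGroup.mk w : PSL2R) ≠ 1 →
      4 < tr w ^ 2)
    (hcl : ∀ A : Fin g → PSL2R, Generates A G → IsClassicalOn G A)
    {A : Fin g → PSL2R} (hA : Generates A G) {i j : Fin g} (hij : i ≠ j) {a b : SL(2, ℝ)}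
    (ha : (QuotientGroup.mk a : PSL2R) = A i) (hb : (QuotientGroup.mk b : PSL2R) = A j) :
    4 < tr a ^ 2 ∧ 4 < tr b ^ 2 ∧ 0 < commDet a b := by
  obtain ⟨C, K, D, hCD, hp⟩ := (hcl A hA).2.exists_pingPong fun _ h => h.isClosed
  have hmem : ∀ k, A k ∈ G := fun k => hA ▸ Subgroup.subset_closure ⟨k, rfl⟩
  have hnc := hp.not_commute hij
  have ha4 : 4 < tr a ^ 2 := hH a (ha ▸ hmem i) fun h => hnc (by rw [← ha, h, one_mul, mul_one])
  have hb4 : 4 < tr b ^ 2 := hH b (hb ▸ hmem j) fun h => hnc (by rw [← hb, h, one_mul, mul_one])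
  refine ⟨ha4, hb4, ?_⟩
  by_contra! hle
  have hne : commDet a b ≠ 0 := by
    intro h0
    have := commDet_ne_zero hH (ha ▸ hmem i) (hb ▸ hmem j) (by rw [ha, hb]; exact hnc)
    rw [h0] at this
    norm_num at this
  have hlt : commDet a b < 0 := lt_of_le_of_ne hle hne
  have key : ∀ b' : SL(2, ℝ), (b' = b ∨ b' = b⁻¹) →
      tr a * tr b' * tr (a * b'⁻¹) - tr a ^ 2 - tr b' ^ 2 ≤ 0 := by
    intro b' hb'
    have hgen : Generates (Function.update A i (QuotientGroup.mk (a * b'⁻¹))) G := by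
      rw [Generates, ← hA]
      have hbA : ∀ H : Subgroup PSL2R, A j ∈ H → (QuotientGroup.mk b' : PSL2R) ∈ H := by
        rintro H hH'
        rcases hb' with rfl | rfl
        · rwa [hb]
        · rw [QuotientGroup.mk_inv, hb]; exact H.inv_mem hH'
      apply closure_range_eq i
      · intro k hk; rw [Function.update_of_ne hk]
      · rw [Function.update_self, QuotientGroup.mk_mul, QuotientGroup.mk_inv, ha]
        exact Subgroup.mul_mem _ (Subgroup.subset_closure ⟨i, rfl⟩)
          (Subgroup.inv_mem _ (hbA _ (Subgroup.subset_closure ⟨j, rfl⟩)))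
      · have e : A i = (QuotientGroup.mk (a * b'⁻¹) : PSL2R) * QuotientGroup.mk b' := by
          rw [← QuotientGroup.mk_mul, inv_mul_cancel_right, ha]
        rw [e]
        refine Subgroup.mul_mem _ (Subgroup.subset_closure ⟨i, by rw [Function.update_self]⟩)
          (hbA _ (Subgroup.subset_closure ⟨j, by rw [Function.update_of_ne hij.symm]⟩))
    have hc := commDet_conj_nonpos (hcl _ hgen).2 (j := j) (a := a * b'⁻¹) (b := a * b'⁻¹) (c := b)
      (by rw [Function.update_of_ne hij.symm, hb]) ⟨i, hij, by rw [Function.update_self]⟩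
      ⟨i, hij, by rw [Function.update_self]⟩
    have hcd : commDet (a * b'⁻¹) (b'⁻¹ * a) ≤ 0 := by
      rcases hb' with rfl | rfl
      · simpa [mul_assoc] using hc.2
      · simpa [mul_assoc] using hc.1
    have hab' : commDet a b' = commDet a b := by
      rcases hb' with rfl | rfl
      · rfl
      · exact commDet_inv_right a b
    rw [commDet_mul_inv, hab'] at hcd
    by_contra! hpos
    nlinarith [mul_pos (neg_pos.mpr hlt) hpos]
  have k1 := key b (Or.inl rfl)
  have k2 := key b⁻¹ (Or.inr rfl)
  rw [tr_mul_inv] at k1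
  rw [inv_inv, tr_inv] at k2
  -- Adding the bounds, with `tr (a b) + tr (a b⁻¹) = tr a tr b`, gives `x² y² ≤ 2 x² + 2 y²` for
  -- the traces `x`, `y`. This is impossible for `x², y² > 4`.
  nlinarith [mul_pos (sub_pos.mpr ha4) (sub_pos.mpr hb4)]

theorem crossing_of_always_classical (hg : 2 ≤ g)
    (hH : ∀ w : SL(2, ℝ), (QuotientGroup.mk w : PSL2R) ∈ G → (QuotientGroup.mk w : PSL2R) ≠ 1 →
      4 < tr w ^ 2)
    (hcl : ∀ A : Fin g → PSL2R, Generates A G → IsClassicalOn G A)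
    {A : Fin g → PSL2R} (hA : Generates A G) :
    g = 2 ∧ ∃ A B : PSL2R, IsHyperbolic A ∧ IsHyperbolic B ∧
      Subgroup.closure {A, B} = G ∧ (axis A ∩ axis B).Nonempty := by
  have hg2 : g = 2 := by
    by_contra hne
    let i : Fin g := ⟨0, by omega⟩
    let j : Fin g := ⟨1, by omega⟩
    let k : Fin g := ⟨2, by omega⟩
    have hij : i ≠ j := by simp [i, j]
    have hik : i ≠ k := by simp [i, k]
    have hjk : j ≠ k := by simp [j, k]
    obtain ⟨a, ha⟩ := exists_rep (A i)
    obtain ⟨b, hb⟩ := exists_rep (A j)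
    obtain ⟨c, hc⟩ := exists_rep (A k)
    have h1 := (commDet_conj_nonpos (hcl A hA).2 hc ⟨i, hik, ha⟩ ⟨j, hjk, hb⟩).1
    -- The pair `A i`, `A k A j (A k)⁻¹` is separated by a circle of `A k` in the old generating
    -- set, yet it must cross because it belongs to the new one.
    have hgen : Generates (Function.update A j (A k * A j * (A k)⁻¹)) G := by
      rw [Generates, ← hA]
      have mk : ∀ (B : Fin g → PSL2R) (l : Fin g), B l ∈ Subgroup.closure (range B) :=
        fun B l => Subgroup.subset_closure ⟨l, rfl⟩
      apply closure_range_eq j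
      · intro l hl; rw [Function.update_of_ne hl]
      · rw [Function.update_self]
        exact Subgroup.mul_mem _ (Subgroup.mul_mem _ (mk _ _) (mk _ _))
          (Subgroup.inv_mem _ (mk _ _))
      · have hj := mk (Function.update A j (A k * A j * (A k)⁻¹)) j
        have hk := mk (Function.update A j (A k * A j * (A k)⁻¹)) k
        rw [Function.update_self] at hj
        rw [Function.update_of_ne hjk.symm] at hk
        have := Subgroup.mul_mem _ (Subgroup.mul_mem _ (Subgroup.inv_mem _ hk) hj) hk
        convert this using 1
        group
    have h2 := (commDet_pos_of_always_classical hH hcl hgen hij (a := a) (b := c * b * c⁻¹)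
      (by rw [Function.update_of_ne hij, ha])
      (by rw [Function.update_self, QuotientGroup.mk_mul, QuotientGroup.mk_mul,
        QuotientGroup.mk_inv, hb, hc])).2.2
    linarith
  refine ⟨hg2, ?_⟩
  subst hg2
  obtain ⟨a, ha⟩ := exists_rep (A 0)
  obtain ⟨b, hb⟩ := exists_rep (A 1)
  obtain ⟨ha4, hb4, hab⟩ := commDet_pos_of_always_classical hH hcl hA (i := 0) (j := 1)
    (by decide) ha hb
  refine ⟨A 0, A 1, ⟨a, ha, (isHyperbolic_mk_iff a).mpr ha4⟩,
    ⟨b, hb, (isHyperbolic_mk_iff b).mpr hb4⟩, ?_, ?_⟩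
  · rw [← hA]
    congr 1
    ext x
    simp [eq_comm]
  · rw [← ha, ← hb]
    exact axis_inter_nonempty ha4 hb4 hab

end AlwaysClassical

-- Pairing circles by real quadratic forms

/-- A real quadratic form `c.1 x² + 2 c.2.1 x y + c.2.2 y²`, extended to a Hermitian form. -/
def realHerm (c : ℝ × ℝ × ℝ) (p q : ℂ) : ℝ := herm c.1 (c.2.1 : ℂ) c.2.2 p q

theorem realHerm_pos {c : ℝ × ℝ × ℝ} (h1 : 0 < c.1) (h2 : c.2.1 ^ 2 < c.1 * c.2.2) {p q : ℂ}
    (h : p ≠ 0 ∨ q ≠ 0) : 0 < realHerm c p q := by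
  obtain ⟨A, B, C⟩ := c
  simp only at h1 h2
  have e : A * realHerm (A, B, C) p q
      = Complex.normSq (A * p + B * q) + (A * C - B ^ 2) * Complex.normSq q := by
    simp only [realHerm, herm, Complex.normSq_apply, Complex.mul_re, Complex.mul_im,
      Complex.conj_re, Complex.conj_im, Complex.add_re, Complex.add_im, Complex.ofReal_re,
      Complex.ofReal_im]
    ring
  have hpos : 0 < A * realHerm (A, B, C) p q := by
    rw [e]
    by_cases hq : q = 0
    · have hp : p ≠ 0 := by simpa [hq] using h
      have : 0 < Complex.normSq (A * p + B * q) := by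
        rw [Complex.normSq_pos, hq]
        simp [hp, h1.ne']
      have := mul_nonneg (sub_pos.mpr h2).le (Complex.normSq_nonneg q)
      linarith
    · have := mul_pos (sub_pos.mpr h2) (Complex.normSq_pos.mpr hq)
      linarith [Complex.normSq_nonneg (A * p + B * q)]
  exact (mul_pos_iff_of_pos_left h1).mp hpos

theorem realHerm_add (c d : ℝ × ℝ × ℝ) (p q : ℂ) :
    realHerm c p q + realHerm d p q = realHerm (c + d) p q := by
  simp only [realHerm, herm, Prod.fst_add, Prod.snd_add, Complex.ofReal_add, add_mul,
    Complex.add_re]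
  ring

/-- The pull-back of a real quadratic form under a matrix. -/
def pullForm (u : SL(2, ℝ)) (c : ℝ × ℝ × ℝ) : ℝ × ℝ × ℝ :=
  (c.1 * u 0 0 ^ 2 + 2 * c.2.1 * u 0 0 * u 1 0 + c.2.2 * u 1 0 ^ 2,
    c.1 * u 0 0 * u 0 1 + c.2.1 * (u 0 0 * u 1 1 + u 0 1 * u 1 0) + c.2.2 * u 1 0 * u 1 1,
    c.1 * u 0 1 ^ 2 + 2 * c.2.1 * u 0 1 * u 1 1 + c.2.2 * u 1 1 ^ 2)

theorem realHerm_pullForm (u : SL(2, ℝ)) (c : ℝ × ℝ × ℝ) (p q : ℂ) :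
    realHerm (pullForm u c) p q
      = realHerm c (u 0 0 * p + u 0 1 * q) (u 1 0 * p + u 1 1 * q) := by
  simp only [realHerm, herm, pullForm, Complex.normSq_apply, Complex.mul_re, Complex.mul_im,
    Complex.conj_re, Complex.conj_im, Complex.add_re, Complex.add_im, Complex.ofReal_re,
    Complex.ofReal_im]
  ring

theorem pullForm_disc (u : SL(2, ℝ)) (c : ℝ × ℝ × ℝ) :
    (pullForm u c).2.1 ^ 2 - (pullForm u c).1 * (pullForm u c).2.2
      = c.2.1 ^ 2 - c.1 * c.2.2 := by
  have h := det_eq u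
  simp only [pullForm]
  linear_combination (c.2.1 ^ 2 - c.1 * c.2.2) * (u 0 0 * u 1 1 - u 0 1 * u 1 0 + 1) * h

/-- Real quadratic forms indexed by the letters whose negative sets play ping-pong. -/
structure PairsForms {ι : Type*} (a : ι → SL(2, ℝ)) (c : ι × Bool → ℝ × ℝ × ℝ) : Prop where
  disc_pos : ∀ l, 0 < (c l).2.1 ^ 2 - (c l).1 * (c l).2.2
  add_pos : ∀ l m, l ≠ m → ∀ p q : ℂ, (p ≠ 0 ∨ q ≠ 0) →
    0 < realHerm (c l) p q + realHerm (c m) p q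
  map_eq : ∀ i p q, realHerm (c (i, true)) (a i 0 0 * p + a i 0 1 * q) (a i 1 0 * p + a i 1 1 * q)
    = - realHerm (c (i, false)) p q

theorem PairsForms.conj {ι : Type*} {a : ι → SL(2, ℝ)} {c : ι × Bool → ℝ × ℝ × ℝ}
    (h : PairsForms a c) (u : SL(2, ℝ)) :
    PairsForms (fun i => u⁻¹ * a i * u) (fun l => pullForm u (c l)) where
  disc_pos l := by rw [pullForm_disc]; exact h.disc_pos l
  add_pos l m hlm p q h0 := by
    rw [realHerm_pullForm, realHerm_pullForm]
    exact h.add_pos l m hlm _ _ (hom_ne_zero u h0)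
  map_eq i p q := by
    rw [realHerm_pullForm, realHerm_pullForm, ← h.map_eq]
    have e : ∀ k j, (u 0 0 * (u⁻¹ * a i * u) 0 j + u 0 1 * (u⁻¹ * a i * u) 1 j
        = a i 0 0 * u 0 j + a i 0 1 * u 1 j) ∧ (u 1 0 * (u⁻¹ * a i * u) 0 j
          + u 1 1 * (u⁻¹ * a i * u) 1 j = a i k 0 * u 0 j + a i k 1 * u 1 j ∨ k = 0) := by
      intro k j
      have h1 := mul_entry u (u⁻¹ * a i * u)
      have h2 := mul_entry (a i) u
      have h3 : u * (u⁻¹ * a i * u) = a i * u := by group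
      rw [h3] at h1
      refine ⟨by rw [← h1, h2], ?_⟩
      fin_cases k
      · exact Or.inr rfl
      · left; simp only [Fin.mk_one]; rw [← h1, h2]
    have e1 : ∀ j, (u 0 0 * (u⁻¹ * a i * u) 0 j + u 0 1 * (u⁻¹ * a i * u) 1 j : ℂ)
        = a i 0 0 * u 0 j + a i 0 1 * u 1 j := fun j => by exact_mod_cast (e 0 j).1
    have e2 : ∀ j, (u 1 0 * (u⁻¹ * a i * u) 0 j + u 1 1 * (u⁻¹ * a i * u) 1 j : ℂ)
        = a i 1 0 * u 0 j + a i 1 1 * u 1 j := fun j => by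
      exact_mod_cast ((e 1 j).2.resolve_right one_ne_zero)
    congr 1
    · linear_combination p * e1 0 + q * e1 1
    · linear_combination p * e2 0 + q * e2 1

/-- Two forms with positive definite sum cannot both be nonpositive at a point, so the closed discs
are disjoint. The sign change in `map_eq` turns the outside of one circle into the inside of its
partner. -/
theorem PairsForms.pairsCurves {g : ℕ} {a : Fin g → SL(2, ℝ)} {c : Fin g × Bool → ℝ × ℝ × ℝ}
    (h : PairsForms a c) :
    PairsCurves IsGeometricCircle (fun i => (QuotientGroup.mk (a i) : PSL2R)) := by
  have hdisc : ∀ l, 0 < Complex.normSq ((c l).2.1 : ℂ) - (c l).1 * (c l).2.2 := by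
    intro l
    rw [Complex.normSq_ofReal, ← sq]
    exact h.disc_pos l
  have hdis : ∀ l m, l ≠ m →
      Disjoint ({x | hermVal (c l).1 (c l).2.1 (c l).2.2 x = 0}
          ∪ {x | hermVal (c l).1 (c l).2.1 (c l).2.2 x < 0})
        ({x | hermVal (c m).1 (c m).2.1 (c m).2.2 x = 0}
          ∪ {x | hermVal (c m).1 (c m).2.1 (c m).2.2 x < 0}) := by
    intro l m hlm
    rw [Set.disjoint_left]
    intro x hx hx'
    obtain ⟨p, q, h0, rfl⟩ := exists_ofHom x
    simp only [mem_union, mem_ofPred_eq, hermVal_zero_iff _ _ _ h0, hermVal_neg_iff _ _ _ h0]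
      at hx hx'
    have := h.add_pos l m hlm p q h0
    simp only [realHerm] at this
    rcases hx with hx | hx <;> rcases hx' with hx' | hx' <;> linarith
  have him : ∀ i (x : Sphere), ∃ p q : ℂ, ∃ _ : p ≠ 0 ∨ q ≠ 0, x = ofHom p q ∧
      (QuotientGroup.mk (a i) : PSL2R) • x
        = ofHom (a i 0 0 * p + a i 0 1 * q) (a i 1 0 * p + a i 1 1 * q) := by
    intro i x
    obtain ⟨p, q, h0, rfl⟩ := exists_ofHom x
    exact ⟨p, q, h0, rfl, mk_smul_ofHom _ h0⟩
  refine ⟨fun i => {x | hermVal (c (i, false)).1 (c (i, false)).2.1 (c (i, false)).2.2 x = 0},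
    fun i => {x | hermVal (c (i, false)).1 (c (i, false)).2.1 (c (i, false)).2.2 x < 0},
    fun i => {x | hermVal (c (i, true)).1 (c (i, true)).2.1 (c (i, true)).2.2 x = 0},
    fun i => {x | hermVal (c (i, true)).1 (c (i, true)).2.1 (c (i, true)).2.2 x < 0},
    fun i => ⟨isGeometricCircle_hermVal_zero _ _ _ (hdisc _),
      isGeometricCircle_hermVal_zero _ _ _ (hdisc _), isSide_hermVal_neg _ _ _ (hdisc _),
      isSide_hermVal_neg _ _ _ (hdisc _)⟩,
    fun i j hij => hdis _ _ (by simpa using hij), fun i j hij => hdis _ _ (by simpa using hij),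
    fun i j => hdis _ _ (by simp), fun i => ?_, fun i => ?_⟩
  · change (MulAction.toPerm (QuotientGroup.mk (a i) : PSL2R)) '' _ = _
    rw [Equiv.image_eq_preimage_symm]
    ext x
    obtain ⟨y, rfl⟩ := (MulAction.toPerm (QuotientGroup.mk (a i) : PSL2R)).surjective x
    rw [mem_preimage, Equiv.symm_apply_apply, MulAction.toPerm_apply]
    obtain ⟨p, q, h0, rfl, e⟩ := him i y
    rw [e, mem_ofPred_eq, mem_ofPred_eq, hermVal_zero_iff _ _ _ h0,
      hermVal_zero_iff _ _ _ (hom_ne_zero _ h0)]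
    have := h.map_eq i p q
    simp only [realHerm] at this
    rw [this, neg_eq_zero]
  · change (MulAction.toPerm (QuotientGroup.mk (a i) : PSL2R)) '' _ = _
    rw [Equiv.image_eq_preimage_symm]
    ext x
    obtain ⟨y, rfl⟩ := (MulAction.toPerm (QuotientGroup.mk (a i) : PSL2R)).surjective x
    rw [mem_preimage, Equiv.symm_apply_apply, MulAction.toPerm_apply]
    obtain ⟨p, q, h0, rfl, e⟩ := him i y
    rw [e, mem_compl_iff, mem_union, mem_ofPred_eq, mem_ofPred_eq, mem_ofPred_eq,
      hermVal_zero_iff _ _ _ h0, hermVal_neg_iff _ _ _ h0, hermVal_neg_iff _ _ _ (hom_ne_zero _ h0)]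
    have := h.map_eq i p q
    simp only [realHerm] at this
    rw [this, Left.neg_neg_iff, ← le_iff_eq_or_lt, not_le]

-- Normal pairs and their rectangles

/-- A pair of symmetric matrices whose Klein model displacement coordinates
`(a₀₀ - a₁₁) / tr a` and `2 b₀₁ / tr b` have squares of sum greater than one. -/
structure IsNormalPair (a b : SL(2, ℝ)) : Prop where
  symm_left : a 0 1 = a 1 0
  symm_right : b 0 1 = b 1 0
  one_lt : 1 < ((a 0 0 - a 1 1) / tr a) ^ 2 + (2 * b 0 1 / tr b) ^ 2

theorem exists_pos_of_det_neg {A B D : ℝ} (h : A * D - B ^ 2 < 0) :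
    ∃ m n : ℝ, 0 < A * m ^ 2 + 2 * B * m * n + D * n ^ 2 := by
  rcases lt_trichotomy A 0 with hA | rfl | hA
  · exact ⟨B, -A, by nlinarith [mul_pos_of_neg_of_neg hA h]⟩
  · have hB : B ≠ 0 := by rintro rfl; simp at h
    refine ⟨(1 - D) / (2 * B), 1, ?_⟩
    have : 2 * B * ((1 - D) / (2 * B)) = 1 - D := by field_simp
    linarith
  · exact ⟨1, 0, by simpa using hA⟩

/-- The rotation matrix. -/
def rot (θ : ℝ) : SL(2, ℝ) :=
  ⟨!![Real.cos θ, -Real.sin θ; Real.sin θ, Real.cos θ], by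
    rw [Matrix.det_fin_two_of]; linear_combination Real.sin_sq_add_cos_sq θ⟩

/-- Conjugating by `rot θ`, an elliptic element fixing `i`, turns the displacement vector `(a₀₀ -
a₁₁, 2 a₀₁)` by the angle `2 θ`. -/
theorem rot_conj {θ : ℝ} {a : SL(2, ℝ)} (ha : a 0 1 = a 1 0) :
    (rot θ * a * (rot θ)⁻¹) 0 1 = (rot θ * a * (rot θ)⁻¹) 1 0 ∧
    2 * (rot θ * a * (rot θ)⁻¹) 0 1
      = Real.sin (2 * θ) * (a 0 0 - a 1 1) + Real.cos (2 * θ) * (2 * a 0 1) ∧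
    (rot θ * a * (rot θ)⁻¹) 0 0 - (rot θ * a * (rot θ)⁻¹) 1 1
      = Real.cos (2 * θ) * (a 0 0 - a 1 1) - Real.sin (2 * θ) * (2 * a 0 1) := by
  obtain ⟨i1, i2, i3, i4⟩ := inv_entries (rot θ)
  have t1 : rot θ 0 0 = Real.cos θ := rfl
  have t2 : rot θ 0 1 = -Real.sin θ := rfl
  have t3 : rot θ 1 0 = Real.sin θ := rfl
  have t4 : rot θ 1 1 = Real.cos θ := rfl
  simp only [mul_entry, i1, i2, i3, i4, t1, t2, t3, t4, Real.sin_two_mul, Real.cos_two_mul', ha]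
  refine ⟨?_, ?_, ?_⟩ <;> ring

theorem tr_ne_zero_of_symm {a : SL(2, ℝ)} (ha : a 0 1 = a 1 0) : tr a ≠ 0 := by
  intro h0
  have hda := det_eq a
  have h1 : a 1 1 = -a 0 0 := by rw [tr] at h0; linarith
  rw [← ha, h1] at hda
  nlinarith [sq_nonneg (a 0 1), sq_nonneg (a 0 0)]

/-- With the crossing point moved to `i`, let `p`, `q` be the displacement vectors of `a`, `b` in
the Klein disc. A rotation by `φ` gives a normal pair when a certain quadratic form in `(cos φ, sin
φ)` exceeds `1`. Subtracting the unit form leaves one with determinant `(1 - |p|²) (1 - |q|²) - (p ×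
q)²`, which is negative exactly when `commDet > 4`, so it takes a positive value somewhere. -/
theorem exists_conj_isNormalPair {a b : SL(2, ℝ)} (h : 4 < commDet a b) :
    ∃ u : SL(2, ℝ), IsNormalPair (u * a * u⁻¹) (u * b * u⁻¹) := by
  obtain ⟨v, sa, sb⟩ := exists_conj_symm (by linarith : 0 < commDet a b)
  rw [← commDet_conj v] at h
  set a' := v * a * v⁻¹ with ha'
  set b' := v * b * v⁻¹ with hb'
  have hda := det_eq a'
  have hdb := det_eq b'
  have hx : tr a' ≠ 0 := tr_ne_zero_of_symm sa
  have hy : tr b' ≠ 0 := tr_ne_zero_of_symm sb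
  have hcd : commDet a' b'
      = (b' 0 1 * (a' 0 0 - a' 1 1) - a' 0 1 * (b' 0 0 - b' 1 1)) ^ 2 := by
    rw [commDet_eq]
    simp only [mul_entry, ← sa, ← sb]
    ring
  set p₁ := (a' 0 0 - a' 1 1) / tr a' with hp₁
  set p₂ := 2 * a' 0 1 / tr a' with hp₂
  set q₁ := (b' 0 0 - b' 1 1) / tr b' with hq₁
  set q₂ := 2 * b' 0 1 / tr b' with hq₂
  have hP : (1 - p₁ ^ 2 - p₂ ^ 2) * tr a' ^ 2 = 4 := by
    rw [hp₁, hp₂]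
    field_simp
    rw [tr]
    linear_combination 4 * hda - 4 * a' 0 1 * sa
  have hQ : (1 - q₁ ^ 2 - q₂ ^ 2) * tr b' ^ 2 = 4 := by
    rw [hq₁, hq₂]
    field_simp
    rw [tr]
    linear_combination 4 * hdb - 4 * b' 0 1 * sb
  have hC : (p₁ * q₂ - p₂ * q₁) ^ 2 * (tr a' ^ 2 * tr b' ^ 2) = 4 * commDet a' b' := by
    rw [hcd, hp₁, hp₂, hq₁, hq₂]
    field_simp
    ring
  have hxy : 0 < tr a' ^ 2 * tr b' ^ 2 := by positivity
  have hneg : (p₁ ^ 2 + q₂ ^ 2 - 1) * (p₂ ^ 2 + q₁ ^ 2 - 1) - (q₁ * q₂ - p₁ * p₂) ^ 2 < 0 := by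
    have e : ((p₁ ^ 2 + q₂ ^ 2 - 1) * (p₂ ^ 2 + q₁ ^ 2 - 1) - (q₁ * q₂ - p₁ * p₂) ^ 2)
        * (tr a' ^ 2 * tr b' ^ 2) = 16 - 4 * commDet a' b' := by
      linear_combination ((1 - q₁ ^ 2 - q₂ ^ 2) * tr b' ^ 2) * hP + 4 * hQ - hC
    by_contra! hn
    have := mul_nonneg hn hxy.le
    linarith
  obtain ⟨m, n, hmn⟩ := exists_pos_of_det_neg hneg
  have hm : (‖(⟨m, n⟩ : ℂ)‖) * Real.cos (Complex.arg ⟨m, n⟩) = m := Complex.norm_mul_cos_arg _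
  have hn : (‖(⟨m, n⟩ : ℂ)‖) * Real.sin (Complex.arg ⟨m, n⟩) = n := Complex.norm_mul_sin_arg _
  set r := ‖(⟨m, n⟩ : ℂ)‖
  set φ := Complex.arg ⟨m, n⟩
  -- Half the polar angle of `(m, n)`, because `rot` turns the Klein disc by twice its angle.
  refine ⟨rot (φ / 2) * v, ?_⟩
  have ea : rot (φ / 2) * v * a * (rot (φ / 2) * v)⁻¹ = rot (φ / 2) * a' * (rot (φ / 2))⁻¹ := by
    rw [ha']; group
  have eb : rot (φ / 2) * v * b * (rot (φ / 2) * v)⁻¹ = rot (φ / 2) * b' * (rot (φ / 2))⁻¹ := by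
    rw [hb']; group
  rw [ea, eb]
  obtain ⟨s1, s2, s3⟩ := rot_conj (θ := φ / 2) sa
  obtain ⟨s1', s2', s3'⟩ := rot_conj (θ := φ / 2) sb
  refine ⟨s1, s1', ?_⟩
  rw [s3, s2', tr_conj (rot (φ / 2)) a', tr_conj (rot (φ / 2)) b', mul_div_cancel₀ φ two_ne_zero]
  have e1 : (Real.cos φ * (a' 0 0 - a' 1 1) - Real.sin φ * (2 * a' 0 1)) / tr a'
      = Real.cos φ * p₁ - Real.sin φ * p₂ := by rw [hp₁, hp₂]; ring
  have e2 : (Real.sin φ * (b' 0 0 - b' 1 1) + Real.cos φ * (2 * b' 0 1)) / tr b'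
      = Real.sin φ * q₁ + Real.cos φ * q₂ := by rw [hq₁, hq₂]; ring
  rw [e1, e2]
  have hsc := Real.sin_sq_add_cos_sq φ
  have hfin : 0 < r ^ 2 * ((Real.cos φ * p₁ - Real.sin φ * p₂) ^ 2
      + (Real.sin φ * q₁ + Real.cos φ * q₂) ^ 2 - 1) := by
    convert hmn using 1
    rw [← hm, ← hn]
    linear_combination r ^ 2 * hsc
  have := (mul_pos_iff_of_pos_left (lt_of_le_of_ne (sq_nonneg r) (by
    intro h0; rw [← h0, zero_mul] at hfin; exact lt_irrefl _ hfin))).mp hfin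
  linarith

/-- The forms cutting out the sides of the fundamental rectangle of a normal pair. -/
def normalForms (α β : ℝ) : Fin 2 × Bool → ℝ × ℝ × ℝ
  | (0, true) => (α ^ 2 - α, 0, α ^ 2 + α)
  | (0, false) => (α ^ 2 + α, 0, α ^ 2 - α)
  | (1, true) => (β ^ 2, -β, β ^ 2)
  | (1, false) => (β ^ 2, β, β ^ 2)

namespace IsNormalPair

variable {a b : SL(2, ℝ)}

theorem sq_lt_one (h : IsNormalPair a b) : ((a 0 0 - a 1 1) / tr a) ^ 2 < 1 ∧
    (2 * b 0 1 / tr b) ^ 2 < 1 := by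
  have hda := det_eq a
  have hdb := det_eq b
  have ha0 := tr_ne_zero_of_symm h.symm_left
  have hb0 := tr_ne_zero_of_symm h.symm_right
  rw [← h.symm_left] at hda
  rw [← h.symm_right] at hdb
  constructor
  · rw [div_pow, div_lt_one (by positivity), tr]
    nlinarith [sq_nonneg (a 0 1)]
  · rw [div_pow, div_lt_one (by positivity), tr]
    nlinarith [sq_nonneg (b 0 0 - b 1 1)]

-- In the Klein disc, `a` is the half turn about the centre followed by the half turn about its
-- displacement point. So any chord through that point is paired with its opposite chord. The
-- vertical chords `x = ±α` are used for `a` and the horizontal chords `y = ±β` for `b`; they are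
-- disjoint because the corners `(±α, ±β)` lie outside the disc.
set_option linter.unusedSimpArgs false in
theorem pairsForms (h : IsNormalPair a b) :
    PairsForms ![a, b] (normalForms ((a 0 0 - a 1 1) / tr a) (2 * b 0 1 / tr b)) := by
  have hda := det_eq a
  have hdb := det_eq b
  have ha0 := tr_ne_zero_of_symm h.symm_left
  have hb0 := tr_ne_zero_of_symm h.symm_right
  obtain ⟨hα, hβ⟩ := h.sq_lt_one
  have h1 := h.one_lt
  have eα : (a 0 0 - a 1 1) / tr a * tr a = a 0 0 - a 1 1 := div_mul_cancel₀ _ ha0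
  have eβ : 2 * b 0 1 / tr b * tr b = 2 * b 0 1 := div_mul_cancel₀ _ hb0
  generalize (a 0 0 - a 1 1) / tr a = α at *
  generalize 2 * b 0 1 / tr b = β at *
  rw [tr] at eα eβ
  have hα0 : 0 < α ^ 2 := by linarith
  have hβ0 : 0 < β ^ 2 := by linarith
  refine ⟨?_, ?_, ?_⟩
  · rintro ⟨i, _ | _⟩ <;> fin_cases i <;> simp only [normalForms, Fin.zero_eta, Fin.mk_one] <;>
      nlinarith
  -- Adjacent sides: the sum is positive definite because `(α² + β²)² > α² + β²`. The four sign
  -- choices are the four corners; `k5` and `k6` below treat opposite sides.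
  · have key : ∀ e₁ e₂ : ℝ, e₁ ^ 2 = 1 → e₂ ^ 2 = 1 → ∀ p q : ℂ, (p ≠ 0 ∨ q ≠ 0) →
        0 < realHerm (α ^ 2 + β ^ 2 + e₁ * α, e₂ * β, α ^ 2 + β ^ 2 - e₁ * α) p q := by
      intro e₁ e₂ h₁ h₂ p q h0
      have hea : (e₁ * α) ^ 2 = α ^ 2 := by rw [mul_pow, h₁, one_mul]
      have heb : (e₂ * β) ^ 2 = β ^ 2 := by rw [mul_pow, h₂, one_mul]
      refine realHerm_pos ?_ ?_ h0
      · simp only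
        nlinarith [sq_nonneg (e₁ * α + 1)]
      · simp only
        nlinarith
    rintro ⟨i, k⟩ ⟨j, l⟩ hij p q h0
    rw [realHerm_add]
    have k1 := key 1 1 (by norm_num) (by norm_num) p q h0
    have k2 := key 1 (-1) (by norm_num) (by norm_num) p q h0
    have k3 := key (-1) 1 (by norm_num) (by norm_num) p q h0
    have k4 := key (-1) (-1) (by norm_num) (by norm_num) p q h0
    have k5 : 0 < realHerm (2 * α ^ 2, 0, 2 * α ^ 2) p q :=
      realHerm_pos (by simpa using hα0) (by simp only; nlinarith) h0
    have k6 : 0 < realHerm (2 * β ^ 2, 0, 2 * β ^ 2) p q :=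
      realHerm_pos (by simpa using hβ0) (by simp only; nlinarith) h0
    have hk : ∀ c d : ℝ × ℝ × ℝ, c.1 = d.1 → c.2.1 = d.2.1 → c.2.2 = d.2.2 →
        0 < realHerm c p q → 0 < realHerm d p q := by
      rintro ⟨c₁, c₂, c₃⟩ ⟨d₁, d₂, d₃⟩ rfl rfl rfl h
      exact h
    fin_cases i <;> fin_cases j <;> cases k <;> cases l <;>
      first
      | exact absurd rfl hij
      | (refine hk _ _ ?_ ?_ ?_ k1 <;> simp only [normalForms, Fin.zero_eta, Fin.mk_one,
          Prod.mk_add_mk] <;> ring1)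
      | (refine hk _ _ ?_ ?_ ?_ k2 <;> simp only [normalForms, Fin.zero_eta, Fin.mk_one,
          Prod.mk_add_mk] <;> ring1)
      | (refine hk _ _ ?_ ?_ ?_ k3 <;> simp only [normalForms, Fin.zero_eta, Fin.mk_one,
          Prod.mk_add_mk] <;> ring1)
      | (refine hk _ _ ?_ ?_ ?_ k4 <;> simp only [normalForms, Fin.zero_eta, Fin.mk_one,
          Prod.mk_add_mk] <;> ring1)
      | (refine hk _ _ ?_ ?_ ?_ k5 <;> simp only [normalForms, Fin.zero_eta, Fin.mk_one,
          Prod.mk_add_mk] <;> ring1)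
      | (refine hk _ _ ?_ ?_ ?_ k6 <;> simp only [normalForms, Fin.zero_eta, Fin.mk_one,
          Prod.mk_add_mk] <;> ring1)
  · have hneg : ∀ (c : ℝ × ℝ × ℝ) (p q : ℂ), realHerm (-c) p q = - realHerm c p q := by
      intro c p q
      simp only [realHerm, herm, Prod.fst_neg, Prod.snd_neg, Complex.ofReal_neg, neg_mul,
        Complex.neg_re]
      ring
    rw [← h.symm_left] at hda
    rw [← h.symm_right] at hdb
    intro i p q
    rw [← realHerm_pullForm, ← hneg]
    congr 1
    fin_cases i
    · simp only [normalForms, Fin.zero_eta, cons_val_zero, pullForm, Prod.neg_mk, Prod.mk.injEq,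
        ← h.symm_left]
      refine ⟨?_, ?_, ?_⟩
      · linear_combination α * a 0 0 * eα - (α ^ 2 + α) * hda
      · linear_combination α * a 0 1 * eα
      · linear_combination α * a 1 1 * eα - (α ^ 2 - α) * hda
    · simp only [normalForms, Fin.mk_one, cons_val_one, cons_val_zero, pullForm, Prod.neg_mk, Prod.mk.injEq,
        ← h.symm_right]
      refine ⟨?_, ?_, ?_⟩
      · linear_combination β * b 0 0 * eβ - β ^ 2 * hdb
      · linear_combination β * b 0 1 * eβ - β * hdb
      · linear_combination β * b 1 1 * eβ - β ^ 2 * hdb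

end IsNormalPair

/-- A pair with trace of the commutator less than `-2` pairs circles. -/
theorem pairsCurves_of_commDet {a b : SL(2, ℝ)} (h : 4 < commDet a b) :
    PairsCurves IsGeometricCircle ![(QuotientGroup.mk a : PSL2R), QuotientGroup.mk b] := by
  obtain ⟨u, hu⟩ := exists_conj_isNormalPair h
  convert (hu.pairsForms.conj u).pairsCurves using 1
  ext i
  fin_cases i
  · simp only [Fin.zero_eta, cons_val_zero]
    congr 1; group
  · simp only [Fin.mk_one, cons_val_one, cons_val_zero]
    congr 1; group

-- Invariance of the commutator trace under change of basis

section TracePolynomials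

open MvPolynomial

/-- The Fricke polynomial `x² + y² + z² - x y z - 4` in the variables `(z, x, y)`; its value at the
traces of `(A B, A, B)` is `tr [A, B] - 2`. -/
def fricke : MvPolynomial (Fin 3) ℂ := X 1 ^ 2 + X 2 ^ 2 + X 0 ^ 2 - X 0 * X 1 * X 2 - C 4

theorem eval_fricke (p : Fin 3 → ℂ) :
    eval p fricke = p 1 ^ 2 + p 2 ^ 2 + p 0 ^ 2 - p 0 * p 1 * p 2 - 4 := by
  simp [fricke]

/-- The trace coordinates of a pair of matrices. -/
def traceCoord (M N : SL(2, ℂ)) : Fin 3 → ℂ :=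
  ![(M * N) 0 0 + (M * N) 1 1, M 0 0 + M 1 1, N 0 0 + N 1 1]

theorem mul_entry_complex (a b : SL(2, ℂ)) (i j : Fin 2) :
    (a * b) i j = a i 0 * b 0 j + a i 1 * b 1 j := by
  rw [Matrix.SpecialLinearGroup.coe_mul, Matrix.mul_apply, Fin.sum_univ_two]

theorem det_eq_complex (a : SL(2, ℂ)) : a 0 0 * a 1 1 - a 0 1 * a 1 0 = 1 := by
  have := a.det_coe
  rwa [Matrix.det_fin_two] at this

theorem inv_entries_complex (w : SL(2, ℂ)) :
    w⁻¹ 0 0 = w 1 1 ∧ w⁻¹ 0 1 = - w 0 1 ∧ w⁻¹ 1 0 = - w 1 0 ∧ w⁻¹ 1 1 = w 0 0 := by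
  simp [Matrix.SpecialLinearGroup.SL2_inv_expl]

theorem eval_fricke_traceCoord (a b : SL(2, ℂ)) : eval (traceCoord a b) fricke
    = ((a * b) 0 0 - (b * a) 0 0) ^ 2
      + ((a * b) 0 1 - (b * a) 0 1) * ((a * b) 1 0 - (b * a) 1 0) := by
  have da := det_eq_complex a
  have db := det_eq_complex b
  rw [eval_fricke]
  simp only [traceCoord, mul_entry_complex, cons_val_zero, cons_val_one, cons_val]
  linear_combination (4 - (b 0 0 + b 1 1) ^ 2) * da + (4 * (a 0 0 * a 1 1 - a 0 1 * a 1 0)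
    - (a 0 0 + a 1 1) ^ 2) * db

theorem one_apply_zero_one : (1 : Matrix (Fin 2) (Fin 2) ℂ) 0 1 = 0 := rfl

theorem one_apply_one_zero : (1 : Matrix (Fin 2) (Fin 2) ℂ) 1 0 = 0 := rfl

/-- Matrix valued functions of a pair which are combinations of `1`, `M`, `N`, `M N` with
coefficients polynomial in the traces. -/
def IsTraceComb (F : SL(2, ℂ) → SL(2, ℂ) → SL(2, ℂ)) : Prop :=
  ∃ c₀ c₁ c₂ c₃ : MvPolynomial (Fin 3) ℂ, ∀ M N i j, F M N i j
    = eval (traceCoord M N) c₀ * (1 : Matrix (Fin 2) (Fin 2) ℂ) i j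
      + eval (traceCoord M N) c₁ * M i j + eval (traceCoord M N) c₂ * N i j
      + eval (traceCoord M N) c₃ * (M * N) i j

theorem IsTraceComb.mul_left_fst {F : SL(2, ℂ) → SL(2, ℂ) → SL(2, ℂ)} (h : IsTraceComb F) :
    IsTraceComb (fun M N => M * F M N) := by
  obtain ⟨c₀, c₁, c₂, c₃, h⟩ := h
  refine ⟨-c₁, c₀ + X 1 * c₁, -c₃, c₂ + X 1 * c₃, fun M N i j => ?_⟩
  have hd := det_eq_complex M
  rw [mul_entry_complex, h, h]
  simp only [map_neg, map_add, map_mul, eval_X]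
  have e1 : traceCoord M N 1 = M 0 0 + M 1 1 := rfl
  rw [e1]
  generalize eval (traceCoord M N) c₀ = k₀
  generalize eval (traceCoord M N) c₁ = k₁
  generalize eval (traceCoord M N) c₂ = k₂
  generalize eval (traceCoord M N) c₃ = k₃
  revert i j
  simp only [Fin.forall_fin_two, mul_entry_complex, Matrix.one_apply_eq, one_apply_zero_one,
    one_apply_one_zero]
  refine ⟨⟨?_, ?_⟩, ?_, ?_⟩
  · linear_combination (-k₁ - k₃ * N 0 0) * hd
  · linear_combination (- k₃ * N 0 1) * hd
  · linear_combination (- k₃ * N 1 0) * hd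
  · linear_combination (-k₁ - k₃ * N 1 1) * hd

/-- With `x`, `y`, `z` the traces of `M`, `N`, `M N`, Cayley–Hamilton gives `N² = y N - 1`, `N M =
(z - x y) + y M + x N - M N` and `N M N = z N + M - x`. -/
theorem IsTraceComb.mul_left_snd {F : SL(2, ℂ) → SL(2, ℂ) → SL(2, ℂ)} (h : IsTraceComb F) :
    IsTraceComb (fun M N => N * F M N) := by
  obtain ⟨c₀, c₁, c₂, c₃, h⟩ := h
  refine ⟨(X 0 - X 1 * X 2) * c₁ - c₂ - X 1 * c₃, X 2 * c₁ + c₃,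
    c₀ + X 1 * c₁ + X 2 * c₂ + X 0 * c₃, -c₁, fun M N i j => ?_⟩
  have hd := det_eq_complex N
  rw [mul_entry_complex, h, h]
  simp only [map_neg, map_add, map_mul, map_sub, eval_X]
  have e0 : traceCoord M N 0 = (M * N) 0 0 + (M * N) 1 1 := rfl
  have e1 : traceCoord M N 1 = M 0 0 + M 1 1 := rfl
  have e2 : traceCoord M N 2 = N 0 0 + N 1 1 := rfl
  rw [e0, e1, e2]
  generalize eval (traceCoord M N) c₀ = k₀
  generalize eval (traceCoord M N) c₁ = k₁
  generalize eval (traceCoord M N) c₂ = k₂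
  generalize eval (traceCoord M N) c₃ = k₃
  revert i j
  simp only [Fin.forall_fin_two, mul_entry_complex, Matrix.one_apply_eq, one_apply_zero_one,
    one_apply_one_zero]
  refine ⟨⟨?_, ?_⟩, ?_, ?_⟩
  · linear_combination (-k₂ - k₃ * M 1 1) * hd
  · linear_combination (k₃ * M 0 1) * hd
  · linear_combination (k₃ * M 1 0) * hd
  · linear_combination (-k₂ - k₃ * M 0 0) * hd

theorem IsTraceComb.sub_smul {F F' : SL(2, ℂ) → SL(2, ℂ) → SL(2, ℂ)} (h : IsTraceComb F)
    (h' : IsTraceComb F') (k : Fin 3) {F'' : SL(2, ℂ) → SL(2, ℂ) → SL(2, ℂ)}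
    (e : ∀ M N i j, F'' M N i j = traceCoord M N k * F M N i j - F' M N i j) :
    IsTraceComb F'' := by
  obtain ⟨c₀, c₁, c₂, c₃, h⟩ := h
  obtain ⟨d₀, d₁, d₂, d₃, h'⟩ := h'
  refine ⟨X k * c₀ - d₀, X k * c₁ - d₁, X k * c₂ - d₂, X k * c₃ - d₃, fun M N i j => ?_⟩
  rw [e, h, h']
  simp only [map_mul, map_sub, eval_X]
  ring

theorem isTraceComb_lift (w : FreeGroup (Fin 2)) :
    IsTraceComb (fun M N => FreeGroup.lift ![M, N] w) := by
  obtain ⟨L, rfl⟩ : ∃ L, FreeGroup.mk L = w := ⟨w.toWord, FreeGroup.mk_toWord⟩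
  simp only [FreeGroup.lift_mk]
  have hinv : ∀ (M A : SL(2, ℂ)) (i j : Fin 2), (M⁻¹ * A) i j
      = (M 0 0 + M 1 1) * A i j - (M * A) i j := by
    intro M A i j
    obtain ⟨i1, i2, i3, i4⟩ := inv_entries_complex M
    fin_cases i <;> fin_cases j <;> simp only [Fin.zero_eta, Fin.mk_one, mul_entry_complex, i1, i2,
      i3, i4] <;> ring
  induction L with
  | nil => exact ⟨1, 0, 0, 0, fun M N i j => by simp⟩
  | cons l L ih =>
    obtain ⟨i, b⟩ := l
    fin_cases i <;> cases b <;> simp only [List.map_cons, List.prod_cons, Fin.zero_eta, Fin.mk_one,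
      cons_val_zero, cons_val_one, cond_true, cond_false]
    · exact ih.sub_smul ih.mul_left_fst 1 fun M N i j => hinv M _ i j
    · exact ih.mul_left_fst
    · exact ih.sub_smul ih.mul_left_snd 2 fun M N i j => hinv N _ i j
    · exact ih.mul_left_snd

theorem exists_trace_polynomial (w : FreeGroup (Fin 2)) :
    ∃ T : MvPolynomial (Fin 3) ℂ, ∀ M N : SL(2, ℂ),
      (FreeGroup.lift ![M, N] w) 0 0 + (FreeGroup.lift ![M, N] w) 1 1
        = eval (traceCoord M N) T := by
  obtain ⟨c₀, c₁, c₂, c₃, h⟩ := isTraceComb_lift w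
  refine ⟨C 2 * c₀ + X 1 * c₁ + X 2 * c₂ + X 0 * c₃, fun M N => ?_⟩
  rw [h, h]
  simp only [map_mul, map_add, eval_X, eval_C]
  simp [traceCoord]
  ring

/-- The polynomial map on trace coordinates induced by a pair of words. -/
theorem exists_trace_map (u v : FreeGroup (Fin 2)) :
    ∃ Φ : Fin 3 → MvPolynomial (Fin 3) ℂ, ∀ M N : SL(2, ℂ),
      traceCoord (FreeGroup.lift ![M, N] u) (FreeGroup.lift ![M, N] v)
        = fun k => eval (traceCoord M N) (Φ k) := by
  obtain ⟨T₀, h₀⟩ := exists_trace_polynomial (u * v)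
  obtain ⟨T₁, h₁⟩ := exists_trace_polynomial u
  obtain ⟨T₂, h₂⟩ := exists_trace_polynomial v
  refine ⟨![T₀, T₁, T₂], fun M N => ?_⟩
  ext k
  fin_cases k
  · simp only [Fin.zero_eta, cons_val_zero, ← h₀, map_mul]; rfl
  · simp only [Fin.mk_one, cons_val_one, cons_val_zero, ← h₁]; rfl
  · simp only [Fin.reduceFinMk, cons_val, ← h₂]; rfl

theorem exists_add_inv (x : ℂ) : ∃ s : ℂ, s ≠ 0 ∧ s + s⁻¹ = x ∧ (s - s⁻¹) ^ 2 = x ^ 2 - 4 := by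
  obtain ⟨w, hw⟩ := IsAlgClosed.exists_pow_nat_eq (x ^ 2 - 4) two_pos
  have h1 : (x + w) / 2 * ((x - w) / 2) = 1 := by linear_combination -hw / 4
  have h0 : (x + w) / 2 ≠ 0 := left_ne_zero_of_mul_eq_one h1
  have hi : ((x + w) / 2)⁻¹ = (x - w) / 2 := inv_eq_of_mul_eq_one_right h1
  refine ⟨(x + w) / 2, h0, ?_, ?_⟩
  · rw [hi]; ring
  · rw [hi, ← hw]; ring

theorem exists_of_entries {a b c d : ℂ} (h : a * d - b * c = 1) :
    ∃ M : SL(2, ℂ), M 0 0 = a ∧ M 0 1 = b ∧ M 1 0 = c ∧ M 1 1 = d :=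
  ⟨⟨!![a, b; c, d], by rw [Matrix.det_fin_two_of, h]⟩, rfl, rfl, rfl, rfl⟩

/-- Since every triple of traces occurs, a polynomial identity in the trace coordinates may be
checked on pairs of matrices. The witnesses are companion-like, with `t + t⁻¹` the prescribed trace
of the product. -/
theorem exists_traceCoord_eq (p : Fin 3 → ℂ) : ∃ M N : SL(2, ℂ), traceCoord M N = p := by
  obtain ⟨t, ht, htz, -⟩ := exists_add_inv (p 0)
  obtain ⟨M, m1, m2, m3, m4⟩ := exists_of_entries (a := p 1) (b := -1) (c := 1) (d := 0) (by ring)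
  obtain ⟨N, n1, n2, n3, n4⟩ := exists_of_entries (a := 0) (b := t) (c := -t⁻¹) (d := p 2)
    (by field_simp; ring)
  refine ⟨M, N, ?_⟩
  ext k
  fin_cases k
  · simp [traceCoord, mul_entry_complex, m1, m2, m3, m4, n1, n2, n3, n4, ← htz, add_comm]
  · simp [traceCoord, m1, m4]
  · simp [traceCoord, n1, n4]

/-- The Fricke polynomial is monic quadratic in `z`, with roots `s t + (s t)⁻¹` and `s t⁻¹ + s⁻¹ t`
over `(x, y) = (s + s⁻¹, t + t⁻¹)`. The remainder of `f` is linear in `z` and vanishes at both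
roots. They are distinct unless `x` or `y` is `±2`, so its coefficients vanish on a product of
infinite sets. -/
theorem fricke_dvd {f : MvPolynomial (Fin 3) ℂ}
    (h : ∀ s t : ℂ, s ≠ 0 → t ≠ 0 → eval ![s * t + (s * t)⁻¹, s + s⁻¹, t + t⁻¹] f = 0) :
    fricke ∣ f := by
  set K := MvPolynomial.finSuccEquiv ℂ 2 fricke with hK
  have hKe : K = Polynomial.X ^ 2 + (- Polynomial.C (X 0 * X 1 : MvPolynomial (Fin 2) ℂ) * Polynomial.X
      + Polynomial.C (X 0 ^ 2 + X 1 ^ 2 - C 4)) := by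
    have x1 : MvPolynomial.finSuccEquiv ℂ 2 (X 1) = Polynomial.C (X 0) :=
      finSuccEquiv_X_succ (j := 0)
    have x2 : MvPolynomial.finSuccEquiv ℂ 2 (X 2) = Polynomial.C (X 1) :=
      finSuccEquiv_X_succ (j := 1)
    have x4 : MvPolynomial.finSuccEquiv ℂ 2 (C 4) = Polynomial.C (C 4) :=
      (MvPolynomial.finSuccEquiv ℂ 2).commutes 4
    rw [hK, fricke]
    simp only [map_sub, map_add, map_mul, map_pow, x1, x2, x4, finSuccEquiv_X_zero]
    ring
  have hlt : (- Polynomial.C (X 0 * X 1 : MvPolynomial (Fin 2) ℂ) * Polynomial.X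
      + Polynomial.C (X 0 ^ 2 + X 1 ^ 2 - C 4)).degree < 2 := by
    rw [← Polynomial.C_neg]
    exact (Polynomial.degree_linear_le).trans_lt (by norm_num)
  have hmonic : K.Monic := by
    rw [hKe]
    exact Polynomial.monic_X_pow_add hlt
  have hdeg : K.natDegree = 2 := by
    rw [hKe, Polynomial.natDegree_add_eq_left_of_degree_lt, Polynomial.natDegree_X_pow]
    rwa [Polynomial.degree_X_pow]
  set F := MvPolynomial.finSuccEquiv ℂ 2 f with hF
  have hr : (F %ₘ K).natDegree ≤ 1 := by
    have := Polynomial.natDegree_modByMonic_lt F hmonic (by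
      intro h1; rw [h1, Polynomial.natDegree_one] at hdeg; norm_num at hdeg)
    omega
  obtain ⟨r₁, r₀, hrr⟩ := Polynomial.exists_eq_X_add_C_of_natDegree_le_one hr
  have heval : ∀ s t : ℂ, s ≠ 0 → t ≠ 0 →
      eval ![s + s⁻¹, t + t⁻¹] r₁ * (s * t + (s * t)⁻¹) + eval ![s + s⁻¹, t + t⁻¹] r₀ = 0 := by
    intro s t hs ht
    have h1 := h s t hs ht
    have hcons : (![s * t + (s * t)⁻¹, s + s⁻¹, t + t⁻¹] : Fin 3 → ℂ)
        = Fin.cons (s * t + (s * t)⁻¹) ![s + s⁻¹, t + t⁻¹] := rfl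
    have h2 : eval ![s * t + (s * t)⁻¹, s + s⁻¹, t + t⁻¹] fricke = 0 := by
      rw [eval_fricke]
      simp only [cons_val_zero, cons_val_one, cons_val]
      field_simp
      ring
    rw [hcons, eval_eq_eval_mv_eval', ← hF, ← Polynomial.modByMonic_add_div F K,
      Polynomial.map_add, Polynomial.map_mul, Polynomial.eval_add, Polynomial.eval_mul] at h1
    rw [hcons, eval_eq_eval_mv_eval', ← hK] at h2
    rw [h2, zero_mul, add_zero, hrr] at h1
    simpa using h1
  have hS : ∀ i : Fin 2, ((fun _ => {2, -2}ᶜ : Fin 2 → Set ℂ) i).Infinite := fun _ =>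
    (Set.toFinite _).infinite_compl
  have hsub : ∀ x : ℂ, x ∈ ({2, -2}ᶜ : Set ℂ) → ∃ s : ℂ, s ≠ 0 ∧ s + s⁻¹ = x ∧ s - s⁻¹ ≠ 0 := by
    intro x hx
    obtain ⟨s, hs, hsx, hs2⟩ := exists_add_inv x
    refine ⟨s, hs, hsx, fun h0 => hx ?_⟩
    rw [h0] at hs2
    have : (x - 2) * (x + 2) = 0 := by linear_combination -hs2
    rcases mul_eq_zero.mp this with h | h
    · left; linear_combination h
    · right; change x = -2; linear_combination h
  have hpair : ∀ x ∈ Set.univ.pi (fun _ => {2, -2}ᶜ : Fin 2 → Set ℂ),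
      eval x r₁ = 0 ∧ eval x r₀ = 0 := by
    intro x hx
    obtain ⟨s, hs, hsx, hs'⟩ := hsub (x 0) (hx 0 trivial)
    obtain ⟨t, ht, htx, ht'⟩ := hsub (x 1) (hx 1 trivial)
    have hxe : x = ![s + s⁻¹, t + t⁻¹] := by
      rw [hsx, htx]; ext k; fin_cases k <;> rfl
    have e1 := heval s t hs ht
    have e2 := heval s t⁻¹ hs (inv_ne_zero ht)
    rw [inv_inv, add_comm t⁻¹ t, ← hxe] at e2
    rw [← hxe] at e1
    have e3 : eval x r₁ * ((s - s⁻¹) * (t - t⁻¹)) = 0 := by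
      have : s * t + (s * t)⁻¹ - (s * t⁻¹ + (s * t⁻¹)⁻¹) = (s - s⁻¹) * (t - t⁻¹) := by
        rw [mul_inv, mul_inv, inv_inv]; ring
      rw [← this]
      linear_combination e1 - e2
    have e4 : eval x r₁ = 0 := (mul_eq_zero.mp e3).resolve_right (mul_ne_zero hs' ht')
    refine ⟨e4, ?_⟩
    rw [e4, zero_mul, zero_add] at e1
    exact e1
  have hr1 : r₁ = 0 := funext_set _ hS fun x hx => by rw [(hpair x hx).1, map_zero]
  have hr0 : r₀ = 0 := funext_set _ hS fun x hx => by rw [(hpair x hx).2, map_zero]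
  have hdvd : K ∣ F := by
    rw [← Polynomial.modByMonic_eq_zero_iff_dvd hmonic, hrr, hr1, hr0]
    simp
  exact (map_dvd_iff (MvPolynomial.finSuccEquiv ℂ 2)).mp hdvd

theorem eval_bind (p : Fin 3 → ℂ) (Φ : Fin 3 → MvPolynomial (Fin 3) ℂ)
    (f : MvPolynomial (Fin 3) ℂ) : eval p (bind₁ Φ f) = eval (fun k => eval p (Φ k)) f := by
  have := aeval_bind₁ (R := ℂ) p Φ f
  simpa [aeval_eq_eval] using this

/-- The diagonal matrix `diag(s, s⁻¹)`. -/
def diagMatrix (s : ℂˣ) : SL(2, ℂ) :=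
  ⟨!![(s : ℂ), 0; 0, ((s⁻¹ : ℂˣ) : ℂ)], by simp [Matrix.det_fin_two_of]⟩

theorem diagMatrix_entries (s : ℂˣ) : diagMatrix s 0 0 = s ∧ diagMatrix s 0 1 = 0 ∧
    diagMatrix s 1 0 = 0 ∧ diagMatrix s 1 1 = ((s⁻¹ : ℂˣ) : ℂ) :=
  ⟨rfl, rfl, rfl, rfl⟩

/-- The homomorphism `s ↦ diag(s, s⁻¹)`. -/
def diagHom : ℂˣ →* SL(2, ℂ) := MonoidHom.mk' diagMatrix <| by
  intro s t
  apply Subtype.ext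
  obtain ⟨s1, s2, s3, s4⟩ := diagMatrix_entries s
  obtain ⟨t1, t2, t3, t4⟩ := diagMatrix_entries t
  obtain ⟨r1, r2, r3, r4⟩ := diagMatrix_entries (s * t)
  ext i j
  revert i j
  simp only [Fin.forall_fin_two, mul_entry_complex, s1, s2, s3, s4, t1, t2, t3, t4, r1, r2, r3, r4]
  simp [mul_comm]

theorem diagHom_apply (s : ℂˣ) : diagHom s = diagMatrix s := rfl

/-- Words in commuting diagonal matrices commute, so the pulled-back Fricke polynomial vanishes at
the traces of all diagonal pairs. -/
theorem exists_fricke_factor {u v : FreeGroup (Fin 2)} {Φ : Fin 3 → MvPolynomial (Fin 3) ℂ}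
    (hΦ : ∀ M N : SL(2, ℂ),
      traceCoord (FreeGroup.lift ![M, N] u) (FreeGroup.lift ![M, N] v)
        = fun k => eval (traceCoord M N) (Φ k)) :
    ∃ q, bind₁ Φ fricke = fricke * q := by
  apply fricke_dvd
  intro s t hs ht
  set S := Units.mk0 s hs
  set T := Units.mk0 t ht
  have e : ![s * t + (s * t)⁻¹, s + s⁻¹, t + t⁻¹] = traceCoord (diagHom S) (diagHom T) := by
    ext k
    obtain ⟨s1, s2, s3, s4⟩ := diagMatrix_entries S
    obtain ⟨t1, t2, t3, t4⟩ := diagMatrix_entries T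
    fin_cases k <;> simp [traceCoord, diagHom_apply, s1, s2, s3, s4, t1, t2, t3, t4,
      mul_entry_complex] <;> simp [S, T, mul_comm]
  have hl : ∀ w, FreeGroup.lift ![diagHom S, diagHom T] w
      = diagHom (FreeGroup.lift ![S, T] w) := by
    intro w
    have : FreeGroup.lift ![diagHom S, diagHom T] = diagHom.comp (FreeGroup.lift ![S, T]) := by
      ext k
      fin_cases k <;> simp
    rw [this, MonoidHom.comp_apply]
  rw [e, eval_bind, ← hΦ, hl, hl, eval_fricke_traceCoord,
    ((Commute.all (FreeGroup.lift ![S, T] u) (FreeGroup.lift ![S, T] v)).map diagHom).eq]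
  ring

/-- The quaternion group, by the shape of its matrices. -/
def quaternionSubgroup : Subgroup SL(2, ℂ) where
  carrier := {A | (A 0 1 = 0 ∧ A 1 0 = 0 ∧ A 0 0 ^ 4 = 1) ∨ (A 0 0 = 0 ∧ A 1 1 = 0 ∧ A 0 1 ^ 4 = 1)}
  one_mem' := by simp
  mul_mem' := by
    rintro A B hA hB
    have dA := det_eq_complex A
    have dB := det_eq_complex B
    simp only [Set.mem_ofPred_eq, mul_entry_complex]
    rcases hA with ⟨h1, h2, h3⟩ | ⟨h1, h2, h3⟩ <;> rcases hB with ⟨k1, k2, k3⟩ | ⟨k1, k2, k3⟩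
    · left; simp [h1, h2, k1, k2, mul_pow, h3, k3]
    · right; simp [h1, h2, k1, k2, mul_pow, h3, k3]
    · right
      have : B 1 1 ^ 4 = 1 := by
        have e : (B 0 0 * B 1 1) ^ 4 = 1 := by rw [show B 0 0 * B 1 1 = 1 by simpa [k1] using dB, one_pow]
        rwa [mul_pow, k3, one_mul] at e
      simp [h1, h2, k1, k2, mul_pow, h3, this]
    · left
      have : B 1 0 ^ 4 = 1 := by
        have e : (B 0 1 * B 1 0) ^ 4 = 1 := by
          rw [show B 0 1 * B 1 0 = -1 by rw [k1] at dB; linear_combination -dB]; norm_num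
        rwa [mul_pow, k3, one_mul] at e
      simp [h1, h2, k1, k2, mul_pow, h3, this]
  inv_mem' := by
    rintro A hA
    obtain ⟨i1, i2, i3, i4⟩ := inv_entries_complex A
    have dA := det_eq_complex A
    simp only [Set.mem_ofPred_eq, i1, i2, i3, i4]
    rcases hA with ⟨h1, h2, h3⟩ | ⟨h1, h2, h3⟩
    · left
      have e : (A 0 0 * A 1 1) ^ 4 = 1 := by
        rw [show A 0 0 * A 1 1 = 1 by simpa [h1] using dA, one_pow]
      rw [mul_pow, h3, one_mul] at e
      simp [h1, h2, e]
    · right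
      simp [h1, h2, h3, Even.neg_pow (show Even 4 by decide)]

theorem sub_sq_of_pow_four {x y : ℂ} (h : x * y = 1) (hx : x ^ 4 = 1) :
    (x - y) ^ 2 = 0 ∨ (x - y) ^ 2 = -4 := by
  have h1 : (x ^ 2 - 1) * (x ^ 2 + 1) = 0 := by linear_combination hx
  have hy : (x * y) ^ 2 = 1 := by rw [h, one_pow]
  rcases mul_eq_zero.mp h1 with h2 | h2
  · left; linear_combination h2 - 2 * h + hy - y ^ 2 * h2
  · right; linear_combination h2 - 2 * h - hy + y ^ 2 * h2

theorem fricke_quaternion {A B : SL(2, ℂ)} (hA : A ∈ quaternionSubgroup)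
    (hB : B ∈ quaternionSubgroup) :
    eval (traceCoord A B) fricke = 0 ∨ eval (traceCoord A B) fricke = -4 := by
  rw [eval_fricke_traceCoord]
  have dA := det_eq_complex A
  have dB := det_eq_complex B
  have hAB := quaternionSubgroup.mul_mem hA hB
  simp only [mul_entry_complex]
  rcases hA with ⟨h1, h2, h3⟩ | ⟨h1, h2, h3⟩ <;> rcases hB with ⟨k1, k2, k3⟩ | ⟨k1, k2, k3⟩ <;>
    simp only [h1, h2, k1, k2, mul_zero, zero_mul, add_zero, zero_add, sub_zero, zero_sub] at dA dB ⊢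
  · left; ring
  · convert sub_sq_of_pow_four dA h3 using 2 <;>
    linear_combination (A 0 0 - A 1 1) ^ 2 * dB
  · convert sub_sq_of_pow_four dB k3 using 2 <;>
    linear_combination (B 0 0 - B 1 1) ^ 2 * dA
  · have e : A 0 1 * B 1 0 * (A 1 0 * B 0 1) = 1 := by linear_combination dB * (-(A 0 1) * A 1 0) + dA
    have e4 : (A 0 1 * B 1 0) ^ 4 = 1 := by
      have e : (B 0 1 * B 1 0) ^ 4 = 1 := by
        rw [show B 0 1 * B 1 0 = -1 by linear_combination -dB]; norm_num
      rw [mul_pow, k3, one_mul] at e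
      rw [mul_pow, h3, e, one_mul]
    convert sub_sq_of_pow_four e e4 using 2 <;> ring

theorem lift_mem_quaternionSubgroup {A B : SL(2, ℂ)} (hA : A ∈ quaternionSubgroup)
    (hB : B ∈ quaternionSubgroup) (w : FreeGroup (Fin 2)) :
    FreeGroup.lift ![A, B] w ∈ quaternionSubgroup := by
  have : (FreeGroup.lift ![A, B]).range ≤ quaternionSubgroup := by
    rw [FreeGroup.range_lift_eq_closure, Subgroup.closure_le]
    rintro _ ⟨k, rfl⟩
    fin_cases k
    · exact hA
    · exact hB
  exact this ⟨w, rfl⟩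

theorem exists_quaternion_pair : ∃ A ∈ quaternionSubgroup, ∃ B ∈ quaternionSubgroup,
    eval (traceCoord A B) fricke = -4 := by
  obtain ⟨M, m1, m2, m3, m4⟩ := exists_of_entries (a := Complex.I) (b := 0) (c := 0)
    (d := -Complex.I) (by linear_combination -Complex.I_sq)
  obtain ⟨N, n1, n2, n3, n4⟩ := exists_of_entries (a := 0) (b := 1) (c := -1) (d := 0) (by ring)
  refine ⟨M, Or.inl ⟨m2, m3, by rw [m1, Complex.I_pow_four]⟩, N, Or.inr ⟨n1, n4, by simp [n2]⟩, ?_⟩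
  rw [eval_fricke_traceCoord]
  simp only [mul_entry_complex, m1, m2, m3, m4, n1, n2, n3, n4]
  linear_combination 4 * Complex.I_sq

/-- A substitution of words multiplies the Fricke polynomial by some polynomial. For an invertible
substitution, the factors for it and for its inverse multiply to `1`, so the factor is a constant,
and one test pair determines it. -/
theorem eval_fricke_lift {u v r s : FreeGroup (Fin 2)}
    (hr : FreeGroup.lift ![u, v] r = FreeGroup.of 0)
    (hs : FreeGroup.lift ![u, v] s = FreeGroup.of 1) (M N : SL(2, ℂ)) :
    eval (traceCoord (FreeGroup.lift ![M, N] u) (FreeGroup.lift ![M, N] v)) fricke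
      = eval (traceCoord M N) fricke := by
  obtain ⟨Φ, hΦ⟩ := exists_trace_map u v
  obtain ⟨Ψ, hΨ⟩ := exists_trace_map r s
  obtain ⟨q, hq⟩ := exists_fricke_factor hΦ
  obtain ⟨q', hq'⟩ := exists_fricke_factor hΨ
  have hcomp : ∀ M N : SL(2, ℂ), ∀ w, FreeGroup.lift ![FreeGroup.lift ![M, N] u,
      FreeGroup.lift ![M, N] v] w = FreeGroup.lift ![M, N] (FreeGroup.lift ![u, v] w) := by
    intro M N w
    have : FreeGroup.lift ![FreeGroup.lift ![M, N] u, FreeGroup.lift ![M, N] v]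
        = (FreeGroup.lift ![M, N]).comp (FreeGroup.lift ![u, v]) := by
      ext k; fin_cases k <;> simp
    rw [this, MonoidHom.comp_apply]
  have key : ∀ M N : SL(2, ℂ), eval (traceCoord M N) fricke
      = eval (traceCoord (FreeGroup.lift ![M, N] u) (FreeGroup.lift ![M, N] v)) q'
        * eval (traceCoord M N) q * eval (traceCoord M N) fricke := by
    intro M N
    have h1 := congrArg (eval (traceCoord M N)) hq
    rw [eval_bind, ← hΦ, map_mul] at h1
    have h2 := congrArg (eval (traceCoord (FreeGroup.lift ![M, N] u)
      (FreeGroup.lift ![M, N] v))) hq'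
    rw [eval_bind, ← hΨ, map_mul, hcomp, hcomp, hr, hs] at h2
    simp only [FreeGroup.lift_apply_of, cons_val_zero, cons_val_one] at h2
    rw [h1] at h2
    linear_combination h2
  have hf0 : fricke ≠ 0 := by
    intro h0
    have := eval_fricke 0
    rw [h0] at this
    norm_num at this
  have hpoly : fricke = bind₁ Φ q' * q * fricke := by
    apply MvPolynomial.funext
    intro p
    obtain ⟨M, N, rfl⟩ := exists_traceCoord_eq p
    rw [map_mul, map_mul, eval_bind, ← hΦ]
    exact key M N
  have hunit : bind₁ Φ q' * q = 1 := by
    have : (bind₁ Φ q' * q - 1) * fricke = 0 := by linear_combination -hpoly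
    exact sub_eq_zero.mp ((mul_eq_zero.mp this).resolve_right hf0)
  obtain ⟨c, -, hc⟩ := isUnit_iff_eq_C_of_isReduced.mp (IsUnit.of_mul_eq_one_right _ hunit)
  have hval : ∀ M N : SL(2, ℂ),
      eval (traceCoord (FreeGroup.lift ![M, N] u) (FreeGroup.lift ![M, N] v)) fricke
        = eval (traceCoord M N) fricke * c := by
    intro M N
    have h1 := congrArg (eval (traceCoord M N)) hq
    rwa [eval_bind, ← hΦ, map_mul, hc, eval_C] at h1
  -- On pairs in the quaternion group the Fricke polynomial takes only the values `0` and `-4`.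
  -- Since it is `-4` on the chosen pair and `c ≠ 0`, the value after substitution is again `-4`.
  have hc1 : c = 1 := by
    obtain ⟨A, hA, B, hB, hAB⟩ := exists_quaternion_pair
    have hc0 : c ≠ 0 := by
      rintro rfl
      rw [hc] at hunit
      simp at hunit
    have h1 := hval A B
    rw [hAB] at h1
    rcases fricke_quaternion (lift_mem_quaternionSubgroup hA hB u)
      (lift_mem_quaternionSubgroup hA hB v) with h2 | h2 <;> rw [h2] at h1
    · exact absurd (by linear_combination h1 / 4) hc0
    · linear_combination h1 / 4
  rw [hval, hc1, mul_one]

/-- Up to sign, the trace of the commutator does not depend on the choice of a basis. -/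
theorem commDet_lift {u v r s : FreeGroup (Fin 2)}
    (hr : FreeGroup.lift ![u, v] r = FreeGroup.of 0)
    (hs : FreeGroup.lift ![u, v] s = FreeGroup.of 1) (a b : SL(2, ℝ)) :
    commDet (FreeGroup.lift ![a, b] u) (FreeGroup.lift ![a, b] v) = commDet a b := by
  set f := Matrix.SpecialLinearGroup.map (n := Fin 2) (algebraMap ℝ ℂ) with hf
  have hcd : ∀ x y : SL(2, ℝ), eval (traceCoord (f x) (f y)) fricke = ((-commDet x y : ℝ) : ℂ) := by
    intro x y
    have he : ∀ (z : SL(2, ℝ)) i j, (f z) i j = ((z i j : ℝ) : ℂ) := fun z i j => rfl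
    rw [eval_fricke_traceCoord, ← map_mul, ← map_mul]
    simp only [he, commDet_eq]
    push_cast
    ring
  have hl : ∀ w, FreeGroup.lift ![f a, f b] w = f (FreeGroup.lift ![a, b] w) := by
    intro w
    have : FreeGroup.lift ![f a, f b] = f.comp (FreeGroup.lift ![a, b]) := by
      ext k : 1
      fin_cases k <;> simp
    rw [this, MonoidHom.comp_apply]
  have h := eval_fricke_lift hr hs (f a) (f b)
  rw [hl, hl, hcd, hcd] at h
  have := Complex.ofReal_injective h
  linarith

end TracePolynomials

-- Crossing generators make every generating pair classical

section Crossing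

variable {G : Subgroup PSL2R}

/-- At a common point of the axes both matrices become symmetric, so `commDet ≥ 0`. Hyperbolicity of
the commutator, nontrivial because the group is not abelian, leaves only `commDet > 4`. -/
theorem four_lt_commDet {a b : SL(2, ℝ)}
    (hH : ∀ w : SL(2, ℝ), (QuotientGroup.mk w : PSL2R) ∈ G → (QuotientGroup.mk w : PSL2R) ≠ 1 →
      4 < tr w ^ 2)
    (hnc : ∃ x ∈ G, ∃ y ∈ G, x * y ≠ y * x)
    (hab : Subgroup.closure {(QuotientGroup.mk a : PSL2R), (QuotientGroup.mk b : PSL2R)} = G)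
    (hax : (axis (QuotientGroup.mk a) ∩ axis (QuotientGroup.mk b)).Nonempty) :
    4 < commDet a b := by
  have hcomm : (QuotientGroup.mk a : PSL2R) * QuotientGroup.mk b
      ≠ QuotientGroup.mk b * QuotientGroup.mk a := by
    intro h
    obtain ⟨x, hx, y, hy, hxy⟩ := hnc
    have hle : G ≤ Subgroup.centralizer
        {(QuotientGroup.mk a : PSL2R), (QuotientGroup.mk b : PSL2R)} := by
      rw [← hab, Subgroup.closure_le]
      rintro w (rfl | rfl) c (rfl | rfl)
      · rfl
      · exact h.symm
      · exact h
      · rfl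
    have hle' : G ≤ Subgroup.centralizer (G : Set PSL2R) := by
      conv_lhs => rw [← hab]
      rw [Subgroup.closure_le]
      intro w hw c hc
      exact (hle hc w hw).symm
    exact hxy (hle' hy x hx)
  have haG : (QuotientGroup.mk a : PSL2R) ∈ G := hab ▸ Subgroup.subset_closure (by simp)
  have hbG : (QuotientGroup.mk b : PSL2R) ∈ G := hab ▸ Subgroup.subset_closure (by simp)
  have h1 := commDet_ne_zero hH haG hbG hcomm
  obtain ⟨z, hza, hzb⟩ := hax
  have sa := toI_conj_symm z.im_pos a (eq_of_mem_axis hza)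
  have sb := toI_conj_symm z.im_pos b (eq_of_mem_axis hzb)
  have h2 := (commDet_ne_zero_of_symm sa sb).1
  rw [commDet_conj] at h2
  nlinarith

/-- A two generator group with `tr [a, b] < -2` is classical on all pairs of generators. -/
theorem isClassicalOn_of_commDet {a b : SL(2, ℝ)} (h : 4 < commDet a b)
    (hab : Subgroup.closure {(QuotientGroup.mk a : PSL2R), (QuotientGroup.mk b : PSL2R)} = G)
    {A : Fin 2 → PSL2R} (hA : Generates A G) : IsClassicalOn G A := by
  refine ⟨hA, ?_⟩
  set B : Fin 2 → PSL2R := ![QuotientGroup.mk a, QuotientGroup.mk b] with hB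
  obtain ⟨C, K, D, -, hpp⟩ := (pairsCurves_of_commDet h).exists_pingPong
    (fun C hC => hC.isClosed)
  have hinj : Function.Injective (FreeGroup.lift B) := hpp.injective_lift
  have hBG : (FreeGroup.lift B).range = G := by
    rw [FreeGroup.range_lift_eq_closure, ← hab, hB]
    simp [Set.pair_comm]
  have hAG : (FreeGroup.lift A).range = G := by
    rw [FreeGroup.range_lift_eq_closure]; exact hA
  have hw : ∀ i, ∃ w, FreeGroup.lift B w = A i := fun i => by
    have : A i ∈ (FreeGroup.lift B).range := by
      rw [hBG, ← hAG]; exact ⟨FreeGroup.of i, by simp⟩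
    exact this
  have hv : ∀ i, ∃ w, FreeGroup.lift A w = B i := fun i => by
    have : B i ∈ (FreeGroup.lift A).range := by
      rw [hAG, ← hBG]; exact ⟨FreeGroup.of i, by simp⟩
    exact this
  obtain ⟨u, hu⟩ := hw 0
  obtain ⟨v, hv'⟩ := hw 1
  have hcomp : ∀ w, FreeGroup.lift A w = FreeGroup.lift B (FreeGroup.lift ![u, v] w) := by
    intro w
    have : FreeGroup.lift A = (FreeGroup.lift B).comp (FreeGroup.lift ![u, v]) := by
      ext k; fin_cases k <;> simp [hu, hv']
    rw [this, MonoidHom.comp_apply]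
  obtain ⟨r, hr⟩ := hv 0
  obtain ⟨s, hs⟩ := hv 1
  -- Freeness on `a`, `b`, which comes from ping-pong with the circles of that pair, turns the
  -- relations in `G` into relations between words: `r`, `s` invert the substitution `u`, `v`.
  have hr' : FreeGroup.lift ![u, v] r = FreeGroup.of 0 :=
    hinj (by rw [← hcomp, hr]; simp)
  have hs' : FreeGroup.lift ![u, v] s = FreeGroup.of 1 :=
    hinj (by rw [← hcomp, hs]; simp)
  have hmk : ∀ w, (QuotientGroup.mk (FreeGroup.lift ![a, b] w) : PSL2R) = FreeGroup.lift B w := by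
    intro w
    have : (QuotientGroup.mk' (Subgroup.center SL(2, ℝ))).comp (FreeGroup.lift ![a, b])
        = FreeGroup.lift B := by
      ext k; fin_cases k <;> simp [hB]
    rw [← this]; rfl
  have hlt : 4 < commDet (FreeGroup.lift ![a, b] u) (FreeGroup.lift ![a, b] v) := by
    rwa [commDet_lift hr' hs']
  have := pairsCurves_of_commDet hlt
  rw [hmk, hmk, hu, hv'] at this
  convert this using 1
  ext k; fin_cases k <;> rfl

end Crossing

-- Straightening one quarter of the cell

section TorusModel

/-- Two functions turning the part of the box `[0, α] × [0, β]` outside the unit disc into the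
triangle `u + v ≤ 1/4` of the square `[0, 1/2] × [0, 1/2]`. -/
structure IsCornerProfile (α β : ℝ) (f₁ f₂ : ℝ → ℝ) : Prop where
  continuous₁ : Continuous f₁
  continuous₂ : Continuous f₂
  anti₁ : StrictAntiOn f₁ (Icc 0 α)
  anti₂ : StrictAntiOn f₂ (Icc 0 β)
  zero₁ : f₁ 0 = 1 / 2
  zero₂ : f₂ 0 = 1 / 2
  end₁ : f₁ α = 0
  end₂ : f₂ β = 0
  lt_iff : ∀ x ∈ Icc 0 α, ∀ y ∈ Icc 0 β, 1 / 4 < f₁ x + f₂ y ↔ x ^ 2 + y ^ 2 < 1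

/-- In `u = α² - x²` and `v = β² - y²` the open disc is `u + v > δ` with `δ = α² + β² - 1`. The
piecewise linear `p` sends `[0, δ]` linearly onto `[0, 1/4]`, which makes this the condition `p u +
p v > 1/4`. Beyond `δ` its slope is chosen to reach `1/2` at the far end: `α² - δ = 1 - β²` and `β²
- δ = 1 - α²`. -/
theorem exists_cornerProfile {α β : ℝ} (hα : 0 < α) (hα1 : α < 1) (hβ : 0 < β) (hβ1 : β < 1)
    (h : 1 < α ^ 2 + β ^ 2) : ∃ f₁ f₂, IsCornerProfile α β f₁ f₂ := by
  set δ := α ^ 2 + β ^ 2 - 1 with hδ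
  have hδ0 : 0 < δ := by linarith
  have hα2 : 0 < 1 - α ^ 2 := by nlinarith
  have hβ2 : 0 < 1 - β ^ 2 := by nlinarith
  let p : ℝ → ℝ → ℝ := fun η u => min u δ / (4 * δ) + max (u - δ) 0 / (4 * η)
  have pc : ∀ η, Continuous (p η) := fun η => by fun_prop
  have plow : ∀ η u, u ≤ δ → p η u = u / (4 * δ) := fun η u hu => by
    simp only [p]; rw [min_eq_left hu, max_eq_right (by linarith)]; ring
  have phigh : ∀ η u, δ ≤ u → p η u = 1 / 4 + (u - δ) / (4 * η) := fun η u hu => by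
    simp only [p]; rw [min_eq_right hu, max_eq_left (by linarith)]; field_simp
  have pmono : ∀ η, 0 < η → StrictMono (p η) := by
    intro η hη u v huv
    rcases le_total v δ with hv | hv
    · rw [plow η u (by linarith), plow η v hv]; gcongr
    rcases le_total u δ with hu | hu
    · rw [plow η u hu, phigh η v hv]
      have h1 : u / (4 * δ) ≤ 1 / 4 := by rw [div_le_div_iff₀ (by positivity) (by norm_num)]; linarith
      have h2 : 0 ≤ (v - δ) / (4 * η) := div_nonneg (by linarith) (by positivity)
      rcases eq_or_lt_of_le hv with e | e
      · have : u / (4 * δ) < 1 / 4 := by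
          rw [div_lt_div_iff₀ (by positivity) (by norm_num)]; linarith
        linarith
      · have : 0 < (v - δ) / (4 * η) := div_pos (by linarith) (by positivity)
        linarith
    · rw [phigh η u hu, phigh η v hv]; gcongr
  have key : ∀ η η' u v, 0 < η → 0 < η' → 0 ≤ u → 0 ≤ v →
      (1 / 4 < p η u + p η' v ↔ δ < u + v) := by
    intro η η' u v hη hη' hu hv
    have p0 : ∀ η, p η 0 = 0 := fun η => by rw [plow η 0 hδ0.le]; simp
    have pd : ∀ η, p η δ = 1 / 4 := fun η => by rw [phigh η δ le_rfl]; simp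
    have nu : 0 ≤ p η u := by rw [← p0 η]; exact (pmono η hη).monotone hu
    have nv : 0 ≤ p η' v := by rw [← p0 η']; exact (pmono η' hη').monotone hv
    by_cases h1 : δ < u
    · have := pmono η hη h1
      rw [pd] at this
      exact iff_of_true (by linarith) (by linarith)
    by_cases h2 : δ < v
    · have := pmono η' hη' h2
      rw [pd] at this
      exact iff_of_true (by linarith) (by linarith)
    rw [plow η u (not_lt.mp h1), plow η' v (not_lt.mp h2), ← add_div,
      div_lt_div_iff₀ (by norm_num) (by positivity)]
    constructor <;> intro h <;> linarith
  refine ⟨fun x => p (1 - β ^ 2) (α ^ 2 - x ^ 2), fun y => p (1 - α ^ 2) (β ^ 2 - y ^ 2),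
    (pc _).comp (by fun_prop), (pc _).comp (by fun_prop), ?_, ?_, ?_, ?_, ?_, ?_, ?_⟩
  · intro x hx y hy hxy
    apply pmono _ hβ2
    have := hx.1
    nlinarith
  · intro x hx y hy hxy
    apply pmono _ hα2
    have := hx.1
    nlinarith
  · rw [phigh _ _ (by nlinarith), hδ]
    field_simp; ring
  · rw [phigh _ _ (by nlinarith), hδ]
    field_simp; ring
  · rw [sub_self, plow _ _ hδ0.le]; simp
  · rw [sub_self, plow _ _ hδ0.le]; simp
  · intro x hx y hy
    have hx2 : x ^ 2 ≤ α ^ 2 := pow_le_pow_left₀ hx.1 hx.2 2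
    have hy2 : y ^ 2 ≤ β ^ 2 := pow_le_pow_left₀ hy.1 hy.2 2
    rw [key _ _ _ _ hβ2 hα2 (by linarith) (by linarith), hδ]
    constructor <;> intro h <;> linarith

/-- Both coordinates are shifted by this amount in order to turn the triangle `u + v ≤ 1/4` into
the square `max u v ≤ 1/4`. -/
def cornerShift (u v : ℝ) : ℝ := min (min u v) (min ((1 / 2 - u) / 2) ((1 / 2 - v) / 2))

theorem cornerShift_comm (u v : ℝ) : cornerShift u v = cornerShift v u := by
  rw [cornerShift, cornerShift, min_comm u v, min_comm ((1 / 2 - u) / 2)]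

theorem cornerShift_cases (u v : ℝ) : (cornerShift u v ≤ u ∧ cornerShift u v ≤ v ∧
    cornerShift u v ≤ (1 / 2 - u) / 2 ∧ cornerShift u v ≤ (1 / 2 - v) / 2) ∧
    (cornerShift u v = u ∨ cornerShift u v = v ∨ cornerShift u v = (1 / 2 - u) / 2 ∨
      cornerShift u v = (1 / 2 - v) / 2) := by
  unfold cornerShift
  refine ⟨⟨by simp, by simp, by simp, by simp⟩, ?_⟩
  rcases min_choice (min u v) (min ((1 / 2 - u) / 2) ((1 / 2 - v) / 2)) with h | h <;> rw [h]
  · rcases min_choice u v with h | h <;> rw [h] <;> simp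
  · rcases min_choice ((1 / 2 - u) / 2) ((1 / 2 - v) / 2) with h | h <;> rw [h] <;> simp

theorem cornerShift_nonneg {u v : ℝ} (hu : u ∈ Icc (0 : ℝ) (1 / 2)) (hv : v ∈ Icc (0 : ℝ) (1 / 2)) :
    0 ≤ cornerShift u v := by
  obtain ⟨h1, h2⟩ := hu
  obtain ⟨h3, h4⟩ := hv
  unfold cornerShift
  refine le_min (le_min h1 h3) (le_min ?_ ?_) <;> linarith

/-- The shift preserves `u - v`, and along each diagonal the shifted coordinates are strictly
increasing, with slope `2` and then `1/2`. -/
theorem cornerShift_injective {u v u' v' : ℝ} (h₁ : u + cornerShift u v = u' + cornerShift u' v')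
    (h₂ : v + cornerShift u v = v' + cornerShift u' v') : u = u' ∧ v = v' := by
  obtain ⟨⟨a1, a2, a3, a4⟩, a⟩ := cornerShift_cases u v
  obtain ⟨⟨b1, b2, b3, b4⟩, b⟩ := cornerShift_cases u' v'
  have : cornerShift u v = cornerShift u' v' := by
    rcases a with a | a | a | a <;> rcases b with b | b | b | b <;> linarith
  exact ⟨by linarith, by linarith⟩

theorem exists_cornerShift {u' v' : ℝ} (hu : u' ∈ Icc (0 : ℝ) (1 / 2))
    (hv : v' ∈ Icc (0 : ℝ) (1 / 2)) :
    ∃ u ∈ Icc (0 : ℝ) (1 / 2), ∃ v ∈ Icc (0 : ℝ) (1 / 2),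
      u + cornerShift u v = u' ∧ v + cornerShift u v = v' := by
  wlog h : v' ≤ u' generalizing u' v'
  · obtain ⟨v, hv, u, hu, e1, e2⟩ := this hv hu (le_of_not_ge h)
    rw [cornerShift_comm] at e1 e2
    exact ⟨u, hu, v, hv, e2, e1⟩
  obtain ⟨hu1, hu2⟩ := hu
  obtain ⟨hv1, hv2⟩ := hv
  -- For `v ≤ u` the shift is the smaller of `v` and `(1/2 - u) / 2`; the two cases invert these two
  -- linear pieces.
  rcases le_total v' (1 - 2 * u') with hc | hc
  · have : cornerShift (u' - v' / 2) (v' / 2) = v' / 2 := by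
      rw [cornerShift, min_eq_right (b := v' / 2) (by linarith), min_eq_left]
      exact le_min (by linarith) (by linarith)
    refine ⟨u' - v' / 2, ⟨by linarith, by linarith⟩, v' / 2, ⟨by linarith, by linarith⟩, ?_, ?_⟩ <;>
      rw [this] <;> ring
  · have : cornerShift (2 * u' - 1 / 2) (v' - 1 / 2 + u') = 1 / 2 - u' := by
      rw [cornerShift, min_eq_right (b := v' - 1 / 2 + u') (by linarith), min_eq_left (b := _ / 2)
        (by linarith), min_eq_right (by linarith)]
      ring
    refine ⟨2 * u' - 1 / 2, ⟨by linarith, by linarith⟩, v' - 1 / 2 + u', ⟨by linarith, by linarith⟩,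
      ?_, ?_⟩ <;> rw [this] <;> ring

theorem lt_max_cornerShift {u v : ℝ} (hu : u ∈ Icc (0 : ℝ) (1 / 2)) (hv : v ∈ Icc (0 : ℝ) (1 / 2)) :
    1 / 4 < max (u + cornerShift u v) (v + cornerShift u v) ↔ 1 / 4 < u + v := by
  obtain ⟨hu1, hu2⟩ := hu
  obtain ⟨hv1, hv2⟩ := hv
  obtain ⟨⟨a1, a2, a3, a4⟩, a⟩ := cornerShift_cases u v
  rw [lt_max_iff]
  constructor
  · rintro (h | h) <;> linarith
  · intro h
    by_contra! hc
    rcases a with a | a | a | a <;> linarith [hc.1, hc.2]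

/-- The shifted first coordinate, measured from the centre of the box. -/
def cornerCoord (f₁ f₂ : ℝ → ℝ) (x y : ℝ) : ℝ := 1 / 2 - (f₁ x + cornerShift (f₁ x) (f₂ y))

/-- The odd extension of `cornerCoord`. -/
def oddCoord (f₁ f₂ : ℝ → ℝ) (x y : ℝ) : ℝ :=
  cornerCoord f₁ f₂ (max x 0) |y| - cornerCoord f₁ f₂ (max (-x) 0) |y|

theorem oddCoord_neg_left (f₁ f₂ : ℝ → ℝ) (x y : ℝ) :
    oddCoord f₁ f₂ (-x) y = - oddCoord f₁ f₂ x y := by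
  simp only [oddCoord, neg_neg]; ring

theorem oddCoord_neg_right (f₁ f₂ : ℝ → ℝ) (x y : ℝ) :
    oddCoord f₁ f₂ x (-y) = oddCoord f₁ f₂ x y := by
  simp only [oddCoord, abs_neg]

namespace IsCornerProfile

variable {α β : ℝ} {f₁ f₂ : ℝ → ℝ}

theorem swap (h : IsCornerProfile α β f₁ f₂) : IsCornerProfile β α f₂ f₁ where
  continuous₁ := h.continuous₂
  continuous₂ := h.continuous₁
  anti₁ := h.anti₂
  anti₂ := h.anti₁
  zero₁ := h.zero₂
  zero₂ := h.zero₁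
  end₁ := h.end₂
  end₂ := h.end₁
  lt_iff x hx y hy := by rw [add_comm, h.lt_iff y hy x hx, add_comm]

theorem mem_Icc (h : IsCornerProfile α β f₁ f₂) {x : ℝ} (hx : x ∈ Icc 0 α) :
    f₁ x ∈ Icc (0 : ℝ) (1 / 2) := by
  have hα := hx.1.trans hx.2
  constructor
  · rw [← h.end₁]; exact h.anti₁.antitoneOn hx ⟨hα, le_rfl⟩ hx.2
  · rw [← h.zero₁]; exact h.anti₁.antitoneOn ⟨le_rfl, hα⟩ hx hx.1

theorem abs_mem_Icc {α y : ℝ} (hy : |y| ≤ α) : |y| ∈ Icc 0 α := ⟨abs_nonneg _, hy⟩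

theorem continuous_oddCoord (h : IsCornerProfile α β f₁ f₂) :
    Continuous fun e : ℝ × ℝ => oddCoord f₁ f₂ e.1 e.2 := by
  have h1 := h.continuous₁
  have h2 := h.continuous₂
  unfold oddCoord cornerCoord cornerShift
  fun_prop

theorem oddCoord_of_nonneg (h : IsCornerProfile α β f₁ f₂) {x y : ℝ} (hx : 0 ≤ x)
    (hy : |y| ≤ β) : oddCoord f₁ f₂ x y = 1 / 2 - (f₁ |x| + cornerShift (f₁ |x|) (f₂ |y|)) := by
  have hv := h.swap.mem_Icc (abs_mem_Icc hy)
  -- At `u = 1/2` the shift vanishes, so `cornerCoord` is zero on the axis `x = 0` and the odd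
  -- extension is continuous there.
  have hs : cornerShift (1 / 2) (f₂ |y|) = 0 := by
    have := cornerShift_nonneg (u := 1 / 2) ⟨by norm_num, le_rfl⟩ hv
    have := (cornerShift_cases (1 / 2) (f₂ |y|)).1.2.2.1
    linarith
  rw [oddCoord, cornerCoord, cornerCoord, max_eq_left hx, max_eq_right (by linarith), h.zero₁, hs,
    abs_of_nonneg hx]
  ring

theorem abs_oddCoord (h : IsCornerProfile α β f₁ f₂) {x y : ℝ} (hx : |x| ≤ α) (hy : |y| ≤ β) :
    |oddCoord f₁ f₂ x y| = 1 / 2 - (f₁ |x| + cornerShift (f₁ |x|) (f₂ |y|)) := by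
  have hu := h.mem_Icc (abs_mem_Icc hx)
  have h3 := (cornerShift_cases (f₁ |x|) (f₂ |y|)).1.2.2.1
  have h0 : 0 ≤ 1 / 2 - (f₁ |x| + cornerShift (f₁ |x|) (f₂ |y|)) := by linarith [hu.2]
  rcases le_total 0 x with hx0 | hx0
  · rw [h.oddCoord_of_nonneg hx0 hy, abs_of_nonneg h0]
  · have := h.oddCoord_of_nonneg (x := -x) (by linarith) hy
    rw [oddCoord_neg_left, abs_neg] at this
    rw [← abs_neg, this, abs_of_nonneg h0]

theorem oddCoord_pos (h : IsCornerProfile α β f₁ f₂) {x y : ℝ} (hx : |x| ≤ α) (hy : |y| ≤ β)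
    (hx0 : 0 < x) : 0 < oddCoord f₁ f₂ x y := by
  rw [h.oddCoord_of_nonneg hx0.le hy]
  have h3 := (cornerShift_cases (f₁ |x|) (f₂ |y|)).1.2.2.1
  have : f₁ |x| < 1 / 2 := by
    rw [← h.zero₁]
    exact h.anti₁ ⟨le_rfl, (abs_nonneg x).trans hx⟩ (abs_mem_Icc hx) (abs_pos.mpr hx0.ne')
  linarith

theorem eq_of_abs_eq_of_oddCoord_eq (h : IsCornerProfile α β f₁ f₂) {x y x' y' : ℝ}
    (hx : |x| ≤ α) (hy : |y| ≤ β) (hx' : |x'| ≤ α) (hy' : |y'| ≤ β) (habs : |x| = |x'|)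
    (e : oddCoord f₁ f₂ x y = oddCoord f₁ f₂ x' y') : x = x' := by
  wlog hpos : 0 < x generalizing x x'
  · by_cases h0 : x = 0
    · rw [h0, abs_zero] at habs
      rw [h0, abs_eq_zero.mp habs.symm]
    · have := this (x := -x) (x' := -x') (by rwa [abs_neg]) (by rwa [abs_neg])
        (by rwa [abs_neg, abs_neg]) (by rw [oddCoord_neg_left, oddCoord_neg_left, e])
        (by have := lt_of_le_of_ne (not_lt.mp hpos) h0; linarith)
      linarith
  rcases abs_eq_abs.mp habs with h1 | h1
  · exact h1
  · exfalso
    have h2 := h.oddCoord_pos hx hy hpos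
    have h3 := h.oddCoord_pos (x := -x') (by rwa [abs_neg]) hy' (by linarith)
    rw [oddCoord_neg_left] at h3
    linarith

theorem oddCoord_injective (h : IsCornerProfile α β f₁ f₂) {x y x' y' : ℝ}
    (hx : |x| ≤ α) (hy : |y| ≤ β) (hx' : |x'| ≤ α) (hy' : |y'| ≤ β)
    (e₁ : oddCoord f₁ f₂ x y = oddCoord f₁ f₂ x' y')
    (e₂ : oddCoord f₂ f₁ y x = oddCoord f₂ f₁ y' x') : x = x' ∧ y = y' := by
  have a1 := h.abs_oddCoord hx hy
  have a2 := h.abs_oddCoord hx' hy'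
  have b1 := h.swap.abs_oddCoord hy hx
  have b2 := h.swap.abs_oddCoord hy' hx'
  rw [e₁, a2] at a1
  rw [e₂, b2, cornerShift_comm, cornerShift_comm (f₂ |y|)] at b1
  obtain ⟨i1, i2⟩ := cornerShift_injective (u := f₁ |x|) (v := f₂ |y|) (u' := f₁ |x'|)
    (v' := f₂ |y'|) (by linarith) (by linarith)
  exact ⟨h.eq_of_abs_eq_of_oddCoord_eq hx hy hx' hy'
      (h.anti₁.injOn (abs_mem_Icc hx) (abs_mem_Icc hx') i1) e₁,
    h.swap.eq_of_abs_eq_of_oddCoord_eq hy hx hy' hx'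
      (h.anti₂.injOn (abs_mem_Icc hy) (abs_mem_Icc hy') i2) e₂⟩

theorem abs_oddCoord_le (h : IsCornerProfile α β f₁ f₂) {x y : ℝ} (hx : |x| ≤ α) (hy : |y| ≤ β) :
    |oddCoord f₁ f₂ x y| ≤ 1 / 2 := by
  rw [h.abs_oddCoord hx hy]
  have hu := h.mem_Icc (abs_mem_Icc hx)
  have := cornerShift_nonneg hu (h.swap.mem_Icc (abs_mem_Icc hy))
  linarith [hu.1]

theorem abs_oddCoord_eq_half_iff (h : IsCornerProfile α β f₁ f₂) {x y : ℝ} (hx : |x| ≤ α)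
    (hy : |y| ≤ β) : |oddCoord f₁ f₂ x y| = 1 / 2 ↔ |x| = α := by
  rw [h.abs_oddCoord hx hy]
  have hu := h.mem_Icc (abs_mem_Icc hx)
  have h0 := cornerShift_nonneg hu (h.swap.mem_Icc (abs_mem_Icc hy))
  have h1 := (cornerShift_cases (f₁ |x|) (f₂ |y|)).1.1
  constructor
  · intro e
    apply h.anti₁.injOn (abs_mem_Icc hx) ⟨(abs_nonneg x).trans hx, le_rfl⟩
    rw [h.end₁]
    linarith [hu.1]
  · intro e
    rw [e, h.end₁] at h0 h1 ⊢
    linarith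

theorem exists_oddCoord_eq (h : IsCornerProfile α β f₁ f₂) (hα : 0 ≤ α) (hβ : 0 ≤ β) {p q : ℝ}
    (hp : |p| ≤ 1 / 2) (hq : |q| ≤ 1 / 2) : ∃ x y, |x| ≤ α ∧ |y| ≤ β ∧
      oddCoord f₁ f₂ x y = p ∧ oddCoord f₂ f₁ y x = q := by
  wlog hp0 : 0 ≤ p generalizing p
  · obtain ⟨x, y, hx, hy, e1, e2⟩ := this (p := -p) (by rwa [abs_neg])
      (by linarith [not_le.mp hp0])
    refine ⟨-x, y, by rwa [abs_neg], hy, ?_, ?_⟩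
    · rw [oddCoord_neg_left, e1, neg_neg]
    · rw [oddCoord_neg_right, e2]
  wlog hq0 : 0 ≤ q generalizing q
  · obtain ⟨x, y, hx, hy, e1, e2⟩ := this (q := -q) (by rwa [abs_neg])
      (by linarith [not_le.mp hq0])
    refine ⟨x, -y, hx, by rwa [abs_neg], ?_, ?_⟩
    · rw [oddCoord_neg_right, e1]
    · rw [oddCoord_neg_left, e2, neg_neg]
  rw [abs_of_nonneg hp0] at hp
  rw [abs_of_nonneg hq0] at hq
  obtain ⟨u, hu, v, hv, e1, e2⟩ := exists_cornerShift (u' := 1 / 2 - p) (v' := 1 / 2 - q)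
    ⟨by linarith, by linarith⟩ ⟨by linarith, by linarith⟩
  obtain ⟨x, hx, rfl⟩ : u ∈ f₁ '' Icc 0 α :=
    intermediate_value_Icc' hα h.continuous₁.continuousOn (by rwa [h.zero₁, h.end₁])
  obtain ⟨y, hy, rfl⟩ : v ∈ f₂ '' Icc 0 β :=
    intermediate_value_Icc' hβ h.continuous₂.continuousOn (by rwa [h.zero₂, h.end₂])
  have hx' : |x| = x := abs_of_nonneg hx.1
  have hy' : |y| = y := abs_of_nonneg hy.1
  have hxα : |x| ≤ α := hx'.trans_le hx.2
  have hyβ : |y| ≤ β := hy'.trans_le hy.2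
  refine ⟨x, y, hxα, hyβ, ?_, ?_⟩
  · rw [h.oddCoord_of_nonneg hx.1 hyβ, hx', hy']; linarith
  · rw [h.swap.oddCoord_of_nonneg hy.1 hxα, hx', hy', cornerShift_comm]; linarith

end IsCornerProfile

end TorusModel

-- The cell with its sides glued is a torus without a disc

section TorusModel

/-- The intersection of a box and the closed unit disc. -/
def closedCell (α β : ℝ) : Set (ℝ × ℝ) := {e | |e.1| ≤ α ∧ |e.2| ≤ β ∧ e.1 ^ 2 + e.2 ^ 2 ≤ 1}

/-- `e` lies on the left or lower side of the box and `e'` is the corresponding point on the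
opposite side, where `φ` and `ψ` give the correspondence. -/
def Glued (α β : ℝ) (φ ψ : ℝ → ℝ) (e e' : ℝ × ℝ) : Prop :=
  (e.1 = -α ∧ e'.1 = α ∧ e'.2 = φ e.2) ∨ (e.2 = -β ∧ e'.2 = β ∧ e'.1 = ψ e.1)

/-- `P` identifies the torus without a closed disc with the cell, glued along `φ` and `ψ`. -/
structure IsTorusModel (α β : ℝ) (φ ψ : ℝ → ℝ) (P : ℝ × ℝ → UnitAddCircle × UnitAddCircle) :
    Prop where
  continuousOn : ContinuousOn P (closedCell α β)
  lt_norm_iff : ∀ e ∈ closedCell α β, 1 / 4 < ‖P e‖ ↔ e.1 ^ 2 + e.2 ^ 2 < 1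
  exists_eq : ∀ p, 1 / 4 < ‖p‖ → ∃ e ∈ closedCell α β, P e = p
  eq_iff : ∀ e ∈ closedCell α β, ∀ e' ∈ closedCell α β, e.1 ^ 2 + e.2 ^ 2 < 1 →
    e'.1 ^ 2 + e'.2 ^ 2 < 1 →
    (P e = P e' ↔ e = e' ∨ Glued α β φ ψ e e' ∨ Glued α β φ ψ e' e)

theorem norm_coe_add_half {w : ℝ} (hw : |w| ≤ 1 / 2) :
    ‖((w + 1 / 2 : ℝ) : UnitAddCircle)‖ = 1 / 2 - |w| := by
  have key : ∀ x : ℝ, |x| ≤ 1 / 2 → ‖(x : UnitAddCircle)‖ = |x| := fun x hx =>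
    (AddCircle.norm_coe_eq_abs_iff (1 : ℝ) one_ne_zero).mpr (by rwa [abs_one])
  obtain ⟨h1, h2⟩ := abs_le.mp hw
  rcases le_total w 0 with h | h
  · rw [key _ (abs_le.mpr ⟨by linarith, by linarith⟩), abs_of_nonpos h, abs_of_nonneg (by linarith)]
    ring
  · have : ((w + 1 / 2 : ℝ) : UnitAddCircle) = ((w - 1 / 2 : ℝ) : UnitAddCircle) := by
      rw [← AddCircle.coe_add_period (1 : ℝ) (w - 1 / 2)]
      congr 1; ring
    rw [this, key _ (abs_le.mpr ⟨by linarith, by linarith⟩), abs_of_nonneg h,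
      abs_of_nonpos (by linarith)]
    ring

theorem coe_add_half_eq_iff {w w' : ℝ} (hw : |w| ≤ 1 / 2) (hw' : |w'| ≤ 1 / 2) :
    ((w + 1 / 2 : ℝ) : UnitAddCircle) = ((w' + 1 / 2 : ℝ) : UnitAddCircle) ↔
      w = w' ∨ (w = - (1 / 2) ∧ w' = 1 / 2) ∨ (w' = - (1 / 2) ∧ w = 1 / 2) := by
  obtain ⟨h1, h2⟩ := abs_le.mp hw
  obtain ⟨h3, h4⟩ := abs_le.mp hw'
  rw [← sub_eq_zero, ← AddCircle.coe_sub, AddCircle.coe_eq_zero_iff]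
  constructor
  · rintro ⟨n, hn⟩
    rw [zsmul_eq_mul, mul_one] at hn
    have hn1 : n < 2 := by
      have : (n : ℝ) < 2 := by linarith
      exact_mod_cast this
    have hn2 : -2 < n := by
      have : (-2 : ℝ) < n := by linarith
      exact_mod_cast this
    have : n = -1 ∨ n = 0 ∨ n = 1 := by omega
    rcases this with rfl | rfl | rfl
    · right; left; push_cast at hn; constructor <;> linarith
    · left; push_cast at hn; linarith
    · right; right; push_cast at hn; constructor <;> linarith
  · rintro (h | ⟨h, h'⟩ | ⟨h, h'⟩)
    · exact ⟨0, by rw [h]; simp⟩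
    · exact ⟨-1, by rw [h, h']; norm_num⟩
    · exact ⟨1, by rw [h, h']; norm_num⟩

theorem exists_coe_add_half (p : UnitAddCircle) :
    ∃ w : ℝ, |w| ≤ 1 / 2 ∧ ((w + 1 / 2 : ℝ) : UnitAddCircle) = p := by
  obtain ⟨x, hx, rfl⟩ : ∃ x ∈ Ico (0 : ℝ) (0 + 1), (x : UnitAddCircle) = p :=
    ⟨_, (AddCircle.equivIco 1 0 p).2, AddCircle.coe_equivIco⟩
  refine ⟨x - 1 / 2, abs_le.mpr ⟨by linarith [hx.1], by linarith [hx.2]⟩, by rw [sub_add_cancel]⟩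

/-- The corners lie outside the disc, so a point of the disc on one pair of sides stays strictly
between the other two. -/
theorem abs_lt_of_glued {α β x y : ℝ} (hβ : 0 ≤ β) (h : 1 < α ^ 2 + β ^ 2)
    (hd : x ^ 2 + y ^ 2 < 1) (hx : |x| = α) : |y| < β := by
  rw [← abs_of_nonneg hβ, ← sq_lt_sq]
  have : x ^ 2 = α ^ 2 := by rw [← hx, sq_abs]
  linarith

theorem IsCornerProfile.eq_neg_of_abs_eq_half {α β : ℝ} {f₁ f₂ : ℝ → ℝ}
    (h : IsCornerProfile α β f₁ f₂) (hα : 0 < α) {x y : ℝ} (hx : |x| ≤ α) (hy : |y| ≤ β)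
    (he : oddCoord f₁ f₂ x y = - (1 / 2)) : x = -α := by
  have hxα := (h.abs_oddCoord_eq_half_iff hx hy).mp (by rw [he]; norm_num)
  rcases eq_or_eq_neg_of_abs_eq hxα with h1 | h1
  · have := h.oddCoord_pos hx hy (by rw [h1]; exact hα)
    rw [he] at this; norm_num at this
  · exact h1

theorem IsCornerProfile.oddCoord_neg_end {α β : ℝ} {f₁ f₂ : ℝ → ℝ}
    (h : IsCornerProfile α β f₁ f₂) (hα : 0 < α) {y : ℝ} (hy : |y| ≤ β) :
    oddCoord f₁ f₂ α y = 1 / 2 ∧ oddCoord f₁ f₂ (-α) y = - (1 / 2) := by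
  have h1 : |α| = α := abs_of_pos hα
  have h2 := (h.abs_oddCoord_eq_half_iff h1.le hy).mpr h1
  rw [abs_of_pos (h.oddCoord_pos h1.le hy hα)] at h2
  exact ⟨h2, by rw [oddCoord_neg_left, h2]⟩

/-- If the first coordinates are opposite sides, the second ones agree. -/
theorem IsCornerProfile.glued_of_opposite {α β : ℝ} {f₁ f₂ : ℝ → ℝ}
    (h : IsCornerProfile α β f₁ f₂) (hα : 0 < α) (hβ : 0 < β) (hαβ : 1 < α ^ 2 + β ^ 2)
    {x y x' y' : ℝ} (hx : |x| ≤ α) (hy : |y| ≤ β) (hx' : |x'| ≤ α) (hy' : |y'| ≤ β)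
    (hd : x ^ 2 + y ^ 2 < 1) (hd' : x' ^ 2 + y' ^ 2 < 1)
    (e₁ : oddCoord f₁ f₂ x y = - (1 / 2)) (e₁' : oddCoord f₁ f₂ x' y' = 1 / 2)
    (e₂ : ((oddCoord f₂ f₁ y x + 1 / 2 : ℝ) : UnitAddCircle)
      = ((oddCoord f₂ f₁ y' x' + 1 / 2 : ℝ) : UnitAddCircle)) :
    x = -α ∧ x' = α ∧ y' = y := by
  have hxα := h.eq_neg_of_abs_eq_half hα hx hy e₁
  have hxα' : -x' = -α := h.eq_neg_of_abs_eq_half hα (x := -x') (by rwa [abs_neg]) hy'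
    (by rw [oddCoord_neg_left, e₁'])
  have hyβ := abs_lt_of_glued hβ.le hαβ hd (by rw [hxα, abs_neg, abs_of_pos hα])
  have hyβ' := abs_lt_of_glued hβ.le hαβ hd' (by rw [neg_inj.mp hxα', abs_of_pos hα])
  have hne : ∀ y x : ℝ, |x| ≤ α → |y| < β → oddCoord f₂ f₁ y x ≠ - (1 / 2) := by
    intro y x hx hy he
    have := (h.swap.abs_oddCoord_eq_half_iff hy.le hx).mp (by rw [he]; norm_num)
    linarith
  have e3 : oddCoord f₂ f₁ y x = oddCoord f₂ f₁ y' x' := by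
    rcases (coe_add_half_eq_iff (h.swap.abs_oddCoord_le hy hx)
      (h.swap.abs_oddCoord_le hy' hx')).mp e₂ with e | ⟨e, -⟩ | ⟨e, -⟩
    · exact e
    · exact absurd e (hne _ _ hx hyβ)
    · exact absurd e (hne _ _ hx' hyβ')
  refine ⟨hxα, neg_inj.mp hxα', ?_⟩
  -- Reflecting `x'` makes the first coordinates equal and leaves the second one unchanged, so
  -- injectivity on the box applies.
  refine ((h.oddCoord_injective (x := -x') (y := y') (by rwa [abs_neg]) hy' hx hy ?_ ?_).2)
  · rw [oddCoord_neg_left, e₁, e₁']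
  · rw [oddCoord_neg_right, e3]

/-- Without twist, opposite sides are glued by translations. -/
theorem exists_isTorusModel_id {α β : ℝ} (hα : 0 < α) (hα1 : α < 1) (hβ : 0 < β) (hβ1 : β < 1)
    (hαβ : 1 < α ^ 2 + β ^ 2) : ∃ P, IsTorusModel α β id id P := by
  obtain ⟨f₁, f₂, h⟩ := exists_cornerProfile hα hα1 hβ hβ1 hαβ
  -- The shift by `1/2` sends all four corners of the box to `0`, so the parts cut off by the circle
  -- assemble to the ball of radius `1/4`.
  refine ⟨fun e => (((oddCoord f₁ f₂ e.1 e.2 + 1 / 2 : ℝ) : UnitAddCircle),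
    ((oddCoord f₂ f₁ e.2 e.1 + 1 / 2 : ℝ) : UnitAddCircle)), ?_, ?_, ?_, ?_⟩
  · apply Continuous.continuousOn
    have c1 := h.continuous_oddCoord
    have c2 := h.swap.continuous_oddCoord.comp continuous_swap
    exact ((AddCircle.continuous_mk' 1).comp (c1.add continuous_const)).prodMk
      ((AddCircle.continuous_mk' 1).comp (c2.add continuous_const))
  · rintro ⟨x, y⟩ ⟨hx, hy, -⟩
    simp only at hx hy ⊢
    have hx' := IsCornerProfile.abs_mem_Icc hx
    have hy' := IsCornerProfile.abs_mem_Icc hy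
    rw [Prod.norm_mk, norm_coe_add_half (h.abs_oddCoord_le hx hy),
      norm_coe_add_half (h.swap.abs_oddCoord_le hy hx), h.abs_oddCoord hx hy,
      h.swap.abs_oddCoord hy hx, sub_sub_cancel, sub_sub_cancel, cornerShift_comm (f₂ |y|),
      lt_max_cornerShift (h.mem_Icc hx') (h.swap.mem_Icc hy'), h.lt_iff _ hx' _ hy', sq_abs, sq_abs]
  · rintro ⟨p, q⟩ hpq
    obtain ⟨w, hw, rfl⟩ := exists_coe_add_half p
    obtain ⟨v, hv, rfl⟩ := exists_coe_add_half q
    obtain ⟨x, y, hx, hy, rfl, rfl⟩ := h.exists_oddCoord_eq hα.le hβ.le hw hv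
    refine ⟨(x, y), ⟨hx, hy, ?_⟩, rfl⟩
    have hx' := IsCornerProfile.abs_mem_Icc hx
    have hy' := IsCornerProfile.abs_mem_Icc hy
    rw [Prod.norm_mk, norm_coe_add_half (h.abs_oddCoord_le hx hy),
      norm_coe_add_half (h.swap.abs_oddCoord_le hy hx), h.abs_oddCoord hx hy,
      h.swap.abs_oddCoord hy hx, sub_sub_cancel, sub_sub_cancel, cornerShift_comm (f₂ |y|),
      lt_max_cornerShift (h.mem_Icc hx') (h.swap.mem_Icc hy'), h.lt_iff _ hx' _ hy', sq_abs,
      sq_abs] at hpq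
    exact hpq.le
  · rintro ⟨x, y⟩ ⟨hx, hy, -⟩ ⟨x', y'⟩ ⟨hx', hy', -⟩ hd hd'
    simp only at hx hy hx' hy' hd hd' ⊢
    rw [Prod.mk.injEq, Prod.mk.injEq]
    constructor
    · rintro ⟨e₁, e₂⟩
      rcases (coe_add_half_eq_iff (h.abs_oddCoord_le hx hy)
        (h.abs_oddCoord_le hx' hy')).mp e₁ with i1 | ⟨i1, i1'⟩ | ⟨i1, i1'⟩
      · rcases (coe_add_half_eq_iff (h.swap.abs_oddCoord_le hy hx)
          (h.swap.abs_oddCoord_le hy' hx')).mp e₂ with i2 | ⟨i2, i2'⟩ | ⟨i2, i2'⟩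
        · exact Or.inl (h.oddCoord_injective hx hy hx' hy' i1 i2)
        · exact Or.inr (Or.inl (Or.inr (h.swap.glued_of_opposite hβ hα (by linarith) hy hx hy' hx'
            ((add_comm _ _).trans_lt hd) ((add_comm _ _).trans_lt hd') i2 i2' e₁)))
        · exact Or.inr (Or.inr (Or.inr (h.swap.glued_of_opposite hβ hα (by linarith) hy' hx' hy hx
            ((add_comm _ _).trans_lt hd') ((add_comm _ _).trans_lt hd) i2 i2' e₁.symm)))
      · exact Or.inr (Or.inl (Or.inl (h.glued_of_opposite hα hβ hαβ hx hy hx' hy' hd hd' i1 i1'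
            e₂)))
      · exact Or.inr (Or.inr (Or.inl (h.glued_of_opposite hα hβ hαβ hx' hy' hx hy hd' hd i1 i1'
            e₂.symm)))
    · have key : ∀ {x y x' y' : ℝ}, |x| ≤ α → |y| ≤ β → |x'| ≤ α → |y'| ≤ β →
          Glued α β id id (x, y) (x', y') →
          ((oddCoord f₁ f₂ x y + 1 / 2 : ℝ) : UnitAddCircle)
            = ((oddCoord f₁ f₂ x' y' + 1 / 2 : ℝ) : UnitAddCircle) ∧
          ((oddCoord f₂ f₁ y x + 1 / 2 : ℝ) : UnitAddCircle)
            = ((oddCoord f₂ f₁ y' x' + 1 / 2 : ℝ) : UnitAddCircle) := by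
        rintro x y x' y' hx hy hx' hy' (⟨g1, g2, g3⟩ | ⟨g1, g2, g3⟩)
        · simp only [id] at g1 g2 g3
          subst g1 g2 g3
          refine ⟨?_, by rw [oddCoord_neg_right]⟩
          rw [coe_add_half_eq_iff (h.abs_oddCoord_le hx hy) (h.abs_oddCoord_le hx' hy')]
          exact Or.inr (Or.inl ⟨(h.oddCoord_neg_end hα hy).2, (h.oddCoord_neg_end hα hy).1⟩)
        · simp only [id] at g1 g2 g3
          subst g1 g2 g3
          refine ⟨by rw [oddCoord_neg_right], ?_⟩
          rw [coe_add_half_eq_iff (h.swap.abs_oddCoord_le hy hx) (h.swap.abs_oddCoord_le hy' hx')]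
          exact Or.inr (Or.inl ⟨(h.swap.oddCoord_neg_end hβ hx).2,
            (h.swap.oddCoord_neg_end hβ hx).1⟩)
      rintro (⟨rfl, rfl⟩ | g | g)
      · exact ⟨rfl, rfl⟩
      · exact key hx hy hx' hy' g
      · have := key hx' hy' hx hy g
        exact ⟨this.1.symm, this.2.symm⟩

theorem swap_mem_closedCell {α β : ℝ} {e : ℝ × ℝ} (h : e ∈ closedCell α β) :
    e.swap ∈ closedCell β α :=
  ⟨h.2.1, h.1, by rw [add_comm]; exact h.2.2⟩

theorem IsTorusModel.swap {α β : ℝ} {φ ψ : ℝ → ℝ} {P : ℝ × ℝ → UnitAddCircle × UnitAddCircle}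
    (h : IsTorusModel α β φ ψ P) : IsTorusModel β α ψ φ (P ∘ Prod.swap) where
  continuousOn := h.continuousOn.comp continuous_swap.continuousOn fun _ => swap_mem_closedCell
  lt_norm_iff e he := by
    rw [Function.comp_apply, h.lt_norm_iff _ (swap_mem_closedCell he), Prod.fst_swap, Prod.snd_swap,
      add_comm]
  exists_eq p hp := by
    obtain ⟨e, he, hp⟩ := h.exists_eq p hp
    exact ⟨e.swap, swap_mem_closedCell he, by rw [Function.comp_apply, Prod.swap_swap, hp]⟩
  eq_iff e he e' he' hd hd' := by
    rw [Function.comp_apply, Function.comp_apply, h.eq_iff _ (swap_mem_closedCell he) _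
      (swap_mem_closedCell he') (by rwa [add_comm]) (by rwa [add_comm]), Prod.swap_inj]
    simp only [Glued, Prod.fst_swap, Prod.snd_swap]
    tauto

-- Twisting the gluing

/-- Relativistic addition of velocities, with speed of light `g`. -/
def boost (g κ y : ℝ) : ℝ := g * (y + κ * g) / (g + κ * y)

theorem boost_denom_pos {g κ y : ℝ} (hg : 0 < g) (hκ : |κ| < 1) (hy : |y| ≤ g) :
    0 < g + κ * y := by
  have h1 : |κ * y| < g := by
    rw [abs_mul]
    calc |κ| * |y| ≤ |κ| * g := by gcongr
      _ < g := by nlinarith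
  linarith [(abs_lt.mp h1).1]

theorem boost_zero {g y : ℝ} (hg : 0 < g) : boost g 0 y = y := by
  have := hg.ne'
  rw [boost, zero_mul, zero_mul, add_zero, add_zero, mul_div_cancel_left₀ _ this]

theorem sq_sub_boost_sq {g κ y : ℝ} (hg : 0 < g) (hκ : |κ| < 1) (hy : |y| ≤ g) :
    g ^ 2 - boost g κ y ^ 2 = g ^ 2 * (1 - κ ^ 2) / (g + κ * y) ^ 2 * (g ^ 2 - y ^ 2) := by
  have := (boost_denom_pos hg hκ hy).ne'
  rw [boost, div_pow, div_mul_eq_mul_div, eq_div_iff (pow_ne_zero 2 this), sub_mul,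
    div_mul_cancel₀ _ (pow_ne_zero 2 this)]
  ring

theorem boost_factor_pos {g κ y : ℝ} (hg : 0 < g) (hκ : |κ| < 1) (hy : |y| ≤ g) :
    0 < g ^ 2 * (1 - κ ^ 2) / (g + κ * y) ^ 2 := by
  have := boost_denom_pos hg hκ hy
  have : 0 < 1 - κ ^ 2 := by
    have := (sq_lt_one_iff_abs_lt_one κ).mpr hκ
    linarith
  positivity

theorem abs_boost_le {g κ y : ℝ} (hg : 0 < g) (hκ : |κ| < 1) (hy : |y| ≤ g) :
    |boost g κ y| ≤ g := by
  have h1 := sq_sub_boost_sq hg hκ hy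
  have h2 := boost_factor_pos hg hκ hy
  have h3 : y ^ 2 ≤ g ^ 2 := by rw [← sq_abs]; exact pow_le_pow_left₀ (abs_nonneg _) hy 2
  apply abs_le_of_sq_le_sq _ hg.le
  nlinarith [mul_nonneg h2.le (sub_nonneg.mpr h3)]

theorem boost_neg_boost {g κ y : ℝ} (hg : 0 < g) (hκ : |κ| < 1) (hy : |y| ≤ g) :
    boost g (-κ) (boost g κ y) = y := by
  have h1 := boost_denom_pos hg hκ hy
  have h2 := boost_denom_pos hg (κ := -κ) (by rwa [abs_neg]) (abs_boost_le hg hκ hy)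
  have h3 : boost g κ y * (g + κ * y) = g * (y + κ * g) := div_mul_cancel₀ _ h1.ne'
  rw [boost, div_eq_iff h2.ne']
  linear_combination h3

/-- The twist with strength `κ`, preserving the first coordinate. -/
def twist (κ : ℝ → ℝ) (e : ℝ × ℝ) : ℝ × ℝ := (e.1, boost (√(1 - e.1 ^ 2)) (κ e.1) e.2)

/-- A twist of the cell supported near its right side. -/
structure IsCellTwist (α β : ℝ) (κ : ℝ → ℝ) : Prop where
  continuous : Continuous κ
  abs_lt : ∀ x, |x| ≤ α → |κ x| < 1
  eq_zero : ∀ x, 0 ≤ x → x ^ 2 ≤ 1 - β ^ 2 → κ x = 0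
  eq_zero_of_neg : ∀ x, x ≤ 0 → κ x = 0

theorem sqrt_pos_of_abs_le {α x : ℝ} (hα1 : α < 1) (hx : |x| ≤ α) : 0 < √(1 - x ^ 2) := by
  rw [Real.sqrt_pos]
  have := (sq_lt_one_iff_abs_lt_one x).mpr (hx.trans_lt hα1)
  linarith

theorem abs_le_sqrt {x y : ℝ} (h : x ^ 2 + y ^ 2 ≤ 1) : |y| ≤ √(1 - x ^ 2) :=
  Real.abs_le_sqrt (by linarith)

namespace IsCellTwist

variable {α β : ℝ} {κ : ℝ → ℝ}

theorem neg (h : IsCellTwist α β κ) : IsCellTwist α β (fun x => -κ x) where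
  continuous := h.continuous.neg
  abs_lt x hx := by rw [abs_neg]; exact h.abs_lt x hx
  eq_zero x hx hx' := by rw [h.eq_zero x hx hx', neg_zero]
  eq_zero_of_neg x hx := by rw [h.eq_zero_of_neg x hx, neg_zero]

theorem continuousOn_twist (h : IsCellTwist α β κ) (hα1 : α < 1) :
    ContinuousOn (twist κ) (closedCell α β) := by
  have h1 := h.continuous
  refine ContinuousOn.prodMk continuous_fst.continuousOn ?_
  unfold boost
  refine ContinuousOn.div (by fun_prop) (by fun_prop) ?_
  rintro ⟨x, y⟩ ⟨hx, hy, hd⟩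
  exact (boost_denom_pos (sqrt_pos_of_abs_le hα1 hx) (h.abs_lt x hx) (abs_le_sqrt hd)).ne'

theorem twist_eq_self (h : IsCellTwist α β κ) (hα1 : α < 1) {e : ℝ × ℝ}
    (he : e ∈ closedCell α β) (hx : e.1 ≤ 0 ∨ e.1 ^ 2 ≤ 1 - β ^ 2) : twist κ e = e := by
  have : κ e.1 = 0 := by
    rcases le_total e.1 0 with h0 | h0
    · exact h.eq_zero_of_neg _ h0
    · rcases hx with hx | hx
      · exact h.eq_zero_of_neg _ hx
      · exact h.eq_zero _ h0 hx
  rw [twist, this, boost_zero (sqrt_pos_of_abs_le hα1 he.1)]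

/-- On each vertical chord of the disc the twist is a boost preserving the end points, so it
multiplies `1 - x² - y²` by a positive factor. -/
theorem sq_add_twist_sq (h : IsCellTwist α β κ) (hα1 : α < 1) {e : ℝ × ℝ}
    (he : e ∈ closedCell α β) : ∃ c > 0,
      1 - (e.1 ^ 2 + (twist κ e).2 ^ 2) = c * (1 - (e.1 ^ 2 + e.2 ^ 2)) := by
  have hg := sqrt_pos_of_abs_le hα1 he.1
  have hs : √(1 - e.1 ^ 2) ^ 2 = 1 - e.1 ^ 2 := Real.sq_sqrt (Real.sqrt_pos.mp hg).le
  refine ⟨_, boost_factor_pos hg (h.abs_lt _ he.1) (abs_le_sqrt he.2.2), ?_⟩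
  have := sq_sub_boost_sq hg (h.abs_lt _ he.1) (abs_le_sqrt he.2.2)
  rw [hs] at this
  rw [twist, hs]
  linear_combination this

theorem twist_mem (h : IsCellTwist α β κ) (hα1 : α < 1) (hβ : 0 ≤ β) {e : ℝ × ℝ}
    (he : e ∈ closedCell α β) : twist κ e ∈ closedCell α β := by
  have hd : e.1 ^ 2 + (twist κ e).2 ^ 2 ≤ 1 := by
    obtain ⟨c, hc, e1⟩ := h.sq_add_twist_sq hα1 he
    have := he.2.2
    nlinarith
  refine ⟨he.1, ?_, hd⟩
  by_cases hx : e.1 ^ 2 ≤ 1 - β ^ 2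
  · rw [h.twist_eq_self hα1 he (Or.inr hx)]; exact he.2.1
  · apply abs_le_of_sq_le_sq _ hβ
    linarith

theorem twist_lt_iff (h : IsCellTwist α β κ) (hα1 : α < 1) {e : ℝ × ℝ}
    (he : e ∈ closedCell α β) :
    (twist κ e).1 ^ 2 + (twist κ e).2 ^ 2 < 1 ↔ e.1 ^ 2 + e.2 ^ 2 < 1 := by
  obtain ⟨c, hc, e1⟩ := h.sq_add_twist_sq hα1 he
  change e.1 ^ 2 + (twist κ e).2 ^ 2 < 1 ↔ _
  rw [← sub_pos, e1, mul_pos_iff_of_pos_left hc, sub_pos]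

theorem twist_neg_twist (h : IsCellTwist α β κ) (hα1 : α < 1) {e : ℝ × ℝ}
    (he : e ∈ closedCell α β) : twist (fun x => -κ x) (twist κ e) = e := by
  rw [twist, twist]
  exact Prod.ext rfl (boost_neg_boost (sqrt_pos_of_abs_le hα1 he.1) (h.abs_lt _ he.1)
    (abs_le_sqrt he.2.2))

theorem twist_twist_neg (h : IsCellTwist α β κ) (hα1 : α < 1) {e : ℝ × ℝ}
    (he : e ∈ closedCell α β) : twist κ (twist (fun x => -κ x) e) = e := by
  have := h.neg.twist_neg_twist hα1 he
  simpa only [neg_neg] using this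

/-- Horizontal sides meet the open disc only over `x² < 1 - β²`, where the strength is zero, so the
twist does not disturb their gluing. -/
theorem twist_snd_eq_iff (h : IsCellTwist α β κ) (hα1 : α < 1) {e : ℝ × ℝ}
    (he : e ∈ closedCell α β) (hd : e.1 ^ 2 + e.2 ^ 2 < 1) {b : ℝ} (hb : b ^ 2 = β ^ 2) :
    ((twist κ e).2 = b ↔ e.2 = b) ∧ (e.2 = b → twist κ e = e) := by
  by_cases hx : e.1 ^ 2 ≤ 1 - β ^ 2
  · rw [h.twist_eq_self hα1 he (Or.inr hx)]
    exact ⟨Iff.rfl, fun _ => rfl⟩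
  · have hd' := (h.twist_lt_iff hα1 he).mpr hd
    have h1 : e.2 ≠ b := by
      rintro rfl
      linarith
    have h2 : (twist κ e).2 ≠ b := by
      intro h2
      rw [h2, hb] at hd'
      change e.1 ^ 2 + β ^ 2 < 1 at hd'
      linarith
    exact ⟨iff_of_false h2 h1, fun h3 => absurd h3 h1⟩

end IsCellTwist

theorem exists_isCellTwist {α β k : ℝ} (hα : 0 < α) (hαβ : 1 < α ^ 2 + β ^ 2) (hk : |k| < 1)
    (hβ1 : β ^ 2 < 1) : ∃ κ, IsCellTwist α β κ ∧ κ α = -k := by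
  -- The abscissa at which the side `y = β` leaves the disc; the strength grows linearly from `0`
  -- there to `-k` at `x = α`.
  set d := √(1 - β ^ 2) with hd
  have hd0 : 0 ≤ d := Real.sqrt_nonneg _
  have hd2 : d ^ 2 = 1 - β ^ 2 := Real.sq_sqrt (by linarith)
  have hdα : d < α := by nlinarith
  have hne : α - d ≠ 0 := by linarith
  refine ⟨fun x => -k * max 0 ((x - d) / (α - d)), ⟨by fun_prop, ?_, ?_, ?_⟩, ?_⟩
  · intro x hx
    have h1 : (x - d) / (α - d) ≤ 1 := by
      rw [div_le_one (by linarith)]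
      linarith [le_abs_self x]
    have h2 : max 0 ((x - d) / (α - d)) ≤ 1 := max_le zero_le_one h1
    have h3 : 0 ≤ max 0 ((x - d) / (α - d)) := le_max_left _ _
    rw [abs_mul, abs_neg, abs_of_nonneg h3]
    nlinarith [abs_nonneg k]
  · intro x hx hx2
    have : x ≤ d := by
      rw [← hd2] at hx2
      exact le_of_sq_le_sq hx2 hd0
    rw [max_eq_left (div_nonpos_of_nonpos_of_nonneg (by linarith) (by linarith)), mul_zero]
  · intro x hx
    rw [max_eq_left (div_nonpos_of_nonpos_of_nonneg (by linarith) (by linarith)), mul_zero]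
  · beta_reduce
    rw [div_self hne, max_eq_right zero_le_one, mul_one]

theorem IsTorusModel.exists_twist {α β k : ℝ} {ψ : ℝ → ℝ}
    {P : ℝ × ℝ → UnitAddCircle × UnitAddCircle} (h : IsTorusModel α β id ψ P)
    (hα : 0 < α) (hα1 : α < 1) (hβ : 0 < β) (hβ1 : β < 1) (hαβ : 1 < α ^ 2 + β ^ 2)
    (hk : |k| < 1) : ∃ P', IsTorusModel α β (boost (√(1 - α ^ 2)) k) ψ P' := by
  obtain ⟨κ, hκ, hκα⟩ := exists_isCellTwist hα hαβ hk (by nlinarith)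
  have hinj : ∀ e ∈ closedCell α β, ∀ e' ∈ closedCell α β, twist κ e = twist κ e' → e = e' := by
    intro e he e' he' h1
    rw [← hκ.twist_neg_twist hα1 he, h1, hκ.twist_neg_twist hα1 he']
  have hglued : ∀ e ∈ closedCell α β, ∀ e' ∈ closedCell α β, e.1 ^ 2 + e.2 ^ 2 < 1 →
      e'.1 ^ 2 + e'.2 ^ 2 < 1 → (Glued α β id ψ (twist κ e) (twist κ e') ↔
        Glued α β (boost (√(1 - α ^ 2)) k) ψ e e') := by
    intro e he e' he' hd hd'
    obtain ⟨i1, i2⟩ := hκ.twist_snd_eq_iff hα1 he hd (neg_sq β)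
    obtain ⟨j1, j2⟩ := hκ.twist_snd_eq_iff hα1 he' hd' (rfl : β ^ 2 = β ^ 2)
    unfold Glued
    apply or_congr
    · change e.1 = -α ∧ e'.1 = α ∧ _ ↔ _
      refine and_congr_right fun h1 => and_congr_right fun h2 => ?_
      -- The twist fixes the left side and acts by the boost `-k` on the right one. So gluing by the
      -- identity after the twist is gluing by the boost `k` before it.
      rw [hκ.twist_eq_self hα1 he (Or.inl (by linarith)), id, twist, h2, hκα]
      have hg := sqrt_pos_of_abs_le hα1 (abs_of_pos hα).le
      have hy : |e.2| ≤ √(1 - α ^ 2) := abs_le_sqrt (by rw [h1, neg_sq] at hd; exact hd.le)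
      have hy' : |e'.2| ≤ √(1 - α ^ 2) := abs_le_sqrt (by rw [h2] at hd'; exact hd'.le)
      constructor
      · intro e1
        have := boost_neg_boost hg (κ := -k) (by rwa [abs_neg]) hy'
        rw [neg_neg] at this
        rw [← this]
        exact congrArg _ e1
      · intro e1
        rw [e1]
        exact boost_neg_boost hg hk hy
    · rw [i1, j1]
      refine and_congr_right fun h1 => and_congr_right fun h2 => ?_
      rw [i2 h1, j2 h2]
  refine ⟨P ∘ twist κ, ⟨h.continuousOn.comp (hκ.continuousOn_twist hα1)
    fun e he => hκ.twist_mem hα1 hβ.le he, fun e he => ?_, fun p hp => ?_,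
    fun e he e' he' hd hd' => ?_⟩⟩
  · rw [Function.comp_apply, h.lt_norm_iff _ (hκ.twist_mem hα1 hβ.le he), hκ.twist_lt_iff hα1 he]
  · obtain ⟨e, he, rfl⟩ := h.exists_eq p hp
    exact ⟨_, hκ.neg.twist_mem hα1 hβ.le he, by
      rw [Function.comp_apply, hκ.twist_twist_neg hα1 he]⟩
  · rw [Function.comp_apply, Function.comp_apply, h.eq_iff _ (hκ.twist_mem hα1 hβ.le he) _
      (hκ.twist_mem hα1 hβ.le he') ((hκ.twist_lt_iff hα1 he).mpr hd)
      ((hκ.twist_lt_iff hα1 he').mpr hd'), hglued e he e' he' hd hd', hglued e' he' e he hd' hd]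
    exact or_congr_left ⟨hinj e he e' he', fun h => by rw [h]⟩

/-- The cell with sides glued by arbitrary boosts is a one-holed torus. -/
theorem exists_isTorusModel {α β k l : ℝ} (hα : 0 < α) (hα1 : α < 1) (hβ : 0 < β) (hβ1 : β < 1)
    (hαβ : 1 < α ^ 2 + β ^ 2) (hk : |k| < 1) (hl : |l| < 1) :
    ∃ P, IsTorusModel α β (boost (√(1 - α ^ 2)) k) (boost (√(1 - β ^ 2)) l) P := by
  obtain ⟨P, hP⟩ := exists_isTorusModel_id hα hα1 hβ hβ1 hαβ
  obtain ⟨P', hP'⟩ := hP.swap.exists_twist hβ hβ1 hα hα1 (by linarith) hl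
  exact hP'.swap.exists_twist hα hα1 hβ hβ1 hαβ hk

end TorusModel

-- The fundamental cell of a family of paired forms

section FormCell

/-- The value of a real form at a point of the upper half plane, normalized so that it is invariant:
up to a factor, the hyperbolic sine of the signed distance from the geodesic of the form. -/
def formHeight (c : ℝ × ℝ × ℝ) (z : ℍ) : ℝ := realHerm c z 1 / z.im

theorem formHeight_eq (c : ℝ × ℝ × ℝ) (z : ℍ) :
    formHeight c z = (c.1 * (z.re ^ 2 + z.im ^ 2) + 2 * c.2.1 * z.re + c.2.2) / z.im := by
  have : realHerm c z 1 = c.1 * (z.re ^ 2 + z.im ^ 2) + 2 * c.2.1 * z.re + c.2.2 := by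
    simp [realHerm, herm, Complex.normSq_apply]
    ring
  rw [formHeight, this]

theorem continuous_formHeight (c : ℝ × ℝ × ℝ) : Continuous (formHeight c) := by
  have h1 := UpperHalfPlane.continuous_re
  have h2 := UpperHalfPlane.continuous_im
  simp_rw [funext (formHeight_eq c)]
  exact Continuous.div (by fun_prop) h2 fun z => z.im_ne_zero

theorem formHeight_smul (u : SL(2, ℝ)) (c : ℝ × ℝ × ℝ) (z : ℍ) :
    formHeight c (u • z) = formHeight (pullForm u c) z := by
  set n : ℂ := u 0 0 * z + u 0 1 with hn
  set d : ℂ := u 1 0 * z + u 1 1 with hd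
  have hcoe : ((u • z : ℍ) : ℂ) = d⁻¹ * n := by
    rw [UpperHalfPlane.coe_specialLinearGroup_apply]
    exact div_eq_inv_mul _ _
  have hd0 : d ≠ 0 := by
    intro h0
    have h1 := congrArg Complex.im h0
    have h2 := congrArg Complex.re h0
    simp [hd, z.im_ne_zero] at h1 h2
    have := det_eq u
    simp [h1] at this h2
    simp [h2] at this
  have him : (u • z : ℍ).im = Complex.normSq d⁻¹ * z.im := by
    rw [← UpperHalfPlane.coe_im, hcoe, Complex.inv_def, Complex.normSq_mul, Complex.normSq_conj,
      Complex.normSq_ofReal]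
    have h0 : Complex.normSq d ≠ 0 := by simpa using hd0
    have e : (starRingEnd ℂ d * n).im = z.im := by
      have := det_eq u
      simp [hn, hd, Complex.mul_im]
      linear_combination z.im * this
    rw [mul_right_comm, Complex.mul_im, Complex.ofReal_re, Complex.ofReal_im, mul_zero, zero_add,
      mul_comm _ (Complex.normSq d)⁻¹, e]
    field_simp
  have hnum : realHerm c ((u • z : ℍ) : ℂ) 1 = Complex.normSq d⁻¹ * realHerm c n d := by
    have := herm_smul c.1 c.2.1 c.2.2 d⁻¹ n d
    rw [inv_mul_cancel₀ hd0] at this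
    rw [hcoe]
    exact this
  have hne : Complex.normSq d⁻¹ ≠ 0 := by simpa using hd0
  rw [formHeight, hnum, him, mul_div_mul_left _ _ hne, formHeight, realHerm_pullForm, mul_one,
    mul_one]

/-- Completing the square gives `A (x² + y²) + 2 B x + C ≥ 2 √(A C - B²) y` on the upper half plane.
Applied to sums of two forms, it gives a uniform gap between distinct sides. -/
theorem exists_le_formHeight {c : ℝ × ℝ × ℝ}
    (h : ∀ p q : ℂ, (p ≠ 0 ∨ q ≠ 0) → 0 < realHerm c p q) :
    ∃ ε > 0, ∀ z : ℍ, ε ≤ formHeight c z := by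
  obtain ⟨A, B, C⟩ := c
  have hA : 0 < A := by
    have := h 1 0 (Or.inl one_ne_zero)
    simpa [realHerm, herm] using this
  have hdet : 0 < A * C - B ^ 2 := by
    have := h (-B) A (Or.inr (by exact_mod_cast hA.ne'))
    have h2 : realHerm (A, B, C) (-B) A = A * (A * C - B ^ 2) := by
      simp [realHerm, herm, Complex.normSq_apply]
      ring
    rw [h2] at this
    exact (mul_pos_iff_of_pos_left hA).mp this
  refine ⟨2 * √(A * C - B ^ 2), by positivity, fun z => ?_⟩
  have hz := z.im_pos
  rw [formHeight_eq, le_div_iff₀ hz]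
  have hs := Real.sq_sqrt hdet.le
  have h0 := Real.sqrt_nonneg (A * C - B ^ 2)
  simp only
  have : A * (2 * √(A * C - B ^ 2) * z.im) ≤
      A * (A * (z.re ^ 2 + z.im ^ 2) + 2 * B * z.re + C) := by
    nlinarith [sq_nonneg (A * z.re + B), sq_nonneg (A * z.im - √(A * C - B ^ 2))]
  exact le_of_mul_le_mul_left this hA

theorem formHeight_add (c d : ℝ × ℝ × ℝ) (z : ℍ) :
    formHeight c z + formHeight d z = formHeight (c + d) z := by
  rw [formHeight, formHeight, ← add_div, realHerm_add, formHeight]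

/-- The region of the upper half plane where all the forms are nonnegative. -/
def formCell {κ : Type*} (c : κ → ℝ × ℝ × ℝ) : Set ℍ := {z | ∀ l, 0 ≤ formHeight (c l) z}

theorem isClosed_formCell {κ : Type*} (c : κ → ℝ × ℝ × ℝ) : IsClosed (formCell c) := by
  have : formCell c = ⋂ l, {z | 0 ≤ formHeight (c l) z} := by ext; simp [formCell]
  rw [this]
  exact isClosed_iInter fun l => isClosed_le continuous_const (continuous_formHeight _)

namespace PairsForms

variable {ι : Type*} {a : ι → SL(2, ℝ)} {c : ι × Bool → ℝ × ℝ × ℝ}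

theorem formHeight_letter (h : PairsForms a c) (l : ι × Bool) (z : ℍ) :
    formHeight (c l) (letter (fun i => (QuotientGroup.mk (a i) : PSL2R)) l • z)
      = - formHeight (c (l.1, !l.2)) z := by
  have key : ∀ i (w : ℍ), formHeight (c (i, true)) ((QuotientGroup.mk (a i) : PSL2R) • w)
      = - formHeight (c (i, false)) w := by
    intro i w
    rw [mk_smul_upperHalfPlane, formHeight_smul, formHeight, realHerm_pullForm, h.map_eq, neg_div,
      formHeight]
  obtain ⟨i, _ | _⟩ := l
  · have := key i ((QuotientGroup.mk (a i) : PSL2R)⁻¹ • z)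
    rw [smul_inv_smul] at this
    change formHeight (c (i, false)) ((QuotientGroup.mk (a i) : PSL2R)⁻¹ • z)
      = - formHeight (c (i, true)) z
    linarith
  · exact key i z

theorem exists_le_add [Finite ι] (h : PairsForms a c) : ∃ ε > 0, ∀ l m, l ≠ m → ∀ z,
    ε ≤ formHeight (c l) z + formHeight (c m) z := by
  have h1 : ∀ p : (ι × Bool) × (ι × Bool), ∃ ε > 0, p.1 ≠ p.2 → ∀ z,
      ε ≤ formHeight (c p.1) z + formHeight (c p.2) z := by
    intro p
    by_cases hp : p.1 = p.2
    · exact ⟨1, one_pos, fun h => absurd hp h⟩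
    · obtain ⟨ε, hε, h2⟩ := exists_le_formHeight (c := c p.1 + c p.2) (fun x y hxy => by
        rw [← realHerm_add]; exact h.add_pos _ _ hp x y hxy)
      exact ⟨ε, hε, fun _ z => by rw [formHeight_add]; exact h2 z⟩
  choose ε hε h2 using h1
  cases isEmpty_or_nonempty ι
  · exact ⟨1, one_pos, fun l => isEmptyElim l.1⟩
  · obtain ⟨p, hp⟩ := Finite.exists_min ε
    exact ⟨ε p, hε p, fun l m hlm z => (hp (l, m)).trans (h2 (l, m) hlm z)⟩

theorem letter_mem_closure (A : ι → PSL2R) (l : ι × Bool) :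
    letter A l ∈ Subgroup.closure (range A) := by
  obtain ⟨i, _ | _⟩ := l
  · exact inv_mem (Subgroup.subset_closure ⟨i, rfl⟩)
  · exact Subgroup.subset_closure ⟨i, rfl⟩

/-- The translates of the cell cover the upper half plane, locally by finitely many of them. -/
theorem exists_finite_cover [Finite ι] (h : PairsForms a c) (z₀ : ℍ) : ∃ U ∈ nhds z₀,
    ∃ W : Set PSL2R, W.Finite ∧
      W ⊆ Subgroup.closure (range fun i => (QuotientGroup.mk (a i) : PSL2R)) ∧
      ∀ z ∈ U, ∃ w ∈ W, w • z ∈ formCell c := by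
  set A : ι → PSL2R := fun i => QuotientGroup.mk (a i) with hA
  obtain ⟨ε, hε, hsum⟩ := h.exists_le_add
  have key : ∀ n : ℕ, ∃ W : Set PSL2R, W.Finite ∧ W ⊆ Subgroup.closure (range A) ∧
      ∀ z : ℍ, (∀ l, -(n * ε) ≤ formHeight (c l) z) → ∃ w ∈ W, w • z ∈ formCell c := by
    intro n
    induction n with
    | zero =>
      refine ⟨{1}, finite_singleton _, by simp, fun z hz => ⟨1, rfl, fun l => ?_⟩⟩
      rw [one_smul]
      simpa using hz l
    | succ n ih =>
      obtain ⟨W, hW, hWG, hWc⟩ := ih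
      refine ⟨{1} ∪ image2 (fun w l => w * letter A l) W univ,
        (finite_singleton _).union (hW.image2 _ finite_univ), ?_, fun z hz => ?_⟩
      · rw [union_subset_iff]
        refine ⟨by simp, ?_⟩
        rintro _ ⟨w, hw, l, -, rfl⟩
        exact mul_mem (hWG hw) (letter_mem_closure A l)
      by_cases hzc : z ∈ formCell c
      · exact ⟨1, Or.inl rfl, by rwa [one_smul]⟩
      obtain ⟨m, hm⟩ : ∃ m, formHeight (c m) z < 0 := by
        by_contra! hc
        exact hzc hc
      -- Crossing the violated side `m` makes the height of `l` equal to `-formHeight (c m) z > 0`.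
      -- Every other height is then at least `ε + formHeight (c m) z`, so the worst deficit drops by
      -- at least `ε`.
      set l : ι × Bool := (m.1, !m.2) with hl
      have hlm : (l.1, !l.2) = m := by simp [hl]
      have h1 := h.formHeight_letter l z
      rw [hlm] at h1
      have h2 := hz m
      obtain ⟨w, hw, hwz⟩ := hWc (letter A l • z) (fun k => by
        by_cases hk : k = l
        · rw [hk]
          have : 0 ≤ n * ε := by positivity
          linarith
        · have h3 := hsum k l hk (letter A l • z)
          push_cast at h2
          linarith)
      exact ⟨w * letter A l, Or.inr ⟨w, hw, l, trivial, rfl⟩, by rwa [mul_smul]⟩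
  obtain ⟨n, hn⟩ : ∃ n : ℕ, ∀ l, -(n * ε) < formHeight (c l) z₀ := by
    cases isEmpty_or_nonempty ι
    · exact ⟨0, fun l => isEmptyElim l.1⟩
    · obtain ⟨m, hm⟩ := Finite.exists_min fun l => formHeight (c l) z₀
      obtain ⟨n, hn⟩ := exists_nat_gt (-formHeight (c m) z₀ / ε)
      rw [div_lt_iff₀ hε] at hn
      exact ⟨n, fun l => by linarith [hm l]⟩
  obtain ⟨W, hW, hWG, hWc⟩ := key n
  refine ⟨⋂ l, {z | -(n * ε) < formHeight (c l) z}, ?_, W, hW, hWG, fun z hz => hWc z fun l => ?_⟩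
  · rw [Filter.iInter_mem]
    exact fun l => (isOpen_lt continuous_const (continuous_formHeight _)).mem_nhds (hn l)
  · exact (mem_iInter.mp hz l).le

/-- Ping-pong on heights: a nonpositive height at `m` forces a positive one at every other letter,
and applying `l` turns the height at `l⁻¹` into its negative at `l`. Only one-letter words can end
on the boundary. -/
theorem formHeight_word_nonpos (h : PairsForms a c) {e : ℍ} (he : e ∈ formCell c)
    (L : List (ι × Bool)) : ∀ l, FreeGroup.IsReduced (l :: L) →
      let A : ι → PSL2R := fun i => QuotientGroup.mk (a i)
      formHeight (c l) (((l :: L).map (letter A)).prod • e) ≤ 0 ∧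
      (L ≠ [] → formHeight (c l) (((l :: L).map (letter A)).prod • e) < 0) := by
  induction L with
  | nil =>
    intro l _
    simp only [List.map_cons, List.map_nil, List.prod_cons, List.prod_nil, mul_one,
      h.formHeight_letter, ne_eq, not_true_eq_false, false_imp_iff, and_true]
    linarith [he (l.1, !l.2)]
  | cons m L ih =>
    intro l hr A
    rw [FreeGroup.isReduced_cons_cons] at hr
    have hm := (ih m hr.2).1
    rw [List.map_cons, List.prod_cons, mul_smul, h.formHeight_letter]
    have hne : (l.1, !l.2) ≠ m := by
      rintro rfl
      simpa using hr.1
    have h0 : 0 < formHeight (c (l.1, !l.2)) (((m :: L).map (letter A)).prod • e)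
        + formHeight (c m) (((m :: L).map (letter A)).prod • e) := by
      rw [formHeight, formHeight, ← add_div]
      exact div_pos (h.add_pos _ _ hne _ _ (Or.inr one_ne_zero)) (UpperHalfPlane.im_pos _)
    constructor
    · linarith
    · intro _
      linarith

/-- Two points of the cell are equivalent only if they coincide or lie on paired sides. -/
theorem smul_mem_formCell_iff [DecidableEq ι] (h : PairsForms a c) {e e' : ℍ} (he : e ∈ formCell c)
    (he' : e' ∈ formCell c) :
    (∃ w ∈ Subgroup.closure (range fun i => (QuotientGroup.mk (a i) : PSL2R)), w • e = e') ↔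
      e = e' ∨ ∃ i, (formHeight (c (i, false)) e = 0 ∧ (QuotientGroup.mk (a i) : PSL2R) • e = e') ∨
        (formHeight (c (i, false)) e' = 0 ∧ (QuotientGroup.mk (a i) : PSL2R) • e' = e) := by
  constructor
  · rintro ⟨w, hw, rfl⟩
    rw [← FreeGroup.range_lift_eq_closure] at hw
    obtain ⟨f, rfl⟩ := hw
    have hr : FreeGroup.IsReduced f.toWord := FreeGroup.isReduced_toWord
    have hf : FreeGroup.lift (fun i => (QuotientGroup.mk (a i) : PSL2R)) f
        = (f.toWord.map (letter fun i => (QuotientGroup.mk (a i) : PSL2R))).prod := by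
      conv_lhs => rw [← FreeGroup.mk_toWord (x := f)]
      exact FreeGroup.lift_mk
    rw [hf] at he' ⊢
    generalize f.toWord = L at hr he' ⊢
    -- A single letter makes two nonnegative heights opposite, so both vanish and the points lie on
    -- paired sides; longer words leave the cell.
    rcases L with _ | ⟨l, _ | ⟨m, L⟩⟩
    · left; simp
    · right
      simp only [List.map_cons, List.map_nil, List.prod_cons, List.prod_nil, mul_one] at he' ⊢
      have h1 := h.formHeight_letter l e
      have h2 := he' l
      have h3 := he (l.1, !l.2)
      obtain ⟨i, _ | _⟩ := l
      · refine ⟨i, Or.inr ⟨?_, smul_inv_smul _ _⟩⟩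
        simp only [Bool.not_false] at h1 h3
        exact le_antisymm (by rw [h1]; linarith) h2
      · refine ⟨i, Or.inl ⟨?_, rfl⟩⟩
        simp only [Bool.not_true] at h1 h3
        linarith
    · exact absurd (he' l) (not_le.mpr ((h.formHeight_word_nonpos he (m :: L) l hr).2 (by simp)))
  · rintro (rfl | ⟨i, ⟨-, h1⟩ | ⟨-, h1⟩⟩)
    · exact ⟨1, one_mem _, one_smul _ _⟩
    · exact ⟨_, Subgroup.subset_closure ⟨i, rfl⟩, h1⟩
    · refine ⟨_, inv_mem (Subgroup.subset_closure ⟨i, rfl⟩), ?_⟩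
      rw [← h1, inv_smul_smul]

end PairsForms

end FormCell

-- Quotients from locally finite covers

section QuotientHomeo

/-- A closed set whose translates cover locally finitely is a topological model of the quotient. -/
theorem isQuotientMap_mk_of_cover {X Γ : Type*} [TopologicalSpace X] [Group Γ] [MulAction Γ X]
    (hcont : ∀ γ : Γ, Continuous fun x : X => γ • x) {E : Set X} (hE : IsClosed E)
    (hcov : ∀ x : X, ∃ U ∈ nhds x, ∃ W : Set Γ, W.Finite ∧ ∀ y ∈ U, ∃ w ∈ W, w • y ∈ E) :
    Topology.IsQuotientMap
      (fun e : E => (Quotient.mk (MulAction.orbitRel Γ X) (e : X))) := by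
  have hmk : ∀ (γ : Γ) (x : X), Quotient.mk (MulAction.orbitRel Γ X) (γ • x) = Quotient.mk _ x :=
    fun γ x => Quotient.sound ⟨γ, rfl⟩
  have hc : Continuous (fun e : E => (Quotient.mk (MulAction.orbitRel Γ X) (e : X))) :=
    continuous_quotient_mk'.comp continuous_subtype_val
  rw [Topology.isQuotientMap_iff_isClosed]
  refine ⟨?_, fun V => ⟨fun hV => hV.preimage hc, fun hV => ?_⟩⟩
  · intro q
    obtain ⟨x, rfl⟩ := Quotient.exists_rep q
    obtain ⟨U, hU, W, -, hW⟩ := hcov x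
    obtain ⟨w, -, hw⟩ := hW x (mem_of_mem_nhds hU)
    exact ⟨⟨_, hw⟩, hmk w x⟩
  · rw [← isQuotientMap_quotient_mk'.isClosed_preimage]
    set C : Set X := (↑) '' ((fun e : E => (Quotient.mk (MulAction.orbitRel Γ X) (e : X))) ⁻¹' V)
      with hC
    have hCcl : IsClosed C := hE.isClosedEmbedding_subtypeVal.isClosedMap _ hV
    rw [← isOpen_compl_iff, isOpen_iff_mem_nhds]
    intro x hx
    obtain ⟨U, hU, W, hWf, hW⟩ := hcov x
    -- Near `x` only the finitely many translations in `W` are needed to enter `E`, so avoiding the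
    -- closed set `C` under all of them is an open condition.
    have h1 : (⋂ w ∈ W, {y | w • y ∉ C}) ∈ nhds x := by
      rw [Filter.biInter_mem hWf]
      intro w _
      refine (hCcl.isOpen_compl.preimage (hcont w)).mem_nhds ?_
      rintro ⟨e, he, hex⟩
      apply hx
      change Quotient.mk _ x ∈ V
      rw [← hmk w x]
      change (e : X) = w • x at hex
      rw [← hex]
      exact he
    filter_upwards [hU, h1] with y hy hy1 hyV
    obtain ⟨w, hw, hwE⟩ := hW y hy
    refine mem_iInter₂.mp hy1 w hw ⟨⟨_, hwE⟩, ?_, rfl⟩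
    change Quotient.mk _ (w • y) ∈ V
    rwa [hmk w y]

theorem nonempty_homeomorph_of_isQuotientMap {X Y Z : Type*} [TopologicalSpace X]
    [TopologicalSpace Y] [TopologicalSpace Z] {f : X → Y} {g : X → Z}
    (hf : Topology.IsQuotientMap f) (hg : Topology.IsQuotientMap g)
    (h : ∀ x x', f x = f x' ↔ g x = g x') : Nonempty (Y ≃ₜ Z) := by
  let F : C(X, Y) := ⟨f, hf.continuous⟩
  let F' : C(X, Z) := ⟨g, hg.continuous⟩
  have e : Setoid.ker f = Setoid.ker g := by
    ext x x'
    exact h x x'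
  have h1 : Quotient (Setoid.ker f) ≃ₜ Y := Topology.IsQuotientMap.homeomorph (f := F) hf
  have h2 : Quotient (Setoid.ker g) ≃ₜ Z := Topology.IsQuotientMap.homeomorph (f := F') hg
  rw [← e] at h2
  exact ⟨h1.symm.trans h2⟩

end QuotientHomeo

-- The Klein model

section KleinModel

theorem formHeight_decomp (c : ℝ × ℝ × ℝ) (z : ℍ) : formHeight c z
    = (c.1 + c.2.2) / 2 * formHeight (1, 0, 1) z + (c.1 - c.2.2) / 2 * formHeight (1, 0, -1) z
      + c.2.1 * formHeight (0, 1, 0) z := by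
  simp only [formHeight_eq]
  ring

theorem formHeight_pos (z : ℍ) : 0 < formHeight (1, 0, 1) z := by
  rw [formHeight_eq]
  have := z.im_pos
  refine div_pos ?_ this
  nlinarith [sq_nonneg z.re, sq_nonneg z.im]

/-- The three heights are the coordinates of the hyperboloid model; dividing by the first one
projects it to the Klein disc. -/
theorem formHeight_sq (z : ℍ) : formHeight (1, 0, 1) z ^ 2
    = formHeight (1, 0, -1) z ^ 2 + formHeight (0, 1, 0) z ^ 2 + 4 := by
  have := z.im_ne_zero
  simp only [formHeight_eq]
  field_simp
  ring

/-- The coordinates of the Klein disc model. -/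
def klein (z : ℍ) : ℝ × ℝ :=
  (formHeight (1, 0, -1) z / formHeight (1, 0, 1) z,
    formHeight (0, 1, 0) z / formHeight (1, 0, 1) z)

theorem continuous_klein : Continuous klein :=
  ((continuous_formHeight _).div (continuous_formHeight _) fun z => (formHeight_pos z).ne').prodMk
    ((continuous_formHeight _).div (continuous_formHeight _) fun z => (formHeight_pos z).ne')

theorem klein_sq_lt (z : ℍ) : (klein z).1 ^ 2 + (klein z).2 ^ 2 < 1 := by
  have h := formHeight_pos z
  rw [klein, div_pow, div_pow, ← add_div, div_lt_one (by positivity), formHeight_sq z]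
  linarith

/-- The inverse of the Klein coordinates, as a complex number. -/
def kleinInv (e : ℝ × ℝ) : ℂ :=
  ((e.2 / (1 - e.1) : ℝ) : ℂ) + ((√(1 - e.1 ^ 2 - e.2 ^ 2) / (1 - e.1) : ℝ) : ℂ) * Complex.I

theorem kleinInv_re (e : ℝ × ℝ) : (kleinInv e).re = e.2 / (1 - e.1) := by
  simp only [kleinInv, Complex.add_re, Complex.ofReal_re, Complex.re_ofReal_mul, Complex.I_re,
    mul_zero, add_zero]

theorem kleinInv_im (e : ℝ × ℝ) :
    (kleinInv e).im = √(1 - e.1 ^ 2 - e.2 ^ 2) / (1 - e.1) := by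
  simp only [kleinInv, Complex.add_im, Complex.ofReal_im, Complex.im_ofReal_mul, Complex.I_im,
    mul_one, zero_add]

theorem one_sub_fst_pos {e : ℝ × ℝ} (he : e.1 ^ 2 + e.2 ^ 2 < 1) : 0 < 1 - e.1 := by
  nlinarith [sq_nonneg e.2, sq_nonneg (e.1 - 1)]

theorem continuousAt_kleinInv {e : ℝ × ℝ} (he : e.1 ^ 2 + e.2 ^ 2 < 1) :
    ContinuousAt kleinInv e := by
  have := (one_sub_fst_pos he).ne'
  unfold kleinInv
  have h1 : ContinuousAt (fun e : ℝ × ℝ => e.2 / (1 - e.1)) e :=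
    ContinuousAt.div (by fun_prop) (by fun_prop) this
  have h2 : ContinuousAt (fun e : ℝ × ℝ => √(1 - e.1 ^ 2 - e.2 ^ 2) / (1 - e.1)) e :=
    ContinuousAt.div (by fun_prop) (by fun_prop) this
  exact (Complex.continuous_ofReal.continuousAt.comp h1).add
    ((Complex.continuous_ofReal.continuousAt.comp h2).mul continuousAt_const)

theorem kleinInv_klein (z : ℍ) : kleinInv (klein z) = z := by
  have h0 := formHeight_pos z
  have hy := z.im_pos
  have h1 : 1 - (klein z).1 = 2 / (z.im * formHeight (1, 0, 1) z) := by
    rw [klein]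
    field_simp
    simp only [formHeight_eq]
    field_simp
    ring
  have h2 : 1 - (klein z).1 ^ 2 - (klein z).2 ^ 2 = (2 / formHeight (1, 0, 1) z) ^ 2 := by
    have := formHeight_sq z
    rw [klein]
    field_simp
    linear_combination this
  have h3 : (klein z).2 = 2 * z.re / z.im / formHeight (1, 0, 1) z := by
    have e : formHeight (0, 1, 0) z = 2 * z.re / z.im := by rw [formHeight_eq]; ring
    change formHeight (0, 1, 0) z / _ = _
    rw [e]
  apply Complex.ext
  · rw [kleinInv_re, h1, h3, UpperHalfPlane.coe_re]
    field_simp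
  · rw [kleinInv_im, h1, h2, Real.sqrt_sq (by positivity), UpperHalfPlane.coe_im]
    field_simp

theorem klein_injective : Function.Injective klein := fun z w h => by
  apply UpperHalfPlane.ext
  rw [← kleinInv_klein z, h, kleinInv_klein]

theorem exists_klein_eq {e : ℝ × ℝ} (he : e.1 ^ 2 + e.2 ^ 2 < 1) :
    ∃ z : ℍ, (z : ℂ) = kleinInv e ∧ klein z = e := by
  obtain ⟨x, y⟩ := e
  have h1 := one_sub_fst_pos he
  simp only at he h1
  have hs : 0 < 1 - x ^ 2 - y ^ 2 := by linarith
  have hsq := Real.sq_sqrt hs.le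
  have hs' := Real.sqrt_pos.mpr hs
  have him : (kleinInv (x, y)).im = √(1 - x ^ 2 - y ^ 2) / (1 - x) := kleinInv_im _
  have hre : (kleinInv (x, y)).re = y / (1 - x) := kleinInv_re _
  refine ⟨⟨kleinInv (x, y), by rw [him]; positivity⟩, rfl, ?_⟩
  set z : ℍ := ⟨kleinInv (x, y), by rw [him]; positivity⟩ with hz
  have him' : z.im = √(1 - x ^ 2 - y ^ 2) / (1 - x) := him
  have hre' : z.re = y / (1 - x) := hre
  have hN : z.re ^ 2 + z.im ^ 2 = (1 + x) / (1 - x) := by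
    rw [him', hre', div_pow, div_pow, hsq]
    field_simp
    ring
  have hy := z.im_ne_zero
  have e0 : formHeight (1, 0, 1) z = 2 / (1 - x) / z.im := by
    rw [formHeight_eq, hN]
    congr 1
    field_simp
    ring
  have e1 : formHeight (1, 0, -1) z = 2 * x / (1 - x) / z.im := by
    rw [formHeight_eq, hN]
    congr 1
    field_simp
    ring
  have e2 : formHeight (0, 1, 0) z = 2 * y / (1 - x) / z.im := by
    rw [formHeight_eq, hre']
    congr 1
    ring
  rw [klein, e0, e1, e2]
  ext
  · simp only
    field_simp
  · simp only
    field_simp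

/-- The Klein chart is a homeomorphism onto the open disc, so the closure of the image of a closed
set adds points only on the unit circle. -/
theorem exists_of_mem_closure_klein {V : Set ℍ} (hV : IsClosed V) {e : ℝ × ℝ}
    (he : e.1 ^ 2 + e.2 ^ 2 < 1) (h : e ∈ closure (klein '' V)) : ∃ z ∈ V, klein z = e := by
  obtain ⟨z, hz, rfl⟩ := exists_klein_eq he
  refine ⟨z, ?_, rfl⟩
  have h1 := mem_closure_image (continuousAt_kleinInv he) h
  have h2 : kleinInv '' (klein '' V) = (fun z : ℍ => (z : ℂ)) '' V := by
    rw [image_image]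
    exact image_congr fun z _ => kleinInv_klein z
  rw [h2, ← hz] at h1
  rw [← hV.closure_eq, UpperHalfPlane.isEmbedding_coe.closure_eq_preimage_closure_image]
  exact h1

theorem formHeight_normalForms (α β : ℝ) (z : ℍ) :
    formHeight (normalForms α β (0, true)) z
      = α * formHeight (1, 0, 1) z * (α - (klein z).1) ∧
    formHeight (normalForms α β (0, false)) z
      = α * formHeight (1, 0, 1) z * (α + (klein z).1) ∧
    formHeight (normalForms α β (1, true)) z
      = β * formHeight (1, 0, 1) z * (β - (klein z).2) ∧
    formHeight (normalForms α β (1, false)) z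
      = β * formHeight (1, 0, 1) z * (β + (klein z).2) := by
  have h := (formHeight_pos z).ne'
  refine ⟨?_, ?_, ?_, ?_⟩ <;> rw [formHeight_decomp (normalForms _ _ _)] <;>
    simp only [normalForms, klein] <;> field_simp <;> ring

theorem mem_formCell_normalForms {α β : ℝ} (hα : 0 < α) (hβ : 0 < β) (z : ℍ) :
    z ∈ formCell (normalForms α β) ↔ klein z ∈ closedCell α β := by
  have h := formHeight_pos z
  obtain ⟨h1, h2, h3, h4⟩ := formHeight_normalForms α β z
  have hα' := mul_pos hα h
  have hβ' := mul_pos hβ h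
  simp only [formCell, closedCell, mem_ofPred_eq, (klein_sq_lt z).le, and_true, abs_le]
  simp only [Prod.forall, Fin.forall_fin_two, Bool.forall_bool, h1, h2, h3, h4,
    mul_nonneg_iff_of_pos_left hα', mul_nonneg_iff_of_pos_left hβ']
  constructor
  · rintro ⟨⟨k1, k2⟩, k3, k4⟩
    exact ⟨⟨by linarith, by linarith⟩, by linarith, by linarith⟩
  · rintro ⟨⟨k1, k2⟩, k3, k4⟩
    exact ⟨⟨by linarith, by linarith⟩, by linarith, by linarith⟩

/-- The action on the left side of the cell of a symmetric matrix. -/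
theorem klein_smul_left {a : SL(2, ℝ)} (ha : a 0 1 = a 1 0) {α : ℝ}
    (hα : α * tr a = a 0 0 - a 1 1) : ∃ k : ℝ, |k| < 1 ∧ ∀ z : ℍ, (klein z).1 = -α →
      klein (a • z) = (α, boost (√(1 - α ^ 2)) k (klein z).2) := by
  have hd := det_eq a
  have ht := tr_ne_zero_of_symm ha
  rw [← ha] at hd
  set p := a 0 0
  set q := a 0 1
  set r := a 1 1
  have htr : tr a = p + r := rfl
  rw [htr] at hα ht
  have hs : 0 < p * r + q ^ 2 := by nlinarith [sq_nonneg q]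
  have hc2 : (1 - α ^ 2) * (p + r) ^ 2 = 4 * (p * r) := by
    linear_combination (-α * (p + r) - (p - r)) * hα
  have hpr : 0 < p * r := by nlinarith [sq_nonneg q]
  have hc : 0 < 1 - α ^ 2 := by
    have : 0 < (p + r) ^ 2 := by positivity
    by_contra hneg
    nlinarith
  set c := √(1 - α ^ 2) with hcdef
  have hc0 : 0 < c := Real.sqrt_pos.mpr hc
  have hcc : c ^ 2 = 1 - α ^ 2 := Real.sq_sqrt hc.le
  -- The square of the numerator is `4 p r q²`, and `(p r + q²)² - 4 p r q² = (p r - q²)² = 1`.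
  have hcsq : |c * q * (p + r) / (p * r + q ^ 2)| < 1 := by
    rw [← sq_lt_one_iff_abs_lt_one, div_pow, div_lt_one (by positivity)]
    have : (c * q * (p + r)) ^ 2 = 4 * (p * r) * q ^ 2 := by
      linear_combination q ^ 2 * (p + r) ^ 2 * hcc + q ^ 2 * hc2
    rw [this]
    nlinarith
  refine ⟨c * q * (p + r) / (p * r + q ^ 2), hcsq, fun z hz => ?_⟩
  have h0 := formHeight_pos z
  have hz' := formHeight_pos (a • z)
  have hy : |(klein z).2| ≤ c := abs_le_sqrt (by
    have := (klein_sq_lt z).le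
    rw [hz, neg_sq] at this
    exact this)
  have hden := boost_denom_pos hc0 hcsq hy
  have e0 := formHeight_smul a (1, 0, 1) z
  have e1 := formHeight_smul a (1, 0, -1) z
  have e2 := formHeight_smul a (0, 1, 0) z
  rw [formHeight_decomp (pullForm _ _)] at e0 e1 e2
  simp only [pullForm, ← ha] at e0 e1 e2
  change _ = (α, _)
  have hk1 : formHeight (1, 0, -1) z = -α * formHeight (1, 0, 1) z := by
    rw [← hz, klein]; field_simp
  have hk2 : formHeight (0, 1, 0) z = (klein z).2 * formHeight (1, 0, 1) z := by
    rw [klein]; field_simp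
  rw [hk1, hk2] at e0 e1 e2
  generalize (klein z).2 = y at *
  generalize formHeight (1, 0, 1) z = W at *
  rw [klein]
  have f0 : formHeight (1, 0, 1) (a • z) = ((p * r + q ^ 2) + q * (p + r) * y) * W := by
    rw [e0]
    linear_combination (-(p - r) / 2 * W) * hα
  have f1 : formHeight (1, 0, -1) (a • z) = α * formHeight (1, 0, 1) (a • z) := by
    rw [e1, f0]
    have : (p + r) * ((p ^ 2 - r ^ 2) / 2 * W - (p ^ 2 - 2 * q ^ 2 + r ^ 2) / 2 * (α * W)
      + q * (p - r) * (y * W) - α * (((p * r + q ^ 2) + q * (p + r) * y) * W)) = 0 := by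
      linear_combination (-(p ^ 2 - 2 * q ^ 2 + r ^ 2) / 2 * W
        - ((p * r + q ^ 2) + q * (p + r) * y) * W) * hα
    have := (mul_eq_zero.mp this).resolve_left ht
    linear_combination this
  have f2 : (p + r) * formHeight (0, 1, 0) (a • z)
      = (4 * (p * r) * q + (p * r + q ^ 2) * (p + r) * y) * W := by
    rw [e2]
    linear_combination (-q * (p - r) * W) * hα
  ext
  · change formHeight (1, 0, -1) (a • z) / formHeight (1, 0, 1) (a • z) = α
    rw [f1, mul_div_assoc, div_self hz'.ne', mul_one]
  · change formHeight (0, 1, 0) (a • z) / formHeight (1, 0, 1) (a • z) = boost c _ y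
    rw [boost, div_eq_div_iff hz'.ne' hden.ne']
    apply mul_left_cancel₀ (mul_ne_zero ht hs.ne')
    have hx : c * q * (p + r) / (p * r + q ^ 2) * (p * r + q ^ 2) = c * q * (p + r) :=
      div_mul_cancel₀ _ hs.ne'
    generalize c * q * (p + r) / (p * r + q ^ 2) = k at *
    rw [f0]
    have hx2 : k * c * (p * r + q ^ 2) * (p + r) = 4 * (p * r) * q := by
      linear_combination c * (p + r) * hx + q * (p + r) ^ 2 * hcc + q * hc2
    linear_combination (p * r + q ^ 2) * (c + k * y) * f2
      + (4 * (p * r) * q + (p * r + q ^ 2) * (p + r) * y) * W * y * hx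
      - c * W * ((p * r + q ^ 2) + q * (p + r) * y) * hx2

/-- The action on the lower side of the cell of a symmetric matrix. -/
theorem klein_smul_lower {b : SL(2, ℝ)} (hb : b 0 1 = b 1 0) {β : ℝ}
    (hβ : β * tr b = 2 * b 0 1) : ∃ k : ℝ, |k| < 1 ∧ ∀ z : ℍ, (klein z).2 = -β →
      klein (b • z) = (boost (√(1 - β ^ 2)) k (klein z).1, β) := by
  have hd := det_eq b
  have ht := tr_ne_zero_of_symm hb
  rw [← hb] at hd
  set p := b 0 0
  set q := b 0 1
  set r := b 1 1
  have htr : tr b = p + r := rfl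
  rw [htr] at hβ ht
  set D := (p ^ 2 + r ^ 2 - 2 * q ^ 2) / 2 with hD
  set m := (p ^ 2 - r ^ 2) / 2 with hm
  have hD2 : D = ((p - r) ^ 2 + 2) / 2 := by rw [hD]; linear_combination hd
  have hs : 0 < D := by rw [hD2]; positivity
  have hc2 : (1 - β ^ 2) * (p + r) ^ 2 = (p - r) ^ 2 + 4 := by
    linear_combination (-β * (p + r) - 2 * q) * hβ + 4 * hd
  have hc : 0 < 1 - β ^ 2 := by
    have : 0 < (p + r) ^ 2 := by positivity
    by_contra hneg
    nlinarith [sq_nonneg (p - r)]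
  set c := √(1 - β ^ 2) with hcdef
  have hc0 : 0 < c := Real.sqrt_pos.mpr hc
  have hcc : c ^ 2 = 1 - β ^ 2 := Real.sq_sqrt hc.le
  have hcm : (c * m) ^ 2 = (p - r) ^ 2 * ((p - r) ^ 2 + 4) / 4 := by
    rw [hm]
    linear_combination ((p ^ 2 - r ^ 2) / 2) ^ 2 * hcc + (p - r) ^ 2 / 4 * hc2
  -- With `s = (p - r)²`, the squares of numerator and denominator are `s (s + 4) / 4` and `(s + 2)²
  -- / 4`, which differ by `1`.
  have hcsq : |c * m / D| < 1 := by
    rw [← sq_lt_one_iff_abs_lt_one, div_pow, div_lt_one (by positivity), hcm, hD2]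
    nlinarith
  refine ⟨c * m / D, hcsq, fun z hz => ?_⟩
  have h0 := formHeight_pos z
  have hz' := formHeight_pos (b • z)
  have hy : |(klein z).1| ≤ c := abs_le_sqrt (by
    have := (klein_sq_lt z).le
    rw [hz, neg_sq, add_comm] at this
    exact this)
  have hden := boost_denom_pos hc0 hcsq hy
  have e0 := formHeight_smul b (1, 0, 1) z
  have e1 := formHeight_smul b (1, 0, -1) z
  have e2 := formHeight_smul b (0, 1, 0) z
  rw [formHeight_decomp (pullForm _ _)] at e0 e1 e2
  simp only [pullForm, ← hb] at e0 e1 e2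
  change _ = (_, β)
  have hk1 : formHeight (1, 0, -1) z = (klein z).1 * formHeight (1, 0, 1) z := by
    rw [klein]; field_simp
  have hk2 : formHeight (0, 1, 0) z = -β * formHeight (1, 0, 1) z := by
    rw [← hz, klein]; field_simp
  rw [hk1, hk2] at e0 e1 e2
  generalize (klein z).1 = y at *
  generalize formHeight (1, 0, 1) z = W at *
  rw [klein]
  have f0 : formHeight (1, 0, 1) (b • z) = (D + m * y) * W := by
    rw [e0, hD, hm]
    linear_combination (-q * W) * hβ
  have f1 : (p + r) * formHeight (1, 0, -1) (b • z)
      = (m * ((p - r) ^ 2 + 4) / (p + r) + D * (p + r) * y) * W := by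
    have hm' : m / (p + r) = (p - r) / 2 := by rw [hm]; field_simp; ring
    rw [mul_div_right_comm, hm', e1, hD]
    have : (p - r) ^ 2 + 4 = (p + r) ^ 2 - 4 * q ^ 2 := by linear_combination -4 * hd
    rw [this]
    linear_combination (-q * (p - r) * W) * hβ
  have f2 : formHeight (0, 1, 0) (b • z) = β * formHeight (1, 0, 1) (b • z) := by
    rw [e2, f0, hD, hm]
    apply mul_left_cancel₀ ht
    linear_combination (-(p * r + q ^ 2) * W - ((p ^ 2 + r ^ 2 - 2 * q ^ 2) / 2
      + (p ^ 2 - r ^ 2) / 2 * y) * W) * hβ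
  ext
  · change formHeight (1, 0, -1) (b • z) / formHeight (1, 0, 1) (b • z) = boost c _ y
    rw [boost, div_eq_div_iff hz'.ne' hden.ne']
    apply mul_left_cancel₀ (mul_ne_zero ht hs.ne')
    have hx : c * m / D * D = c * m := div_mul_cancel₀ _ hs.ne'
    generalize c * m / D = k at *
    rw [f0]
    have hx2 : k * c * D * (p + r) = m * ((p - r) ^ 2 + 4) / (p + r) := by
      rw [eq_div_iff ht]
      linear_combination c * (p + r) ^ 2 * hx + m * (p + r) ^ 2 * hcc + m * hc2
    linear_combination D * (c + k * y) * f1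
      + (m * ((p - r) ^ 2 + 4) / (p + r) + D * (p + r) * y) * W * y * hx
      - c * W * (D + m * y) * hx2
  · change formHeight (0, 1, 0) (b • z) / formHeight (1, 0, 1) (b • z) = β
    rw [f2, mul_div_assoc, div_self hz'.ne', mul_one]

end KleinModel

-- The quotient is a one-holed torus

section OneHoledTorus

theorem continuous_smul_upperHalfPlane (w : PSL2R) : Continuous fun z : ℍ => w • z := by
  obtain ⟨a, rfl⟩ := QuotientGroup.mk_surjective w
  exact continuous_const_smul a

/-- The quotient by a normal pair with positive parameters, conjugated by `u`. -/
theorem isOneHoledTorus_of_pos {a b u : SL(2, ℝ)} {G : Subgroup PSL2R}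
    (h : IsNormalPair (u * a * u⁻¹) (u * b * u⁻¹))
    (hα : 0 < ((u * a * u⁻¹) 0 0 - (u * a * u⁻¹) 1 1) / tr (u * a * u⁻¹))
    (hβ : 0 < 2 * (u * b * u⁻¹) 0 1 / tr (u * b * u⁻¹))
    (hG : Subgroup.closure {(QuotientGroup.mk a : PSL2R), (QuotientGroup.mk b : PSL2R)} = G) :
    IsOneHoledTorus (QuotientSurface G) := by
  have hforms := h.pairsForms.conj u
  have ha0 := tr_ne_zero_of_symm h.symm_left
  have hb0 := tr_ne_zero_of_symm h.symm_right
  obtain ⟨hα1, hβ1⟩ := h.sq_lt_one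
  have hαβ := h.one_lt
  have eα : ((u * a * u⁻¹) 0 0 - (u * a * u⁻¹) 1 1) / tr (u * a * u⁻¹) * tr (u * a * u⁻¹)
    = (u * a * u⁻¹) 0 0 - (u * a * u⁻¹) 1 1 := div_mul_cancel₀ _ ha0
  have eβ : 2 * (u * b * u⁻¹) 0 1 / tr (u * b * u⁻¹) * tr (u * b * u⁻¹)
    = 2 * (u * b * u⁻¹) 0 1 := div_mul_cancel₀ _ hb0
  generalize ((u * a * u⁻¹) 0 0 - (u * a * u⁻¹) 1 1) / tr (u * a * u⁻¹) = α at *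
  generalize 2 * (u * b * u⁻¹) 0 1 / tr (u * b * u⁻¹) = β at *
  have hα1' : α < 1 := by nlinarith
  have hβ1' : β < 1 := by nlinarith
  obtain ⟨k, hk, hka⟩ := klein_smul_left h.symm_left eα
  obtain ⟨l, hl, hlb⟩ := klein_smul_lower h.symm_right eβ
  obtain ⟨P, hP⟩ := exists_isTorusModel hα hα1' hβ hβ1' hαβ hk hl
  set A : Fin 2 → SL(2, ℝ) := fun i => u⁻¹ * ![u * a * u⁻¹, u * b * u⁻¹] i * u with hA
  have hA0 : A 0 = a := by
    change u⁻¹ * (u * a * u⁻¹) * u = a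
    group
  have hA1 : A 1 = b := by
    change u⁻¹ * (u * b * u⁻¹) * u = b
    group
  set E : Set ℍ := formCell fun l => pullForm u (normalForms α β l) with hE
  have hclosure : Subgroup.closure (range fun i => (QuotientGroup.mk (A i) : PSL2R)) = G := by
    rw [← hG]
    congr 1
    ext x
    simp only [mem_range, Fin.exists_fin_two, hA0, hA1, mem_insert_iff, mem_singleton_iff,
      eq_comm (b := x)]
  have hmemE : ∀ z, z ∈ E ↔ klein (u • z) ∈ closedCell α β := by
    intro z
    rw [← mem_formCell_normalForms hα hβ]
    simp only [hE, formCell, mem_ofPred_eq, formHeight_smul]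
  have hnorm : ∀ z ∈ E, 1 / 4 < ‖P (klein (u • z))‖ := fun z hz =>
    (hP.lt_norm_iff _ ((hmemE z).mp hz)).mpr (klein_sq_lt _)
  have hucont : Continuous fun z : ℍ => u • z := continuous_const_smul u
  let f : E → OneHoledTorus := fun z => ⟨P (klein (u • (z : ℍ))), hnorm z z.2⟩
  have hEcl : IsClosed E := isClosed_formCell _
  have hfc : Continuous f := by
    refine Continuous.subtype_mk ?_ _
    refine hP.continuousOn.comp_continuous
      (continuous_klein.comp (hucont.comp continuous_subtype_val)) fun z => (hmemE z).mp z.2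
  have hcellcl : IsClosed (closedCell α β) := by
    have c1 : Continuous fun e : ℝ × ℝ => |e.1| := by fun_prop
    have c2 : Continuous fun e : ℝ × ℝ => |e.2| := by fun_prop
    have c3 : Continuous fun e : ℝ × ℝ => e.1 ^ 2 + e.2 ^ 2 := by fun_prop
    exact (isClosed_le c1 continuous_const).inter
      ((isClosed_le c2 continuous_const).inter (isClosed_le c3 continuous_const))
  have hcellcpt : IsCompact (closedCell α β) := by
    refine (isCompact_closedBall (0 : ℝ × ℝ) 1).of_isClosed_subset hcellcl ?_
    rintro ⟨x, y⟩ ⟨hx, hy, -⟩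
    rw [mem_closedBall_zero_iff, Prod.norm_mk, Real.norm_eq_abs, Real.norm_eq_abs]
    exact max_le (hx.trans hα1'.le) (hy.trans hβ1'.le)
  -- `P` is defined on the compact cell including its arcs on the unit circle. The closure of the
  -- Klein image there has compact image under `P`, and the added circle points map into the removed
  -- disc.
  have hfcl : IsClosedMap f := by
    intro V hV
    set V' : Set ℍ := (fun z : E => u • (z : ℍ)) '' V with hV'
    have hV'cl : IsClosed V' := by
      have h1 : IsClosed ((↑) '' V : Set ℍ) := hEcl.isClosedEmbedding_subtypeVal.isClosedMap _ hV
      have h2 : V' = (fun z : ℍ => u⁻¹ • z) ⁻¹' ((↑) '' V : Set ℍ) := by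
        ext z
        constructor
        · rintro ⟨v, hv, rfl⟩
          exact ⟨v, hv, (inv_smul_smul u _).symm⟩
        · rintro ⟨v, hv, hvz⟩
          refine ⟨v, hv, ?_⟩
          change u • (v : ℍ) = z
          rw [hvz]
          exact smul_inv_smul u z
      rw [h2]
      exact h1.preimage (continuous_const_smul u⁻¹)
    have hsub : closure (klein '' V') ⊆ closedCell α β := by
      refine closure_minimal ?_ hcellcl
      rintro _ ⟨_, ⟨v, -, rfl⟩, rfl⟩
      exact (hmemE v).mp v.2
    have hcpt : IsCompact (closure (klein '' V')) := hcellcpt.of_isClosed_subset isClosed_closure hsub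
    have himg : IsClosed (P '' closure (klein '' V')) :=
      (hcpt.image_of_continuousOn (hP.continuousOn.mono hsub)).isClosed
    have : f '' V = Subtype.val ⁻¹' (P '' closure (klein '' V')) := by
      ext p
      constructor
      · rintro ⟨v, hv, rfl⟩
        exact ⟨_, subset_closure ⟨_, ⟨v, hv, rfl⟩, rfl⟩, rfl⟩
      · rintro ⟨e, he, hep⟩
        have hlt : e.1 ^ 2 + e.2 ^ 2 < 1 :=
          (hP.lt_norm_iff e (hsub he)).mp (by rw [hep]; exact p.2)
        obtain ⟨_, ⟨v, hv, rfl⟩, rfl⟩ := exists_of_mem_closure_klein hV'cl hlt he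
        exact ⟨v, hv, Subtype.ext hep⟩
    rw [this]
    exact himg.preimage continuous_subtype_val
  have hfsurj : Function.Surjective f := by
    rintro ⟨p, hp⟩
    obtain ⟨e, he, rfl⟩ := hP.exists_eq p hp
    obtain ⟨z, -, rfl⟩ := exists_klein_eq ((hP.lt_norm_iff e he).mp hp)
    have hz : u • u⁻¹ • z = z := smul_inv_smul u z
    refine ⟨⟨u⁻¹ • z, (hmemE _).mpr (by rwa [hz])⟩, Subtype.ext ?_⟩
    change P (klein (u • u⁻¹ • z)) = P (klein z)
    rw [hz]
  have hfq : Topology.IsQuotientMap f := hfcl.isQuotientMap hfc hfsurj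
  have hρ : Topology.IsQuotientMap
      (fun e : E => (Quotient.mk (MulAction.orbitRel G ℍ) (e : ℍ))) := by
    refine isQuotientMap_mk_of_cover (Γ := G) (fun γ => continuous_smul_upperHalfPlane (γ : PSL2R)) hEcl
      fun z => ?_
    obtain ⟨U, hU, W, hWf, hWG, hW⟩ := hforms.exists_finite_cover z
    rw [hclosure] at hWG
    refine ⟨U, hU, (↑) ⁻¹' W, hWf.preimage Subtype.val_injective.injOn, fun y hy => ?_⟩
    obtain ⟨w, hw, hwy⟩ := hW y hy
    exact ⟨⟨w, hWG hw⟩, hw, hwy⟩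
  have hside : ∀ z z' : ℍ,
      (∃ i, formHeight (pullForm u (normalForms α β (i, false))) z = 0 ∧
        (QuotientGroup.mk (A i) : PSL2R) • z = z') ↔
      Glued α β (boost (√(1 - α ^ 2)) k) (boost (√(1 - β ^ 2)) l) (klein (u • z))
        (klein (u • z')) := by
    intro z z'
    obtain ⟨-, n2, -, n4⟩ := formHeight_normalForms α β (u • z)
    have hW := formHeight_pos (u • z)
    have hconj : ∀ x : SL(2, ℝ), u • x • z = (u * x * u⁻¹) • u • z := by
      intro x
      rw [← mul_smul, ← mul_smul]
      congr 1
      group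
    have hinj : ∀ x : SL(2, ℝ), (QuotientGroup.mk x : PSL2R) • z = z' ↔
        klein ((u * x * u⁻¹) • u • z) = klein (u • z') := by
      intro x
      rw [klein_injective.eq_iff, ← hconj, smul_left_cancel_iff, mk_smul_upperHalfPlane]
    rw [Fin.exists_fin_two, ← formHeight_smul, ← formHeight_smul, n2, n4, hA0, hA1, hinj, hinj, Glued]
    refine or_congr ?_ ?_
    · rw [mul_eq_zero_iff_left (mul_pos hα hW).ne', add_comm, ← eq_neg_iff_add_eq_zero]
      refine and_congr_right fun h1 => ?_
      rw [hka _ h1, Prod.ext_iff, eq_comm, eq_comm (b := (klein (u • z')).2)]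
    · rw [mul_eq_zero_iff_left (mul_pos hβ hW).ne', add_comm, ← eq_neg_iff_add_eq_zero]
      refine and_congr_right fun h1 => ?_
      rw [hlb _ h1, Prod.ext_iff]
      constructor
      · rintro ⟨h2, h3⟩; exact ⟨h3.symm, h2.symm⟩
      · rintro ⟨h2, h3⟩; exact ⟨h3.symm, h2.symm⟩
  -- Both maps out of the cell are quotient maps, and both identify exactly equal points and points
  -- matched by the side pairings.
  refine nonempty_homeomorph_of_isQuotientMap hρ hfq fun e e' => ?_
  have h1 := hforms.smul_mem_formCell_iff e.2 e'.2
  rw [hclosure] at h1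
  have h2 := hP.eq_iff _ ((hmemE e).mp e.2) _ ((hmemE e').mp e'.2) (klein_sq_lt _) (klein_sq_lt _)
  rw [← hside, ← hside, klein_injective.eq_iff, smul_left_cancel_iff] at h2
  have h3 : f e = f e' ↔ P (klein (u • (e : ℍ))) = P (klein (u • (e' : ℍ))) := Subtype.ext_iff
  rw [h3, h2, ← exists_or, ← h1, Quotient.eq, MulAction.orbitRel_apply, MulAction.mem_orbit_iff]
  constructor
  · rintro ⟨γ, hγ⟩
    exact ⟨(γ : PSL2R)⁻¹, inv_mem γ.2, by rw [← hγ]; exact inv_smul_smul (γ : PSL2R) _⟩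
  · rintro ⟨w, hw, hwe⟩
    exact ⟨⟨w⁻¹, inv_mem hw⟩, by rw [← hwe]; exact inv_smul_smul w _⟩

theorem IsNormalPair.inv_left {a b : SL(2, ℝ)} (h : IsNormalPair a b) : IsNormalPair a⁻¹ b := by
  obtain ⟨i1, i2, i3, i4⟩ := inv_entries a
  refine ⟨by rw [i2, i3, h.symm_left], h.symm_right, ?_⟩
  have := h.one_lt
  rw [tr_inv, i1, i4, ← neg_sub, neg_div, neg_sq]
  exact this

theorem IsNormalPair.inv_right {a b : SL(2, ℝ)} (h : IsNormalPair a b) : IsNormalPair a b⁻¹ := by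
  obtain ⟨i1, i2, i3, i4⟩ := inv_entries b
  refine ⟨h.symm_left, by rw [i2, i3, h.symm_right], ?_⟩
  have := h.one_lt
  rw [tr_inv, i2, mul_neg, neg_div, neg_sq]
  exact this

theorem closure_pair_inv_left {Γ : Type*} [Group Γ] (x y : Γ) :
    Subgroup.closure {x⁻¹, y} = Subgroup.closure {x, y} := by
  apply le_antisymm <;> rw [Subgroup.closure_le]
  · rintro _ (rfl | rfl)
    · exact inv_mem (Subgroup.subset_closure (by simp))
    · exact Subgroup.subset_closure (by simp)
  · rintro _ (rfl | rfl)
    · exact inv_mem_iff.mp (Subgroup.subset_closure (by simp))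
    · exact Subgroup.subset_closure (by simp)

/-- A two generator group with `tr [a, b] < -2` uniformizes a one-holed torus. -/
theorem isOneHoledTorus_of_commDet {a b : SL(2, ℝ)} {G : Subgroup PSL2R} (h : 4 < commDet a b)
    (hG : Subgroup.closure {(QuotientGroup.mk a : PSL2R), (QuotientGroup.mk b : PSL2R)} = G) :
    IsOneHoledTorus (QuotientSurface G) := by
  obtain ⟨u, hu⟩ := exists_conj_isNormalPair h
  clear h
  -- Replacing a generator by its inverse changes the sign of its parameter. Neither parameter is
  -- zero, since the squares are below `1` and their sum exceeds `1`.
  wlog hα : 0 < ((u * a * u⁻¹) 0 0 - (u * a * u⁻¹) 1 1) / tr (u * a * u⁻¹) generalizing a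
  · have e : u * a⁻¹ * u⁻¹ = (u * a * u⁻¹)⁻¹ := by group
    refine this (a := a⁻¹) ?_ ?_ ?_
    · rw [QuotientGroup.mk_inv, closure_pair_inv_left, hG]
    · rw [e]; exact hu.inv_left
    · rw [e]
      obtain ⟨i1, -, -, i4⟩ := inv_entries (u * a * u⁻¹)
      rw [tr_inv, i1, i4, ← neg_sub, neg_div]
      have hne : ((u * a * u⁻¹) 0 0 - (u * a * u⁻¹) 1 1) / tr (u * a * u⁻¹) ≠ 0 := by
        intro h0
        have h1 := hu.one_lt
        have h2 := hu.sq_lt_one.2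
        rw [h0] at h1
        linarith
      have := lt_of_le_of_ne (not_lt.mp hα) hne
      linarith
  wlog hβ : 0 < 2 * (u * b * u⁻¹) 0 1 / tr (u * b * u⁻¹) generalizing b
  · have e : u * b⁻¹ * u⁻¹ = (u * b * u⁻¹)⁻¹ := by group
    refine this (b := b⁻¹) ?_ ?_ ?_
    · rw [QuotientGroup.mk_inv, Set.pair_comm, closure_pair_inv_left, Set.pair_comm, hG]
    · rw [e]; exact hu.inv_right
    · rw [e]
      obtain ⟨-, i2, -, -⟩ := inv_entries (u * b * u⁻¹)
      rw [tr_inv, i2, mul_neg, neg_div]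
      have hne : 2 * (u * b * u⁻¹) 0 1 / tr (u * b * u⁻¹) ≠ 0 := by
        intro h0
        have h1 := hu.one_lt
        have h2 := hu.sq_lt_one.1
        rw [h0] at h1
        linarith
      have := lt_of_le_of_ne (not_lt.mp hβ) hne
      linarith
  exact isOneHoledTorus_of_pos hu hα hβ hG

end OneHoledTorus

-- Assembling the theorem

/-- These three consequences of ping-pong with the Jordan curves are the information about `G` on
which both parts of the theorem draw. -/
theorem IsFuchsianSchottky.exists_generators {g : ℕ} {G : Subgroup PSL2R}
    (hG : IsFuchsianSchottky g G) (hg : 2 ≤ g) :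
    (∃ A : Fin g → PSL2R, Generates A G) ∧
    (∀ w : SL(2, ℝ), (QuotientGroup.mk w : PSL2R) ∈ G → (QuotientGroup.mk w : PSL2R) ≠ 1 →
      4 < tr w ^ 2) ∧ ∃ x ∈ G, ∃ y ∈ G, x * y ≠ y * x := by
  obtain ⟨-, A, hA, hP⟩ := hG
  obtain ⟨C, K, D, -, hpp⟩ := hP.exists_pingPong fun C hC => hC.isClosed
  refine ⟨⟨A, hA⟩, fun w hw hw1 => hpp.four_lt_trace_sq w (by rwa [← hA] at hw) hw1, ?_⟩
  have hmem : ∀ i, A i ∈ G := fun i => hA ▸ Subgroup.subset_closure ⟨i, rfl⟩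
  exact ⟨_, hmem ⟨0, by omega⟩, _, hmem ⟨1, by omega⟩, hpp.not_commute (by simp)⟩

/-- Generators with intersecting axes can be lifted to matrices with `tr [a, b] < -2`. -/
theorem exists_commDet_of_crossing {G : Subgroup PSL2R}
    (hH : ∀ w : SL(2, ℝ), (QuotientGroup.mk w : PSL2R) ∈ G → (QuotientGroup.mk w : PSL2R) ≠ 1 →
      4 < tr w ^ 2)
    (hnc : ∃ x ∈ G, ∃ y ∈ G, x * y ≠ y * x) {A B : PSL2R} (hAB : Subgroup.closure {A, B} = G)
    (hax : (axis A ∩ axis B).Nonempty) : ∃ a b : SL(2, ℝ), 4 < commDet a b ∧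
      Subgroup.closure {(QuotientGroup.mk a : PSL2R), (QuotientGroup.mk b : PSL2R)} = G := by
  obtain ⟨a, rfl⟩ := QuotientGroup.mk_surjective A
  obtain ⟨b, rfl⟩ := QuotientGroup.mk_surjective B
  exact ⟨a, b, four_lt_commDet hH hnc hAB hax, hAB⟩

end FuchsianSchottky

end

theorem theorem2 (g : ℕ) (hg : 2 ≤ g) (G : Subgroup FuchsianSchottky.PSL2R)
    (hG : FuchsianSchottky.IsFuchsianSchottky g G) :
    (¬ FuchsianSchottky.IsOneHoledTorus (FuchsianSchottky.QuotientSurface G) →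
      ∃ A : Fin g → FuchsianSchottky.PSL2R,
        FuchsianSchottky.Generates A G ∧ ¬ FuchsianSchottky.IsClassicalOn G A) ∧
    ((∀ A : Fin g → FuchsianSchottky.PSL2R,
        FuchsianSchottky.Generates A G → FuchsianSchottky.IsClassicalOn G A) ↔
      g = 2 ∧ ∃ A B : FuchsianSchottky.PSL2R,
        FuchsianSchottky.IsHyperbolic A ∧ FuchsianSchottky.IsHyperbolic B ∧
        Subgroup.closure {A, B} = G ∧
        (FuchsianSchottky.axis A ∩ FuchsianSchottky.axis B).Nonempty) := by
  obtain ⟨⟨A₀, hA₀⟩, hH, hnc⟩ := hG.exists_generators hg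
  refine ⟨fun hS => ?_, fun hcl => ?_, ?_⟩
  · by_contra! hcl
    obtain ⟨-, A, B, -, -, hAB, hax⟩ :=
      FuchsianSchottky.crossing_of_always_classical hg hH hcl hA₀
    obtain ⟨a, b, h, hab⟩ := FuchsianSchottky.exists_commDet_of_crossing hH hnc hAB hax
    exact hS (FuchsianSchottky.isOneHoledTorus_of_commDet h hab)
  · exact FuchsianSchottky.crossing_of_always_classical hg hH hcl hA₀
  · rintro ⟨rfl, A, B, -, -, hAB, hax⟩ P hP
    obtain ⟨a, b, h, hab⟩ := FuchsianSchottky.exists_commDet_of_crossing hH hnc hAB hax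
    exact FuchsianSchottky.isClassicalOn_of_commDet h hab hP
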